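/- A house allocation instance consists of a finite set $N$ of $n$ agents, a finite set $O$ of objects, and for each agent $i$ a preference list, i.e. a set of acceptable objects with a weak order $\succ_i$ (ties allowed); being unmatched is worse than any acceptable object. Let $m$ be the number of acceptable agent-object pairs. A matching gives each agent at most one acceptable object and each object to at most one agent. A matching $M$ is $k$-stable if there is no other matching $M'$ with $|\{i\in N : M'(i)\succ_i M(i)\}|\ge k$; it is majority stable if it is $\frac{n+1}{2}$-stable. A list is dichotomous if it has at most two ties (good and bad objects), and complete if all objects are acceptable. Theorem. 1. If each agent's preference list is a single tie, then every maximum size matching is majority stable; in particular a majority stable matching exists. One can be found in $O(\sqrt n\,m)$ time. 2. If each agent's preference list is dichotomous and complete and $|O|\ge|N|$, then every maximum size matching $F$ of the graph of first-choice edges can be extended to a matching that matches all agents, and every such extension of $F$ is majority stable; in particular a majority stable matching exists. One can be found in $O(\sqrt n\,m)$ time. 3. If each agent's preference list is dichotomous and complete and $|O|<|N|$, then a $\left(\frac{2n}{3}+1\right)$-stable matching exists, and one can be found in $O(\sqrt n\,m)$ time. Running times are for a random access machine with unit-cost instructions (constants, addition, subtraction, indirect load and store, jumps) on words of $O(\log(n+|O|+m))$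 bits and zero-initialised memory, which is given $n$, $|O|$, $m$ and the $m$ acceptable pairs with the positions of their ties, listed in any order; the bound is $C(\sqrt n\,m+1)$ steps for a constant $C$, where the $+1$ matters only if $m=0$. -/

import Mathlib

universe u v

/-! ### House allocation with ties and possibly incomplete preference lists -/

/-- A house allocation instance with agents `N` and objects `O`. The preference list of agent `i`
consists of the objects in `acc i`, arranged in consecutive ties; `rank i o` is the position
(starting from `0`) of the tie that contains the acceptable object `o`. No position is skipped.
The value of `rank i o` is irrelevant if `o` is not acceptable to `i`. -/
structure HAInstance (N : Type*) (O : Type*) where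
  acc : N → Finset O
  rank : N → O → ℕ
  rank_dense : ∀ i, ∀ o ∈ acc i, ∀ r < rank i o, ∃ o' ∈ acc i, rank i o' = r

namespace HAInstance

/-- The number of matched agents. -/
def matchingSize {N O : Type*} [Fintype N] (M : N → Option O) : ℕ :=
  (Finset.univ.filter fun i => (M i).isSome = true).card

section

variable {N O : Type*} (I : HAInstance N O)

/-- `o ≻ᵢ o'`, for acceptable objects `o` and `o'`. -/
def Prefers (i : N) (o o' : O) : Prop :=
  o ∈ I.acc i ∧ o' ∈ I.acc i ∧ I.rank i o < I.rank i o'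

/-- Comparison of outcomes for an agent, `none` meaning being unmatched: being unmatched is worse
than every acceptable object. -/
def PrefersOutcome (i : N) : Option O → Option O → Prop
  | some o, some o' => I.Prefers i o o'
  | some o, none => o ∈ I.acc i
  | none, _ => False

/-- Each agent gets at most one object, which is acceptable, and each object is given to at most
one agent. -/
def IsMatching (M : N → Option O) : Prop :=
  (∀ i o, M i = some o → o ∈ I.acc i) ∧
    ∀ i j o, M i = some o → M j = some o → i = j

open Classical in
/-- The number of agents `i` with `M' i ≻ᵢ M i`. -/
noncomputable def numImproving [Fintype N] (M M' : N → Option O) : ℕ :=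
  (Finset.univ.filter fun i => I.PrefersOutcome i (M' i) (M i)).card

/-- `M` is a `k`-stable matching. -/
def KStable [Fintype N] (k : ℝ) (M : N → Option O) : Prop :=
  I.IsMatching M ∧
    ¬ ∃ M' : N → Option O, I.IsMatching M' ∧ M' ≠ M ∧ k ≤ (I.numImproving M M' : ℝ)

/-- `M` is a majority stable matching. -/
def MajorityStable [Fintype N] (M : N → Option O) : Prop :=
  I.KStable (((Fintype.card N : ℝ) + 1) / 2) M

/-- A matching of maximum size in the acceptability graph. -/
def IsMaximumMatching [Fintype N] (M : N → Option O) : Prop :=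
  I.IsMatching M ∧ ∀ M', I.IsMatching M' → matchingSize M' ≤ matchingSize M

/-- `o` is a most preferred acceptable object of `i`. -/
def IsFirstChoice (i : N) (o : O) : Prop :=
  o ∈ I.acc i ∧ ∀ o' ∈ I.acc i, ¬ I.Prefers i o' o

/-- A matching in the graph that contains only the first-choice edges of each agent. -/
def IsFirstChoiceMatching (M : N → Option O) : Prop :=
  I.IsMatching M ∧ ∀ i o, M i = some o → I.IsFirstChoice i o

/-- A matching of maximum size in the graph of first-choice edges. -/
def IsMaximumFirstChoiceMatching [Fintype N] (M : N → Option O) : Prop :=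
  I.IsFirstChoiceMatching M ∧
    ∀ M', I.IsFirstChoiceMatching M' → matchingSize M' ≤ matchingSize M

/-- `M` is obtained from the matching `F` by giving an object to every agent unmatched in `F`. -/
def IsCompletionOf (M F : N → Option O) : Prop :=
  I.IsMatching M ∧ (∀ i o, F i = some o → M i = some o) ∧ ∀ i, M i ≠ none

/-- Every preference list is a single tie. -/
def SingleTie : Prop :=
  ∀ i, ∀ o ∈ I.acc i, ∀ o' ∈ I.acc i, I.rank i o = I.rank i o'

/-- Every agent classifies the acceptable objects as good (position `0`) or bad (position `1`). -/
def Dichotomous : Prop :=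
  ∀ i, ∀ o ∈ I.acc i, I.rank i o ≤ 1

/-- Every agent finds every object acceptable. -/
def CompleteLists : Prop :=
  ∀ i o, o ∈ I.acc i

/-- The number `m` of acceptable agent-object pairs. -/
def numPairs [Fintype N] : ℕ :=
  ∑ i, (I.acc i).card

/-- `e` lists every acceptable agent-object pair exactly once, in any order. -/
def IsListing (e : List (N × O)) : Prop :=
  e.Nodup ∧ ∀ p : N × O, p ∈ e ↔ p.2 ∈ I.acc p.1

end

end HAInstance

/-! ### Random access machines -/

/-- The instructions of a random access machine with registers `0, 1, 2, …` and an
array of memory cells, all holding natural numbers. -/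
inductive RAMInstr where
  /-- `r := c` -/
  | const (r c : ℕ)
  /-- `r := s + t` -/
  | add (r s t : ℕ)
  /-- `r := s - t`, truncated at `0` -/
  | sub (r s t : ℕ)
  /-- `r := mem[s]` -/
  | load (r s : ℕ)
  /-- `mem[r] := s` -/
  | store (r s : ℕ)
  /-- go to instruction `l` -/
  | jump (l : ℕ)
  /-- go to instruction `l` if `s < t` -/
  | jumpLt (s t l : ℕ)

/-- A program; execution starts at instruction `0` and halts when the program counter leaves the
program. -/
abbrev RAMProgram := List RAMInstr

structure RAMConfig where
  pc : ℕ
  reg : ℕ → ℕ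
  mem : ℕ → ℕ

namespace RAMConfig

/-- The effect of a single instruction. -/
def exec (c : RAMConfig) : RAMInstr → RAMConfig
  | .const r v => ⟨c.pc + 1, Function.update c.reg r v, c.mem⟩
  | .add r s t => ⟨c.pc + 1, Function.update c.reg r (c.reg s + c.reg t), c.mem⟩
  | .sub r s t => ⟨c.pc + 1, Function.update c.reg r (c.reg s - c.reg t), c.mem⟩
  | .load r s => ⟨c.pc + 1, Function.update c.reg r (c.mem (c.reg s)), c.mem⟩
  | .store r s => ⟨c.pc + 1, c.reg, Function.update c.mem (c.reg r) (c.reg s)⟩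
  | .jump l => ⟨l, c.reg, c.mem⟩
  | .jumpLt s t l => ⟨if c.reg s < c.reg t then l else c.pc + 1, c.reg, c.mem⟩

/-- One step of the program `P`; a halted configuration is left unchanged. -/
def step (P : RAMProgram) (c : RAMConfig) : RAMConfig :=
  match P[c.pc]? with
  | some ins => c.exec ins
  | none => c

/-- No register and no memory cell holds a number larger than `B`. -/
def BoundedBy (B : ℕ) (c : RAMConfig) : Prop :=
  (∀ r, c.reg r ≤ B) ∧ ∀ a, c.mem a ≤ B

end RAMConfig

namespace HAInstance

/-- The initial configuration for an instance with `n` agents, `q` objects and the listing `e` of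
the `m` acceptable pairs. Registers `0, 1, 2` hold `n, q, m`. Cells `3 j, 3 j + 1, 3 j + 2`
hold the agent, the object and the rank of the `j`-th listed pair, for `j < m`. Everything else
is `0`. -/
def initialConfig {n q : ℕ} (I : HAInstance (Fin n) (Fin q)) (e : List (Fin n × Fin q)) :
    RAMConfig where
  pc := 0
  reg := fun r => if r = 0 then n else if r = 1 then q else if r = 2 then e.length else 0
  mem := fun a =>
    match e[a / 3]? with
    | none => 0
    | some (i, o) =>
        if a % 3 = 0 then (i : ℕ) else if a % 3 = 1 then (o : ℕ) else I.rank i o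

/-- The `n` cells after the `3 m` input cells hold the matching `M`: the cell of agent `i` is `0`
if `i` is unmatched and `o + 1` if `i` is matched to `o`. -/
def Outputs {n q : ℕ} (c : RAMConfig) (m : ℕ) (M : Fin n → Option (Fin q)) : Prop :=
  ∀ i : Fin n, c.mem (3 * m + i) =
    match M i with
    | none => 0
    | some o => (o : ℕ) + 1

/-- There is one program that, for every instance satisfying `Restriction` with `n` agents, `q`
objects and `m` acceptable pairs, presented by any listing of these pairs, halts after
`O(√n m)` steps (a constant number of steps if there are no acceptable pairs) with an output
matching `M` satisfying `Goal`; all numbers occurring are at most `C (n + q + m + 1)`, so that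
words of `O(log (n + q + m))` bits suffice. -/
def FoundInSqrtTime
    (Restriction : ∀ {n q : ℕ}, HAInstance (Fin n) (Fin q) → Prop)
    (Goal : ∀ {n q : ℕ}, HAInstance (Fin n) (Fin q) → (Fin n → Option (Fin q)) → Prop) : Prop :=
  ∃ (P : RAMProgram) (C : ℕ), ∀ (n q : ℕ) (I : HAInstance (Fin n) (Fin q))
    (e : List (Fin n × Fin q)), I.IsListing e → Restriction I →
      ∃ (t : ℕ) (M : Fin n → Option (Fin q)),
        (t : ℝ) ≤ C * (Real.sqrt n * I.numPairs + 1) ∧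
        P.length ≤ ((RAMConfig.step P)^[t] (I.initialConfig e)).pc ∧
        (∀ s ≤ t, ((RAMConfig.step P)^[s] (I.initialConfig e)).BoundedBy
          (C * (n + q + I.numPairs + 1))) ∧
        Outputs ((RAMConfig.step P)^[t] (I.initialConfig e)) I.numPairs M ∧
        Goal I M

end HAInstance

/-!
Let `M` arise from a maximum first-choice matching `F` by adding pairs until none can be added. If
all lists are single ties, then `F` is a maximum matching and so is `M`, and only agents unmatched
in `M` can prefer another matching. With dichotomous and complete lists, an agent that prefers a
matching `M'` either is unmatched in `M`, or exchanges a bad object for a good one. Agents of the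
second kind are unmatched in `F`, and their pairs in `M'` form a first-choice matching, so there are
at most `min |F| (|M| - |F|)` of them. As `|M|` is `min |N| |O|`, this leaves at most `n / 2`
improving agents if `|O| ≥ n`, and at most `2 n / 3` in any case.

To find such a matching in time `O(√n m)`, let agents bid for first choices in an auction with `K`
price levels, where `K` is about `√n`. This takes time `O(K m)`. For each level `t`, a maximum
first-choice matching exceeds the outcome by at most the number of matched agents of level `t`;
averaging over the levels, by at most `n / K`. The missing pairs are gained one by one by
depth-first searches for augmenting paths in time `O(m)` each, and one scan of all pairs completes
the matching.
-/

namespace HAInstance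

section Stability

variable {N O : Type*} {I : HAInstance N O}

/-- `M` contains all pairs of the matching `F`. -/
def Extends (M F : N → Option O) : Prop :=
  ∀ i o, F i = some o → M i = some o

/-- A matching to which no acceptable pair can be added. -/
def IsMaximalMatching (I : HAInstance N O) (M : N → Option O) : Prop :=
  I.IsMatching M ∧ ∀ i, ∀ o ∈ I.acc i, M i ≠ none ∨ ∃ j, M j = some o

/-- A matching that first serves as many first choices as possible and is then extended until no
pair can be added. The stable matchings of all three parts of the theorem are of this kind. -/
def IsGreedyMatching [Fintype N] (I : HAInstance N O) (M : N → Option O) : Prop :=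
  ∃ F, I.IsMaximumFirstChoiceMatching F ∧ Extends M F ∧ I.IsMaximalMatching M

theorem isFirstChoice_iff {i : N} {o : O} :
    I.IsFirstChoice i o ↔ o ∈ I.acc i ∧ I.rank i o = 0 := by
  constructor
  · rintro ⟨h, h'⟩
    refine ⟨h, ?_⟩
    by_contra hne
    obtain ⟨o', ho', hr⟩ := I.rank_dense i o h 0 (Nat.pos_of_ne_zero hne)
    exact h' o' ho' ⟨ho', h, by omega⟩
  · rintro ⟨h, h'⟩
    exact ⟨h, fun o' _ hp => by have := hp.2.2; omega⟩

theorem SingleTie.isFirstChoice (h : I.SingleTie) {i : N} {o : O} (ho : o ∈ I.acc i) :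
    I.IsFirstChoice i o :=
  ⟨ho, fun o' ho' hp => hp.2.2.ne (h i o' ho' o ho)⟩

theorem PrefersOutcome.exists_eq_some {i : N} {x y : Option O} (h : I.PrefersOutcome i x y) :
    ∃ o, x = some o := by
  cases x with
  | none => exact h.elim
  | some o => exact ⟨o, rfl⟩

theorem IsMatching.update [DecidableEq N] {M : N → Option O} (hM : I.IsMatching M) {i : N} {o : O}
    (ho : o ∈ I.acc i) (hfree : ∀ j, M j ≠ some o) :
    I.IsMatching (Function.update M i (some o)) := by
  have hval : ∀ j x, Function.update M i (some o) j = some x →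
      (j = i ∧ o = x) ∨ M j = some x := by
    intro j x
    by_cases hj : j = i <;> simp +contextual [hj]
  refine ⟨fun j x hx => ?_, fun j k x hj hk => ?_⟩
  · rcases hval j x hx with ⟨rfl, rfl⟩ | h
    · exact ho
    · exact hM.1 j x h
  · rcases hval j x hj with ⟨rfl, rfl⟩ | h <;> rcases hval k _ hk with ⟨rfl, hx⟩ | h'
    · rfl
    · exact absurd h' (hfree k)
    · exact absurd h (hx ▸ hfree j)
    · exact hM.2 j k x h h'

variable [Fintype N]

theorem card_unmatched_add_matchingSize (M : N → Option O) :
    (Finset.univ.filter fun i => M i = none).card + matchingSize M = Fintype.card N := by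
  classical
  have h := Finset.card_filter_add_card_filter_not (s := Finset.univ) (fun i => M i = none)
  simpa only [matchingSize, ← ne_eq, Option.ne_none_iff_isSome, Finset.card_univ] using h

theorem matchingSize_eq_card_iff {M : N → Option O} :
    matchingSize M = Fintype.card N ↔ ∀ i, M i ≠ none := by
  have h := card_unmatched_add_matchingSize M
  have hempty : (Finset.univ.filter fun i => M i = none).card = 0 ↔ ∀ i, M i ≠ none := by
    simp [Finset.filter_eq_empty_iff]
  rw [← hempty]
  omega

theorem Extends.matchingSize_le {F M : N → Option O} (h : Extends M F) :
    matchingSize F ≤ matchingSize M :=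
  Finset.card_le_card <| Finset.monotone_filter_right _ fun i _ hi =>
    let ⟨o, ho⟩ := Option.isSome_iff_exists.1 hi
    Option.isSome_iff_exists.2 ⟨o, h i o ho⟩

theorem matchingSize_lt_update [DecidableEq N] {M : N → Option O} {i : N} (hi : M i = none)
    (o : O) : matchingSize M < matchingSize (Function.update M i (some o)) := by
  refine Finset.card_lt_card ((Finset.ssubset_iff_of_subset fun j hj => ?_).2
    ⟨i, by simp, by simp [hi]⟩)
  by_cases hji : j = i
  · simp [hji]
  · simpa [Function.update_apply, hji] using hj

theorem IsMatching.matchingSize_le_card [Fintype O] {M : N → Option O} (hM : I.IsMatching M) :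
    matchingSize M ≤ Fintype.card O := by
  classical
  let s := Finset.univ.filter fun i => (M i).isSome = true
  have hs : ∀ i : s, ∃ o, M i = some o := fun i =>
    Option.isSome_iff_exists.1 (Finset.mem_filter.1 i.2).2
  choose f hf using hs
  rw [matchingSize, ← Fintype.card_coe]
  exact Fintype.card_le_of_injective f fun i j h =>
    Subtype.ext (hM.2 i j _ (hf i) (h ▸ hf j))

theorem card_le_matchingSize_of_forall_matched [Fintype O] {M : N → Option O}
    (h : ∀ o, ∃ i, M i = some o) : Fintype.card O ≤ matchingSize M := by
  choose g hg using h
  rw [← Finset.card_univ]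
  refine Finset.card_le_card_of_injOn g (fun o _ => by simp [hg]) fun o _ o' _ h => ?_
  simpa [hg] using congrArg M h

theorem IsMaximalMatching.matchingSize_eq_min [Fintype O] (hc : I.CompleteLists)
    {M : N → Option O} (hM : I.IsMaximalMatching M) :
    matchingSize M = min (Fintype.card N) (Fintype.card O) := by
  have hN := card_unmatched_add_matchingSize M
  have hO := hM.1.matchingSize_le_card
  by_cases h : ∀ i, M i ≠ none
  · have := matchingSize_eq_card_iff.2 h
    omega
  · push Not at h
    obtain ⟨i, hi⟩ := h
    have := card_le_matchingSize_of_forall_matched fun o =>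
      (hM.2 i o (hc i o)).resolve_left (· hi)
    omega

theorem exists_maximum (p : (N → Option O) → Prop) (hp : ∃ M, p M) :
    ∃ M, p M ∧ ∀ M', p M' → matchingSize M' ≤ matchingSize M := by
  have hfin : (matchingSize '' {M | p M}).Finite :=
    (Set.finite_Iic (Fintype.card N)).subset <| Set.image_subset_iff.2 fun M _ =>
      Finset.card_le_univ _
  obtain ⟨M, hM⟩ := Set.Finite.exists_maximalFor' matchingSize {M | p M} hfin hp
  exact ⟨M, hM.1, fun M' hM' => not_lt.1 fun h => (hM.2 hM' h.le).not_gt h⟩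

theorem exists_isMaximumFirstChoiceMatching (I : HAInstance N O) :
    ∃ F, I.IsMaximumFirstChoiceMatching F :=
  exists_maximum I.IsFirstChoiceMatching
    ⟨fun _ => none, by simp [IsFirstChoiceMatching, IsMatching]⟩

omit [Fintype N] in
theorem IsMatching.exists_isMaximalMatching_extends [Finite N] {F : N → Option O}
    (hF : I.IsMatching F) : ∃ M, I.IsMaximalMatching M ∧ Extends M F := by
  classical
  cases nonempty_fintype N
  obtain ⟨M, ⟨hM, hext⟩, hmax⟩ :=
    exists_maximum (fun M => I.IsMatching M ∧ Extends M F) ⟨F, hF, fun _ _ h => h⟩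
  refine ⟨M, ⟨hM, fun i o ho => ?_⟩, hext⟩
  by_contra! hcon
  obtain ⟨hi, hfree⟩ := hcon
  refine (matchingSize_lt_update hi o).not_ge (hmax _ ⟨hM.update ho hfree, fun j x hx => ?_⟩)
  have hji : j ≠ i := by
    rintro rfl
    simp [hext j x hx] at hi
  rw [Function.update_of_ne hji, hext j x hx]

theorem exists_isGreedyMatching (I : HAInstance N O) : ∃ M, I.IsGreedyMatching M :=
  let ⟨F, hF⟩ := I.exists_isMaximumFirstChoiceMatching
  let ⟨M, hM, hext⟩ := hF.1.1.exists_isMaximalMatching_extends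
  ⟨M, F, hF, hext, hM⟩

theorem kStable_of_numImproving_lt {k : ℝ} {M : N → Option O} (hM : I.IsMatching M)
    (h : ∀ M', I.IsMatching M' → (I.numImproving M M' : ℝ) < k) : I.KStable k M :=
  ⟨hM, fun ⟨M', hM', _, hk⟩ => absurd hk (not_le.2 (h M' hM'))⟩

theorem majorityStable_of_two_mul_numImproving_le {M : N → Option O} (hM : I.IsMatching M)
    (h : ∀ M', I.IsMatching M' → 2 * I.numImproving M M' ≤ Fintype.card N) :
    I.MajorityStable M :=
  kStable_of_numImproving_lt hM fun M' hM' => by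
    have : 2 * (I.numImproving M M' : ℝ) ≤ Fintype.card N := by exact_mod_cast h M' hM'
    linarith

theorem numImproving_le_matchingSize (I : HAInstance N O) (M M' : N → Option O) :
    I.numImproving M M' ≤ matchingSize M' := by
  classical
  exact Finset.card_le_card <| Finset.monotone_filter_right _ fun i _ hi =>
    Option.isSome_iff_exists.2 hi.exists_eq_some

theorem SingleTie.numImproving_add_matchingSize_le (h : I.SingleTie) (M M' : N → Option O) :
    I.numImproving M M' + matchingSize M ≤ Fintype.card N := by
  classical
  rw [← card_unmatched_add_matchingSize M]
  refine Nat.add_le_add_right (Finset.card_le_card <|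
    Finset.monotone_filter_right _ fun i _ hi => ?_) _
  obtain ⟨o, ho⟩ := hi.exists_eq_some
  cases hMi : M i with
  | none => rfl
  | some o' =>
    rw [ho, hMi] at hi
    exact absurd (h i o hi.1 o' hi.2.1) hi.2.2.ne

theorem SingleTie.majorityStable (h : I.SingleTie) {M : N → Option O}
    (hM : I.IsMaximumMatching M) : I.MajorityStable M := by
  refine majorityStable_of_two_mul_numImproving_le hM.1 fun M' hM' => ?_
  have hunmatched := h.numImproving_add_matchingSize_le M M'
  have hmatched := (I.numImproving_le_matchingSize M M').trans (hM.2 M' hM')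
  omega

theorem SingleTie.isMaximumMatching (h : I.SingleTie) {M : N → Option O}
    (hM : I.IsGreedyMatching M) : I.IsMaximumMatching M := by
  obtain ⟨F, hF, hext, hmax⟩ := hM
  exact ⟨hmax.1, fun M' hM' =>
    (hF.2 M' ⟨hM', fun i o ho => h.isFirstChoice (hM'.1 i o ho)⟩).trans hext.matchingSize_le⟩

open Classical in
/-- The agents that have an object in `M` and get a better one in `M'`. With dichotomous lists,
they exchange a bad object for a good one. -/
noncomputable def upgradedAgents (I : HAInstance N O) (M M' : N → Option O) : Finset N :=
  Finset.univ.filter fun i => ∃ o o', M' i = some o ∧ M i = some o' ∧ I.Prefers i o o'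

theorem mem_upgradedAgents {M M' : N → Option O} {i : N} :
    i ∈ I.upgradedAgents M M' ↔ ∃ o o', M' i = some o ∧ M i = some o' ∧ I.Prefers i o o' := by
  simp [upgradedAgents]

theorem numImproving_add_matchingSize_le (I : HAInstance N O) (M M' : N → Option O) :
    I.numImproving M M' + matchingSize M ≤ Fintype.card N + (I.upgradedAgents M M').card := by
  classical
  rw [← card_unmatched_add_matchingSize M, add_right_comm]
  refine Nat.add_le_add_right
    ((Finset.card_le_card fun i hi => ?_).trans (Finset.card_union_le _ _)) _
  have himp := (Finset.mem_filter.1 hi).2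
  obtain ⟨o, ho⟩ := himp.exists_eq_some
  cases hMi : M i with
  | none => exact Finset.mem_union_left _ (by simp [hMi])
  | some o' =>
    rw [ho, hMi] at himp
    exact Finset.mem_union_right _ (mem_upgradedAgents.2 ⟨o, o', ho, hMi, himp⟩)

theorem IsMaximumFirstChoiceMatching.card_le {F M : N → Option O}
    (hF : I.IsMaximumFirstChoiceMatching F) (hM : I.IsMatching M) (S : Finset N)
    (hS : ∀ i ∈ S, ∃ o, M i = some o ∧ I.IsFirstChoice i o) : S.card ≤ matchingSize F := by
  classical
  let G : N → Option O := fun i => if i ∈ S then M i else none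
  have hG : ∀ {i o}, G i = some o → i ∈ S ∧ M i = some o := by
    intro i o
    simp only [G]
    split_ifs with hi <;> simp [hi]
  have hGF : I.IsFirstChoiceMatching G := by
    refine ⟨⟨fun i o h => hM.1 i o (hG h).2, fun i j o hi hj =>
      hM.2 i j o (hG hi).2 (hG hj).2⟩, fun i o h => ?_⟩
    obtain ⟨o', ho', hfirst⟩ := hS i (hG h).1
    obtain rfl : o = o' := Option.some_injective _ ((hG h).2.symm.trans ho')
    exact hfirst
  refine (Finset.card_le_card fun i hi => ?_).trans (hF.2 G hGF)
  obtain ⟨o, ho, -⟩ := hS i hi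
  simp [G, hi, ho]

theorem Dichotomous.card_upgradedAgents_le (hd : I.Dichotomous) {F M M' : N → Option O}
    (hF : I.IsMaximumFirstChoiceMatching F) (hM' : I.IsMatching M') :
    (I.upgradedAgents M M').card ≤ matchingSize F := by
  refine hF.card_le hM' _ fun i hi => ?_
  obtain ⟨o, o', ho, -, hacc, hacc', hlt⟩ := mem_upgradedAgents.1 hi
  have := hd i o' hacc'
  exact ⟨o, ho, isFirstChoice_iff.2 ⟨hacc, by omega⟩⟩

theorem IsFirstChoiceMatching.card_upgradedAgents_add_matchingSize_le {F M M' : N → Option O}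
    (hF : I.IsFirstChoiceMatching F) (hext : Extends M F) :
    (I.upgradedAgents M M').card + matchingSize F ≤ matchingSize M := by
  classical
  rw [matchingSize, ← Finset.card_union_of_disjoint]
  · refine Finset.card_le_card (Finset.union_subset (fun i hi => ?_) fun i hi => ?_)
    · obtain ⟨o, o', -, ho', -⟩ := mem_upgradedAgents.1 hi
      simp [ho']
    · obtain ⟨o, ho⟩ := Option.isSome_iff_exists.1 (Finset.mem_filter.1 hi).2
      simp [hext i o ho]
  · refine Finset.disjoint_left.2 fun i hi hi' => ?_
    obtain ⟨o, o', -, ho', hp⟩ := mem_upgradedAgents.1 hi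
    obtain ⟨f, hf⟩ := Option.isSome_iff_exists.1 (Finset.mem_filter.1 hi').2
    obtain rfl : f = o' := Option.some_injective _ ((hext i f hf).symm.trans ho')
    exact (hF.2 i f hf).2 o hp.1 hp

theorem IsCompletionOf.majorityStable (hd : I.Dichotomous) {F M : N → Option O}
    (hF : I.IsMaximumFirstChoiceMatching F) (hM : I.IsCompletionOf M F) :
    I.MajorityStable M := by
  refine majorityStable_of_two_mul_numImproving_le hM.1 fun M' hM' => ?_
  have himp := I.numImproving_add_matchingSize_le M M'
  have hle := hd.card_upgradedAgents_le hF (M := M) hM'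
  have hadd := hF.1.card_upgradedAgents_add_matchingSize_le hM.2.1 (M' := M')
  have hsize := matchingSize_eq_card_iff.2 hM.2.2
  omega

theorem isCompletionOf_of_isMaximalMatching [Fintype O] (hc : I.CompleteLists)
    (hcard : Fintype.card N ≤ Fintype.card O) {F M : N → Option O} (hM : I.IsMaximalMatching M)
    (hext : Extends M F) : I.IsCompletionOf M F :=
  ⟨hM.1, hext,
    matchingSize_eq_card_iff.1 ((hM.matchingSize_eq_min hc).trans (min_eq_left hcard))⟩

theorem IsGreedyMatching.majorityStable [Fintype O] (hd : I.Dichotomous) (hc : I.CompleteLists)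
    (hcard : Fintype.card N ≤ Fintype.card O) {M : N → Option O} (hM : I.IsGreedyMatching M) :
    I.MajorityStable M :=
  let ⟨_, hF, hext, hmax⟩ := hM
  (isCompletionOf_of_isMaximalMatching hc hcard hmax hext).majorityStable hd hF

theorem IsGreedyMatching.kStable [Finite O] (hd : I.Dichotomous) (hc : I.CompleteLists)
    {M : N → Option O} (hM : I.IsGreedyMatching M) :
    I.KStable (2 * (Fintype.card N : ℝ) / 3 + 1) M := by
  cases nonempty_fintype O
  obtain ⟨F, hF, hext, hmax⟩ := hM
  refine kStable_of_numImproving_lt hmax.1 fun M' hM' => ?_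
  have himp := I.numImproving_add_matchingSize_le M M'
  have hle := hd.card_upgradedAgents_le hF (M := M) hM'
  have hadd := hF.1.card_upgradedAgents_add_matchingSize_le hext (M' := M')
  have hsize := hmax.matchingSize_eq_min hc
  have hO := (I.numImproving_le_matchingSize M M').trans hM'.matchingSize_le_card
  have hthirds : 3 * I.numImproving M M' ≤ 2 * Fintype.card N := by omega
  have : 3 * (I.numImproving M M' : ℝ) ≤ 2 * Fintype.card N := by exact_mod_cast hthirds
  linarith

end Stability

end HAInstance

/-! ### Structured programs for the random access machine -/

namespace RAMCode

/-- The variables of structured programs: the sizes `n`, `q`, `m` of the input; the constants `zero`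
and `one`; the number `cap` of levels of the auction and its square `sq`; the current edge `e` and
its bound `lim`, which is `m + 1`; the current agent `c`; temporaries `p`, `o`, `i`, `g`, `l`; the
height `top` of the stack; and the flag `fnd`, which becomes `0` when the search from an agent
fails. -/
inductive Var
  | n | q | m | zero | one | cap | sq | e | lim | c | p | o | i | g | l | top | fnd
  deriving DecidableEq

/-- The register that holds a variable; registers `3, 4, 5, 6` are kept for address computations. -/
def Var.reg : Var → ℕ
  | n => 0 | q => 1 | m => 2 | zero => 7 | one => 8 | cap => 9 | sq => 10 | e => 11 | lim => 12
  | c => 13 | p => 14 | o => 15 | i => 16 | g => 17 | l => 18 | top => 19 | fnd => 20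

/-- The arrays of structured programs: the ends `agt` and `obj` of the edges; the linked lists of
the good edges of each agent, with links `nxt`, heads `hd` and current positions `ptr`; the levels
`lvl` of the agents and the prices `prc` of the objects in the auction; the matching, as `mate` of
an agent and owner `own` of an object; the marks `mrk` of the objects that a search has reached; and
the stack `stk` of the objects on its current path. -/
inductive Arr
  | agt | obj | nxt | hd | ptr | lvl | prc | mate | own | mrk | stk
  deriving DecidableEq

/-- The arrays are interleaved: entry `j` of the array with index `k` is stored `16 j + k` cells
after the end of the output. -/
def Arr.idx : Arr → ℕ
  | agt => 0 | obj => 1 | nxt => 2 | hd => 3 | ptr => 4 | lvl => 5 | prc => 6 | mate => 7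
  | own => 8 | mrk => 9 | stk => 10

theorem Var.reg_inj {x y : Var} : x.reg = y.reg ↔ x = y := by
  cases x <;> cases y <;> simp [Var.reg]

theorem Var.reg_ne (x : Var) : x.reg ≠ 3 ∧ x.reg ≠ 4 ∧ x.reg ≠ 5 ∧ x.reg ≠ 6 := by
  cases x <;> simp [Var.reg]

theorem Arr.idx_inj {x y : Arr} : x.idx = y.idx ↔ x = y := by
  cases x <;> cases y <;> simp [Arr.idx]

theorem Arr.idx_lt (x : Arr) : x.idx < 16 := by
  cases x <;> simp [Arr.idx]

/-- Structured programs; compiling them to machine code leaves their specifications free of jump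
targets and addresses. -/
inductive Cmd
  /-- `r := c` -/
  | const (r : Var) (c : ℕ)
  /-- `r := s + t` -/
  | add (r s t : Var)
  /-- `r := s - t` -/
  | sub (r s t : Var)
  /-- `r := k[s]` -/
  | load (r : Var) (k : Arr) (s : Var)
  /-- `k[r] := s` -/
  | store (k : Arr) (r s : Var)
  /-- `r` becomes entry `col` of the input triple number `s` -/
  | inp (r : Var) (col : Fin 3) (s : Var)
  /-- output cell number `r` becomes `s` -/
  | out (r s : Var)
  | seq (a b : Cmd)
  /-- if `s < t` then `a` else `b` -/
  | ite (s t : Var) (a b : Cmd)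
  /-- while `s < t` do `a` -/
  | loop (s t : Var) (a : Cmd)

instance : Append Cmd := ⟨Cmd.seq⟩

/-- States of structured programs. -/
structure St where
  v : Var → ℕ
  a : Arr → ℕ → ℕ
  out : ℕ → ℕ

namespace St

def setV (s : St) (r : Var) (x : ℕ) : St := { s with v := Function.update s.v r x }

def setA (s : St) (k : Arr) (j x : ℕ) : St :=
  { s with a := Function.update s.a k (Function.update (s.a k) j x) }

def setOut (s : St) (j x : ℕ) : St := { s with out := Function.update s.out j x }

variable (s : St) (r r' : Var) (k k' : Arr) (j x : ℕ)

theorem setV_v : (s.setV r x).v r' = if r' = r then x else s.v r' := by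
  simp [setV, Function.update_apply]
theorem setV_a : (s.setV r x).a k = s.a k := rfl
theorem setV_out : (s.setV r x).out = s.out := rfl
theorem setA_v : (s.setA k j x).v r = s.v r := rfl
theorem setA_a : (s.setA k j x).a k' = if k' = k then Function.update (s.a k) j x else s.a k' := by
  unfold setA
  by_cases h : k' = k
  · subst h; simp
  · simp [h]
theorem setA_out : (s.setA k j x).out = s.out := rfl
theorem setOut_v : (s.setOut j x).v r = s.v r := rfl
theorem setOut_a : (s.setOut j x).a k = s.a k := rfl
theorem setOut_out : (s.setOut j x).out = Function.update s.out j x := rfl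

end St

/-- The data that a run depends on: the numbers `n` of agents, `q` of objects and `m` of input
triples, the triples themselves (agent, object, rank), and a bound `B` for the numbers that
occur. -/
structure Env where
  n : ℕ
  q : ℕ
  m : ℕ
  B : ℕ
  inp : Fin 3 → ℕ → ℕ
  size_le : 4 * n + 2 * m + q + 16 ≤ B
  agt_lt : ∀ j < m, inp 0 j < n
  obj_lt : ∀ j < m, inp 1 j < q
  rank_le : ∀ j < m, inp 2 j ≤ B

theorem Env.inp_le (E : Env) (col : Fin 3) (j : ℕ) (hj : j < E.m) : E.inp col j ≤ E.B := by
  have hB := E.size_le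
  have hagt := E.agt_lt j hj
  have hobj := E.obj_lt j hj
  have hrank := E.rank_le j hj
  fin_cases col <;> simp only [Fin.reduceFinMk, Fin.zero_eta, Fin.mk_one] at * <;> omega

/-- `Runs E a s s' t`: started in `s`, the program `a` ends in `s'` after `t` steps, and no number
that is computed exceeds the bound. -/
inductive Runs (E : Env) : Cmd → St → St → ℕ → Prop
  | const (r c s) : c ≤ E.B → Runs E (.const r c) s (s.setV r c) 1
  | add (r x y s) : s.v x + s.v y ≤ E.B → Runs E (.add r x y) s (s.setV r (s.v x + s.v y)) 1
  | sub (r x y s) : Runs E (.sub r x y) s (s.setV r (s.v x - s.v y)) 1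
  | load (r k x s) : Runs E (.load r k x) s (s.setV r (s.a k (s.v x))) 1
  | store (k r x s) : Runs E (.store k r x) s (s.setA k (s.v r) (s.v x)) 1
  | inp (r col x s) : s.v x < E.m → Runs E (.inp r col x) s (s.setV r (E.inp col (s.v x))) 1
  | out (r x s) : s.v r < E.n → Runs E (.out r x) s (s.setOut (s.v r) (s.v x)) 1
  | seq {a b s s' s'' t t'} : Runs E a s s' t → Runs E b s' s'' t' →
      Runs E (.seq a b) s s'' (t + t')
  | ite_true {x y a b s s' t} : s.v x < s.v y → Runs E a s s' t → Runs E (.ite x y a b) s s' (t + 1)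
  | ite_false {x y a b s s' t} : ¬ s.v x < s.v y → Runs E b s s' t →
      Runs E (.ite x y a b) s s' (t + 1)
  | loop_false {x y a s} : ¬ s.v x < s.v y → Runs E (.loop x y a) s s 1
  | loop_true {x y a s s' s'' t t'} : s.v x < s.v y → Runs E a s s' t →
      Runs E (.loop x y a) s' s'' t' → Runs E (.loop x y a) s s'' (t + t' + 1)

/-- The weakest precondition for termination in a state and after a time that satisfy `Q`. -/
def wp (E : Env) (a : Cmd) (Q : St → ℕ → Prop) (s : St) : Prop :=
  ∃ s' t, Runs E a s s' t ∧ Q s' t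

section wp

variable {E : Env} {Q : St → ℕ → Prop} {s : St}

theorem wp_const {r c} : wp E (.const r c) Q s ↔ c ≤ E.B ∧ Q (s.setV r c) 1 :=
  ⟨fun ⟨_, _, h, hQ⟩ => by cases h; exact ⟨‹_›, hQ⟩, fun h => ⟨_, _, .const _ _ _ h.1, h.2⟩⟩

theorem wp_add {r x y} :
    wp E (.add r x y) Q s ↔ s.v x + s.v y ≤ E.B ∧ Q (s.setV r (s.v x + s.v y)) 1 :=
  ⟨fun ⟨_, _, h, hQ⟩ => by cases h; exact ⟨‹_›, hQ⟩, fun h => ⟨_, _, .add _ _ _ _ h.1, h.2⟩⟩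

theorem wp_sub {r x y} : wp E (.sub r x y) Q s ↔ Q (s.setV r (s.v x - s.v y)) 1 :=
  ⟨fun ⟨_, _, h, hQ⟩ => by cases h; exact hQ, fun h => ⟨_, _, .sub _ _ _ _, h⟩⟩

theorem wp_load {r k x} : wp E (.load r k x) Q s ↔ Q (s.setV r (s.a k (s.v x))) 1 :=
  ⟨fun ⟨_, _, h, hQ⟩ => by cases h; exact hQ, fun h => ⟨_, _, .load _ _ _ _, h⟩⟩

theorem wp_store {k r x} : wp E (.store k r x) Q s ↔ Q (s.setA k (s.v r) (s.v x)) 1 :=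
  ⟨fun ⟨_, _, h, hQ⟩ => by cases h; exact hQ, fun h => ⟨_, _, .store _ _ _ _, h⟩⟩

theorem wp_inp {r col x} :
    wp E (.inp r col x) Q s ↔ s.v x < E.m ∧ Q (s.setV r (E.inp col (s.v x))) 1 :=
  ⟨fun ⟨_, _, h, hQ⟩ => by cases h; exact ⟨‹_›, hQ⟩, fun h => ⟨_, _, .inp _ _ _ _ h.1, h.2⟩⟩

theorem wp_out {r x} :
    wp E (.out r x) Q s ↔ s.v r < E.n ∧ Q (s.setOut (s.v r) (s.v x)) 1 :=
  ⟨fun ⟨_, _, h, hQ⟩ => by cases h; exact ⟨‹_›, hQ⟩, fun h => ⟨_, _, .out _ _ _ h.1, h.2⟩⟩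

theorem wp_seq {a b} :
    wp E (a ++ b) Q s ↔ wp E a (fun s' t => wp E b (fun s'' t' => Q s'' (t + t')) s') s :=
  ⟨fun ⟨_, _, (h : Runs E (.seq a b) _ _ _), hQ⟩ => by
    cases h with | seq h h' => exact ⟨_, _, h, _, _, h', hQ⟩,
    fun ⟨_, _, h, _, _, h', hQ⟩ => ⟨_, _, .seq h h', hQ⟩⟩

theorem wp_ite {x y a b} : wp E (.ite x y a b) Q s ↔
    if s.v x < s.v y then wp E a (fun s' t => Q s' (t + 1)) s
    else wp E b (fun s' t => Q s' (t + 1)) s := by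
  split_ifs with hc
  · exact ⟨fun ⟨_, _, h, hQ⟩ => by
      cases h with
      | ite_true _ h => exact ⟨_, _, h, hQ⟩
      | ite_false h' _ => exact absurd hc h', fun ⟨_, _, h, hQ⟩ => ⟨_, _, .ite_true hc h, hQ⟩⟩
  · exact ⟨fun ⟨_, _, h, hQ⟩ => by
      cases h with
      | ite_true h' _ => exact absurd h' hc
      | ite_false _ h => exact ⟨_, _, h, hQ⟩, fun ⟨_, _, h, hQ⟩ => ⟨_, _, .ite_false hc h, hQ⟩⟩

theorem wp_mono {a} {Q' : St → ℕ → Prop} (h : wp E a Q s) (hQ : ∀ s' t, Q s' t → Q' s' t) :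
    wp E a Q' s := by
  obtain ⟨s', t, hr, hq⟩ := h
  exact ⟨s', t, hr, hQ _ _ hq⟩

/-- The potential `Φ` pays for the steps. -/
theorem wp_loop {x y a} (I : St → Prop) (Φ : St → ℕ) (hs : I s)
    (hbody : ∀ s, I s → s.v x < s.v y → wp E a (fun s' t => I s' ∧ t + 1 + Φ s' ≤ Φ s) s)
    (hQ : ∀ s' t, I s' → ¬ s'.v x < s'.v y → t + Φ s' ≤ Φ s + 1 → Q s' t) :
    wp E (.loop x y a) Q s := by
  suffices h : ∀ N s, Φ s < N → I s →
      wp E (.loop x y a) (fun s' t => I s' ∧ ¬ s'.v x < s'.v y ∧ t + Φ s' ≤ Φ s + 1) s from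
    wp_mono (h _ s (Nat.lt_succ_self _) hs) fun s' t h => hQ s' t h.1 h.2.1 h.2.2
  intro N
  induction N with
  | zero => exact fun s hN => absurd hN (Nat.not_lt_zero _)
  | succ N ih =>
    intro s hN hI
    by_cases hc : s.v x < s.v y
    · obtain ⟨s₁, t₁, h₁, hI₁, hΦ⟩ := hbody s hI hc
      obtain ⟨s₂, t₂, h₂, hI₂, hc₂, hΦ₂⟩ := ih s₁ (by omega) hI₁
      exact ⟨s₂, _, .loop_true hc h₁ h₂, hI₂, hc₂, by omega⟩
    · exact ⟨s, 1, .loop_false hc, hI, hc, by omega⟩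

end wp

/-! ### Compilation -/

open RAMInstr RAMConfig

/-- Code that computes the address of the cell `s` of the array `k` into register `3`. -/
def addrCode (k : Arr) (s : Var) : RAMProgram :=
  [add 3 s.reg s.reg, add 3 3 3, add 3 3 3, add 3 3 3, const 4 k.idx, add 3 3 4, add 3 3 5]

/-- The machine code of a structured program that is placed at position `k`. -/
def compile : ℕ → Cmd → RAMProgram
  | _, .const r c => [const r.reg c]
  | _, .add r x y => [add r.reg x.reg y.reg]
  | _, .sub r x y => [sub r.reg x.reg y.reg]
  | _, .load r k x => addrCode k x ++ [load r.reg 3]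
  | _, .store k r x => addrCode k r ++ [store 3 x.reg]
  | _, .inp r col x =>
      [add 3 x.reg x.reg, add 3 3 x.reg, const 4 col, add 3 3 4, load r.reg 3]
  | _, .out r x => [add 3 6 r.reg, store 3 x.reg]
  | k, .seq a b => compile k a ++ compile (k + (compile k a).length) b
  | k, .ite x y a b =>
      let cb := compile (k + 1) b
      let ca := compile (k + 2 + cb.length) a
      jumpLt x.reg y.reg (k + 2 + cb.length) :: (cb ++ jump (k + 2 + cb.length + ca.length) :: ca)
  | k, .loop x y a =>
      let ca := compile (k + 2) a
      jumpLt x.reg y.reg (k + 2) :: jump (k + 3 + ca.length) :: (ca ++ [jump k])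

/-- The program `P` contains the code `l` at position `k`. -/
def CodeAt (P : RAMProgram) (k : ℕ) (l : RAMProgram) : Prop :=
  ∀ j ins, l[j]? = some ins → P[k + j]? = some ins

theorem CodeAt.cons {P k x l} (h : CodeAt P k (x :: l)) :
    P[k]? = some x ∧ CodeAt P (k + 1) l :=
  ⟨h 0 x rfl, fun j ins hj => by
    have := h (j + 1) ins (by simpa using hj)
    rwa [show k + 1 + j = k + (j + 1) by omega]⟩

theorem CodeAt.append {P k l l'} (h : CodeAt P k (l ++ l')) :
    CodeAt P k l ∧ CodeAt P (k + l.length) l' := by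
  refine ⟨fun j ins hj => h j ins ?_, fun j ins hj => ?_⟩
  · rw [List.getElem?_append_left (List.getElem?_eq_some_iff.1 hj).1]
    exact hj
  · rw [add_assoc]
    refine h _ ins ?_
    rw [List.getElem?_append_right (by omega)]
    simpa using hj

/-- `c'` is reached from `c` in `t` steps through configurations bounded by `b`. -/
def Reach (P : RAMProgram) (b : ℕ) (c : RAMConfig) (t : ℕ) (c' : RAMConfig) : Prop :=
  (step P)^[t] c = c' ∧ ∀ s ≤ t, BoundedBy b ((step P)^[s] c)

section Reach

variable {P : RAMProgram} {b : ℕ} {c c' c'' : RAMConfig} {t t' : ℕ}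

theorem Reach.refl (h : BoundedBy b c) : Reach P b c 0 c :=
  ⟨rfl, fun s hs => by rwa [Nat.le_zero.1 hs]⟩

theorem Reach.trans (h : Reach P b c t c') (h' : Reach P b c' t' c'') :
    Reach P b c (t + t') c'' := by
  refine ⟨by rw [add_comm, Function.iterate_add_apply, h.1, h'.1], fun s hs => ?_⟩
  rcases le_total s t with hst | hst
  · exact h.2 s hst
  · obtain ⟨d, rfl⟩ := Nat.exists_eq_add_of_le hst
    rw [add_comm, Function.iterate_add_apply, h.1]
    exact h'.2 d (by omega)

theorem Reach.bounded (h : Reach P b c t c') : BoundedBy b c' := h.1 ▸ h.2 t le_rfl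

theorem Reach.step {ins} (h : BoundedBy b c) (hP : P[c.pc]? = some ins)
    (hb : BoundedBy b (c.exec ins)) : Reach P b c 1 (c.exec ins) := by
  have hs : RAMConfig.step P c = c.exec ins := by simp [RAMConfig.step, hP]
  refine ⟨hs, fun s hs' => ?_⟩
  rcases (by omega : s = 0 ∨ s = 1) with rfl | rfl
  · exact h
  · rw [Function.iterate_one, hs]
    exact hb

/-- The code contains no jumps and computes no number above `b`. -/
def Safe (b : ℕ) : RAMProgram → RAMConfig → Prop
  | [], _ => True
  | ins :: l, c => (match ins with
      | const _ v => v ≤ b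
      | add _ s t => c.reg s + c.reg t ≤ b
      | jump _ => False
      | jumpLt _ _ _ => False
      | _ => True) ∧ Safe b l (c.exec ins)

theorem boundedBy_reg (h : BoundedBy b c) {r x pc : ℕ} (hx : x ≤ b) :
    BoundedBy b ⟨pc, Function.update c.reg r x, c.mem⟩ := by
  refine ⟨fun r' => ?_, h.2⟩
  by_cases hr : r' = r
  · subst hr; simpa using hx
  · simpa [hr] using h.1 r'

theorem Reach.of_safe : ∀ (l : RAMProgram) (c : RAMConfig), BoundedBy b c → Safe b l c →
    CodeAt P c.pc l → Reach P b c l.length (l.foldl exec c)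
  | [], _, h, _, _ => Reach.refl h
  | ins :: l, c, h, hs, hP => by
    have hexec : BoundedBy b (c.exec ins) ∧ (c.exec ins).pc = c.pc + 1 := by
      cases ins with
      | const r v => exact ⟨boundedBy_reg h hs.1, rfl⟩
      | add r s t => exact ⟨boundedBy_reg h hs.1, rfl⟩
      | sub r s t => exact ⟨boundedBy_reg h ((Nat.sub_le _ _).trans (h.1 _)), rfl⟩
      | load r s => exact ⟨boundedBy_reg h (h.2 _), rfl⟩
      | store r s =>
        refine ⟨⟨h.1, fun a => ?_⟩, rfl⟩
        by_cases ha : a = c.reg r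
        · simpa [RAMConfig.exec, ha] using h.1 s
        · simpa [RAMConfig.exec, ha] using h.2 a
      | jump _ => exact hs.1.elim
      | jumpLt _ _ _ => exact hs.1.elim
    rw [List.length_cons, add_comm, List.foldl_cons]
    refine (Reach.step h hP.cons.1 hexec.1).trans (Reach.of_safe l _ hexec.1 hs.2 ?_)
    rw [hexec.2]
    exact hP.cons.2

end Reach

/-- The machine configuration `c` represents the state `s`. -/
structure Sim (E : Env) (s : St) (c : RAMConfig) : Prop where
  reg : ∀ x : Var, c.reg x.reg = s.v x
  base : c.reg 5 = 3 * E.m + E.n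
  base' : c.reg 6 = 3 * E.m
  inp : ∀ (col : Fin 3) (j), j < E.m → c.mem (3 * j + col) = E.inp col j
  out : ∀ i < E.n, c.mem (3 * E.m + i) = s.out i
  arr : ∀ (k : Arr) (i), c.mem (3 * E.m + E.n + 16 * i + k.idx) = s.a k i
  le_v : ∀ x, s.v x ≤ E.B
  le_a : ∀ k i, s.a k i ≤ E.B

theorem Sim.setV {E : Env} {s : St} {c : RAMConfig} (h : Sim E s c) {r : Var} {x : ℕ}
    (hx : x ≤ E.B) {c' : RAMConfig} (hm : c'.mem = c.mem)
    (hr : ∀ j, j ≠ 3 → j ≠ 4 → c'.reg j = Function.update c.reg r.reg x j) :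
    Sim E (s.setV r x) c' where
  reg y := by
    rw [hr _ y.reg_ne.1 y.reg_ne.2.1, St.setV_v, Function.update_apply, h.reg]
    simp only [Var.reg_inj]
  base := by rw [hr _ (by simp) (by simp), Function.update_of_ne r.reg_ne.2.2.1.symm, h.base]
  base' := by rw [hr _ (by simp) (by simp), Function.update_of_ne r.reg_ne.2.2.2.symm, h.base']
  inp := by rw [hm]; exact h.inp
  out := by rw [hm]; exact h.out
  arr := by rw [hm]; exact h.arr
  le_v y := by
    rw [St.setV_v]
    split_ifs
    · exact hx
    · exact h.le_v y
  le_a := h.le_a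

theorem Sim.of_reg {E : Env} {s : St} {c c' : RAMConfig} (h : Sim E s c)
    (hm : c'.mem = c.mem) (hr : c'.reg = c.reg) : Sim E s c' :=
  ⟨by rw [hr]; exact h.reg, by rw [hr]; exact h.base, by rw [hr]; exact h.base',
    by rw [hm]; exact h.inp, by rw [hm]; exact h.out, by rw [hm]; exact h.arr, h.le_v, h.le_a⟩

theorem Sim.setA {E : Env} {s : St} {c : RAMConfig} (h : Sim E s c) {k : Arr} {j : ℕ} {x : Var}
    {c' : RAMConfig}
    (hm : c'.mem = Function.update c.mem (3 * E.m + E.n + 16 * j + k.idx) (s.v x))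
    (hr : ∀ j, j ≠ 3 → j ≠ 4 → c'.reg j = c.reg j) :
    Sim E (s.setA k j (s.v x)) c' where
  reg y := by rw [hr _ y.reg_ne.1 y.reg_ne.2.1, St.setA_v, h.reg]
  base := by rw [hr _ (by simp) (by simp), h.base]
  base' := by rw [hr _ (by simp) (by simp), h.base']
  inp col i hi := by
    have := col.isLt
    rw [hm, Function.update_of_ne (by omega), h.inp col i hi]
  out i hi := by rw [hm, Function.update_of_ne (by omega), h.out i hi]; rfl
  arr k' i := by
    have h1 := k.idx_lt
    have h2 := k'.idx_lt
    rw [hm, Function.update_apply, St.setA_a, h.arr]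
    by_cases hk : k' = k
    · subst hk
      rw [if_pos rfl, Function.update_apply]
      congr 1
      exact propext ⟨fun _ => by omega, fun h => by rw [h]⟩
    · rw [if_neg hk, if_neg]
      intro h'
      exact hk (Arr.idx_inj.1 (by omega))
  le_v := h.le_v
  le_a k' i := by
    rw [St.setA_a]
    split_ifs
    · rw [Function.update_apply]
      split_ifs
      · exact h.le_v x
      · exact h.le_a _ _
    · exact h.le_a _ _

theorem Sim.setOut {E : Env} {s : St} {c : RAMConfig} (h : Sim E s c) {j : ℕ} (hj : j < E.n)
    {x : ℕ} {c' : RAMConfig} (hm : c'.mem = Function.update c.mem (3 * E.m + j) x)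
    (hr : ∀ j, j ≠ 3 → c'.reg j = c.reg j) :
    Sim E (s.setOut j x) c' where
  reg y := by rw [hr _ y.reg_ne.1, St.setOut_v, h.reg]
  base := by rw [hr _ (by simp), h.base]
  base' := by rw [hr _ (by simp), h.base']
  inp col i hi := by
    have := col.isLt
    rw [hm, Function.update_of_ne (by omega), h.inp col i hi]
  out i hi := by
    rw [hm, St.setOut_out, Function.update_apply, Function.update_apply, h.out i hi]
    congr 1
    exact propext ⟨fun _ => by omega, fun h => by rw [h]⟩
  arr k' i := by rw [hm, Function.update_of_ne (by omega), h.arr]; rfl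
  le_v := h.le_v
  le_a := h.le_a

theorem addrCode_spec {E : Env} {s : St} {c : RAMConfig} (h : Sim E s c) (k : Arr) (x : Var) :
    Safe (32 * E.B) (addrCode k x) c ∧
      ((addrCode k x).foldl exec c).reg 3 = 3 * E.m + E.n + 16 * s.v x + k.idx ∧
      ((addrCode k x).foldl exec c).mem = c.mem ∧
      ∀ j, j ≠ 3 → j ≠ 4 → ((addrCode k x).foldl exec c).reg j = c.reg j := by
  have hidx := k.idx_lt
  have hx := h.le_v x
  have hB := E.size_le
  refine ⟨?_, ?_, rfl, ?_⟩
  · simp [addrCode, Safe, RAMConfig.exec, h.reg, h.base]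
    omega
  · simp [addrCode, RAMConfig.exec, h.reg, h.base]
    omega
  · intro j hj hj'
    simp [addrCode, RAMConfig.exec, hj, hj']

theorem Safe.append {b : ℕ} : ∀ {l l' : RAMProgram} {c : RAMConfig}, Safe b l c →
    Safe b l' (l.foldl exec c) → Safe b (l ++ l') c
  | [], _, _, _, h' => h'
  | _ :: _, _, _, h, h' => ⟨h.1, Safe.append h.2 h'⟩

theorem pc_foldl_exec {b : ℕ} : ∀ {l : RAMProgram} {c : RAMConfig}, Safe b l c →
    (l.foldl exec c).pc = c.pc + l.length
  | [], _, _ => rfl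
  | ins :: l, c, h => by
    rw [List.foldl_cons, pc_foldl_exec h.2, List.length_cons]
    cases ins with
    | jump _ => exact h.1.elim
    | jumpLt _ _ _ => exact h.1.elim
    | _ => simp only [RAMConfig.exec]; omega

/-- The code of `a`, wherever it is placed, takes every configuration that represents `s` to one
that represents `s'`, spending at most `10` machine steps for each of the `t` steps of `a`. -/
def Simulates (E : Env) (a : Cmd) (s s' : St) (t : ℕ) : Prop :=
  ∀ (P : RAMProgram) (c : RAMConfig), Sim E s c → BoundedBy (32 * E.B) c →
    CodeAt P c.pc (compile c.pc a) →
    ∃ t' c', t' ≤ 10 * t ∧ Reach P (32 * E.B) c t' c' ∧ Sim E s' c' ∧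
      c'.pc = c.pc + (compile c.pc a).length

section Simulates

variable {E : Env} {s s' s'' : St} {a b : Cmd} {x y r : Var} {k : Arr} {t t' : ℕ}

theorem Reach.simulate {P : RAMProgram} {l : RAMProgram} {c : RAMConfig}
    (hb : BoundedBy (32 * E.B) c) (hs : Safe (32 * E.B) l c) (hP : CodeAt P c.pc l)
    (hl : l.length ≤ 10) (h' : Sim E s' (l.foldl exec c)) :
    ∃ t' c', t' ≤ 10 * 1 ∧ Reach P (32 * E.B) c t' c' ∧ Sim E s' c' ∧
      c'.pc = c.pc + l.length :=
  ⟨_, _, by omega, Reach.of_safe l c hb hs hP, h', pc_foldl_exec hs⟩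

theorem Simulates.const {v : ℕ} (hv : v ≤ E.B) :
    Simulates E (.const r v) s (s.setV r v) 1 := fun P c hS hb hP =>
  Reach.simulate hb ⟨by simp only; omega, trivial⟩ hP (by simp [compile])
    (hS.setV hv rfl fun _ _ _ => rfl)

theorem Simulates.add (h : s.v x + s.v y ≤ E.B) :
    Simulates E (.add r x y) s (s.setV r (s.v x + s.v y)) 1 := fun P c hS hb hP =>
  Reach.simulate hb ⟨by simp only [hS.reg]; omega, trivial⟩ hP (by simp [compile])
    (hS.setV h rfl fun _ _ _ => by simp [compile, RAMConfig.exec, hS.reg])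

theorem Simulates.sub : Simulates E (.sub r x y) s (s.setV r (s.v x - s.v y)) 1 :=
  fun P c hS hb hP => Reach.simulate hb ⟨trivial, trivial⟩ hP (by simp [compile])
    (hS.setV ((Nat.sub_le _ _).trans (hS.le_v x)) rfl fun _ _ _ => by
      simp [compile, RAMConfig.exec, hS.reg])

theorem Simulates.load : Simulates E (.load r k x) s (s.setV r (s.a k (s.v x))) 1 := by
  intro P c hS hb hP
  obtain ⟨hsafe, haddr, hmem, hreg⟩ := addrCode_spec hS k x
  refine Reach.simulate hb (hsafe.append ⟨trivial, trivial⟩) hP (by simp [compile, addrCode])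
    (hS.setV (hS.le_a k _) ?_ fun j hj hj' => ?_)
  · simpa [compile, RAMConfig.exec] using hmem
  · simp only [compile, List.foldl_append, List.foldl_cons, List.foldl_nil, RAMConfig.exec]
    rw [haddr, hmem, hS.arr]
    by_cases hr : j = r.reg
    · simp [hr]
    · simp [hr, hreg j hj hj']

theorem Simulates.store : Simulates E (.store k r x) s (s.setA k (s.v r) (s.v x)) 1 := by
  intro P c hS hb hP
  obtain ⟨hsafe, haddr, hmem, hreg⟩ := addrCode_spec hS k r
  refine Reach.simulate hb (hsafe.append ⟨trivial, trivial⟩) hP (by simp [compile, addrCode])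
    (hS.setA ?_ fun j hj hj' => ?_)
  · simp only [compile, List.foldl_append, List.foldl_cons, List.foldl_nil, RAMConfig.exec]
    rw [haddr, hmem, hreg _ x.reg_ne.1 x.reg_ne.2.1, hS.reg]
  · simpa [compile, RAMConfig.exec] using hreg j hj hj'

theorem Simulates.inp {col : Fin 3} (hx : s.v x < E.m) :
    Simulates E (.inp r col x) s (s.setV r (E.inp col (s.v x))) 1 := by
  intro P c hS hb hP
  have hxB := hS.le_v x
  have hcol := col.isLt
  have hne := x.reg_ne
  have hB := E.size_le
  refine Reach.simulate hb ?_ hP (by simp [compile])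
    (hS.setV (E.inp_le col _ hx) ?_ fun j hj hj' => ?_)
  · simp [compile, Safe, RAMConfig.exec, hS.reg, hne]
    omega
  · simp [compile, RAMConfig.exec]
  · rw [← hS.inp col _ hx, show 3 * s.v x + (col : ℕ) = s.v x + s.v x + s.v x + col by ring]
    simp [compile, RAMConfig.exec, Function.update_apply, hS.reg, hj, hj', hne]

theorem Simulates.out (hr : s.v r < E.n) :
    Simulates E (.out r x) s (s.setOut (s.v r) (s.v x)) 1 := by
  intro P c hS hb hP
  have hB := E.size_le
  refine Reach.simulate hb ?_ hP (by simp [compile]) (hS.setOut hr ?_ fun j hj => ?_)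
  · simp [compile, Safe, hS.reg, hS.base']
    omega
  · simp [compile, RAMConfig.exec, hS.reg, hS.base', x.reg_ne]
  · simp [compile, RAMConfig.exec, hj]

theorem Simulates.seq (h₁ : Simulates E a s s' t) (h₂ : Simulates E b s' s'' t') :
    Simulates E (.seq a b) s s'' (t + t') := by
  intro P c hS hb hP
  obtain ⟨hP₁, hP₂⟩ := CodeAt.append hP
  obtain ⟨t₁, c₁, ht₁, hR₁, hS₁, hpc₁⟩ := h₁ P c hS hb hP₁
  obtain ⟨t₂, c₂, ht₂, hR₂, hS₂, hpc₂⟩ := h₂ P c₁ hS₁ hR₁.bounded (by rwa [hpc₁])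
  refine ⟨_, c₂, by omega, hR₁.trans hR₂, hS₂, ?_⟩
  rw [hpc₂, hpc₁, compile, List.length_append]
  omega

theorem Sim.jump {P : RAMProgram} {c : RAMConfig} {l : ℕ} (hS : Sim E s c)
    (hb : BoundedBy (32 * E.B) c) (hP : P[c.pc]? = some (jump l)) :
    ∃ c', Reach P (32 * E.B) c 1 c' ∧ Sim E s c' ∧ c'.pc = l :=
  ⟨_, Reach.step hb hP ⟨hb.1, hb.2⟩, hS.of_reg rfl rfl, rfl⟩

theorem Sim.jumpLt {P : RAMProgram} {c : RAMConfig} {l : ℕ} (hS : Sim E s c)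
    (hb : BoundedBy (32 * E.B) c) (hP : P[c.pc]? = some (jumpLt x.reg y.reg l)) :
    ∃ c', Reach P (32 * E.B) c 1 c' ∧ Sim E s c' ∧
      c'.pc = if s.v x < s.v y then l else c.pc + 1 :=
  ⟨_, Reach.step hb hP ⟨hb.1, hb.2⟩, hS.of_reg rfl rfl, by simp only [RAMConfig.exec, hS.reg]⟩

theorem Simulates.ite_true (hc : s.v x < s.v y) (h : Simulates E a s s' t) :
    Simulates E (.ite x y a b) s s' (t + 1) := by
  intro P c hS hb hP
  simp only [compile] at hP ⊢
  obtain ⟨hjump, hP⟩ := hP.cons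
  obtain ⟨-, hP⟩ := hP.append
  obtain ⟨-, hP⟩ := hP.cons
  obtain ⟨c₁, hR₁, hS₁, hpc₁⟩ := hS.jumpLt hb hjump
  rw [if_pos hc] at hpc₁
  obtain ⟨t₂, c₂, ht₂, hR₂, hS₂, hpc₂⟩ := h P c₁ hS₁ hR₁.bounded
    (by rw [hpc₁]; convert hP using 1; omega)
  refine ⟨_, c₂, by omega, hR₁.trans hR₂, hS₂, ?_⟩
  rw [hpc₂, hpc₁]
  simp only [List.length_cons, List.length_append]
  omega

theorem Simulates.ite_false (hc : ¬ s.v x < s.v y) (h : Simulates E b s s' t) :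
    Simulates E (.ite x y a b) s s' (t + 1) := by
  intro P c hS hb hP
  simp only [compile] at hP ⊢
  obtain ⟨hjump, hP⟩ := hP.cons
  obtain ⟨hP, hP'⟩ := hP.append
  obtain ⟨hexit, -⟩ := hP'.cons
  obtain ⟨c₁, hR₁, hS₁, hpc₁⟩ := hS.jumpLt hb hjump
  rw [if_neg hc] at hpc₁
  obtain ⟨t₂, c₂, ht₂, hR₂, hS₂, hpc₂⟩ := h P c₁ hS₁ hR₁.bounded (by rwa [hpc₁])
  rw [hpc₁] at hpc₂
  obtain ⟨c₃, hR₃, hS₃, hpc₃⟩ := hS₂.jump hR₂.bounded (hpc₂ ▸ hexit)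
  refine ⟨_, c₃, by omega, (hR₁.trans hR₂).trans hR₃, hS₃, ?_⟩
  rw [hpc₃]
  simp only [List.length_cons, List.length_append]
  omega

theorem Simulates.loop_false (hc : ¬ s.v x < s.v y) : Simulates E (.loop x y a) s s 1 := by
  intro P c hS hb hP
  simp only [compile] at hP ⊢
  obtain ⟨hjump, hP⟩ := hP.cons
  obtain ⟨hexit, -⟩ := hP.cons
  obtain ⟨c₁, hR₁, hS₁, hpc₁⟩ := hS.jumpLt hb hjump
  rw [if_neg hc] at hpc₁
  obtain ⟨c₂, hR₂, hS₂, hpc₂⟩ := hS₁.jump hR₁.bounded (hpc₁ ▸ hexit)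
  refine ⟨_, c₂, by omega, hR₁.trans hR₂, hS₂, ?_⟩
  rw [hpc₂]
  simp only [List.length_cons, List.length_append, List.length_nil]
  omega

theorem Simulates.loop_true (hc : s.v x < s.v y) (h₁ : Simulates E a s s' t)
    (h₂ : Simulates E (.loop x y a) s' s'' t') :
    Simulates E (.loop x y a) s s'' (t + t' + 1) := by
  intro P c hS hb hP
  have hcode := hP
  simp only [compile] at hcode
  obtain ⟨hjump, hcode⟩ := hcode.cons
  obtain ⟨-, hcode⟩ := hcode.cons
  obtain ⟨hbody, hback⟩ := hcode.append
  obtain ⟨c₁, hR₁, hS₁, hpc₁⟩ := hS.jumpLt hb hjump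
  rw [if_pos hc] at hpc₁
  obtain ⟨t₂, c₂, ht₂, hR₂, hS₂, hpc₂⟩ := h₁ P c₁ hS₁ hR₁.bounded (by rwa [hpc₁])
  rw [hpc₁] at hpc₂
  obtain ⟨c₃, hR₃, hS₃, hpc₃⟩ := hS₂.jump hR₂.bounded (hpc₂ ▸ hback.cons.1)
  obtain ⟨t₄, c₄, ht₄, hR₄, hS₄, hpc₄⟩ := h₂ P c₃ hS₃ hR₃.bounded (by rwa [hpc₃])
  exact ⟨_, c₄, by omega, ((hR₁.trans hR₂).trans hR₃).trans hR₄, hS₄, by rw [hpc₄, hpc₃]⟩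

theorem Runs.simulates (h : Runs E a s s' t) : Simulates E a s s' t := by
  induction h with
  | const _ _ _ h => exact .const h
  | add _ _ _ _ h => exact .add h
  | sub => exact .sub
  | load => exact .load
  | store => exact .store
  | inp _ _ _ _ h => exact .inp h
  | out _ _ _ h => exact .out h
  | seq _ _ ih₁ ih₂ => exact ih₁.seq ih₂
  | ite_true hc _ ih => exact .ite_true hc ih
  | ite_false hc _ ih => exact .ite_false hc ih
  | loop_false hc => exact .loop_false hc
  | loop_true hc _ _ ih₁ ih₂ => exact .loop_true hc ih₁ ih₂

end Simulates

/-! ### Matchings in arrays -/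

/-- The arrays `mate` and `own` hold a matching of agents to objects along `adj`, where `0` stands
for being unmatched. -/
structure Matched (adj : ℕ → ℕ → Prop) (mate own : ℕ → ℕ) : Prop where
  adj_mate : ∀ c, mate c ≠ 0 → adj c (mate c)
  own_mate : ∀ c, mate c ≠ 0 → own (mate c) = c
  mate_own : ∀ o, own o ≠ 0 → mate (own o) = o
  mate_zero : mate 0 = 0
  own_zero : own 0 = 0

/-- The mates after the agent `c` has taken the object `o` from its owner. -/
def takeMate (mate own : ℕ → ℕ) (c o : ℕ) : ℕ → ℕ :=
  Function.update (Function.update mate c o) (own o) 0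

/-- The agents among `1, …, n` that have a mate. -/
def matchedAgents (n : ℕ) (mate : ℕ → ℕ) : Finset ℕ := (Finset.Icc 1 n).filter (mate · ≠ 0)

theorem mem_matchedAgents {n : ℕ} {mate : ℕ → ℕ} {a : ℕ} :
    a ∈ matchedAgents n mate ↔ (1 ≤ a ∧ a ≤ n) ∧ mate a ≠ 0 := by
  simp only [matchedAgents, Finset.mem_filter, Finset.mem_Icc]

theorem card_matchedAgents_le (n : ℕ) (mate : ℕ → ℕ) : (matchedAgents n mate).card ≤ n :=
  (Finset.card_filter_le _ _).trans (by simp)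

theorem takeMate_own {mate own : ℕ → ℕ} {c o : ℕ} : takeMate mate own c o (own o) = 0 :=
  Function.update_self ..

theorem takeMate_of_ne {mate own : ℕ → ℕ} {c o x : ℕ} (hx : x ≠ c) (hx' : x ≠ own o) :
    takeMate mate own c o x = mate x := by
  rw [takeMate, Function.update_of_ne hx', Function.update_of_ne hx]

namespace Matched

theorem of_eq_zero {adj : ℕ → ℕ → Prop} {mate own : ℕ → ℕ} (hmate : ∀ c, mate c = 0)
    (hown : ∀ o, own o = 0) : Matched adj mate own where
  adj_mate c h := absurd (hmate c) h
  own_mate c h := absurd (hmate c) h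
  mate_own o h := absurd (hown o) h
  mate_zero := hmate 0
  own_zero := hown 0

variable {adj : ℕ → ℕ → Prop} {mate own : ℕ → ℕ} (h : Matched adj mate own)
include h

theorem mono {adj' : ℕ → ℕ → Prop} (hadj : ∀ a b, adj a b → adj' a b) : Matched adj' mate own where
  adj_mate c hc := hadj _ _ (h.adj_mate c hc)
  own_mate := h.own_mate
  mate_own := h.mate_own
  mate_zero := h.mate_zero
  own_zero := h.own_zero

theorem adj_own {o : ℕ} (ho : own o ≠ 0) : adj (own o) o := by
  have hmate := h.mate_own o ho
  have hzero : o ≠ 0 := by rintro rfl; exact ho h.own_zero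
  have hadj := h.adj_mate (own o) (hmate.trans_ne hzero)
  rwa [hmate] at hadj

theorem injOn_mate {s : Set ℕ} (hs : ∀ a ∈ s, mate a ≠ 0) : s.InjOn mate := by
  intro a ha b hb hab
  rw [← h.own_mate a (hs a ha), hab, h.own_mate b (hs b hb)]

theorem eq_of_own_eq {o o' : ℕ} (ho : own o ≠ 0) (heq : own o = own o') : o = o' := by
  rw [← h.mate_own o ho, heq, h.mate_own o' (heq ▸ ho)]

theorem mem_matchedAgents_of_ne {n a : ℕ} (hn : ∀ c o, adj c o → c ≤ n) (ha : mate a ≠ 0) :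
    a ∈ matchedAgents n mate := by
  have hzero : a ≠ 0 := by rintro rfl; exact ha h.mate_zero
  exact mem_matchedAgents.2 ⟨⟨Nat.one_le_iff_ne_zero.2 hzero, hn _ _ (h.adj_mate a ha)⟩, ha⟩

theorem own_mem_matchedAgents {n o : ℕ} (hn : ∀ c o, adj c o → c ≤ n) (ho : own o ≠ 0) :
    own o ∈ matchedAgents n mate := by
  have hzero : o ≠ 0 := by rintro rfl; exact ho h.own_zero
  exact h.mem_matchedAgents_of_ne hn ((h.mate_own o ho).trans_ne hzero)

theorem add {c o : ℕ} (hc : c ≠ 0) (ho : o ≠ 0) (hmate : mate c = 0) (hown : own o = 0)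
    (hadj : adj c o) : Matched adj (Function.update mate c o) (Function.update own o c) := by
  obtain ⟨hadj_mate, hown_mate, hmate_own, hmate_zero, hown_zero⟩ := h
  constructor <;> grind

variable {c o : ℕ} (hc : c ≠ 0) (hm : mate c = 0) (ho : o ≠ 0)
include hc hm ho

theorem own_ne : own o ≠ c := by
  rintro rfl
  exact ho ((h.mate_own o hc).symm.trans hm)

theorem takeMate_self : takeMate mate own c o c = o := by
  rw [takeMate, Function.update_of_ne (h.own_ne hc hm ho).symm, Function.update_self]

theorem takeMate_eq_zero {x : ℕ} (hx : takeMate mate own c o x = 0) :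
    x = own o ∨ (x ≠ c ∧ mate x = 0) := by
  by_cases hxo : x = own o
  · exact Or.inl hxo
  by_cases hxc : x = c
  · exact absurd hx (hxc ▸ (h.takeMate_self hc hm ho).trans_ne ho)
  · exact Or.inr ⟨hxc, (takeMate_of_ne hxc hxo).symm.trans hx⟩

theorem takeMate_ne_zero {x : ℕ} (hx : takeMate mate own c o x ≠ 0) :
    (x = c ∧ takeMate mate own c o x = o) ∨
      (x ≠ c ∧ mate x ≠ 0 ∧ takeMate mate own c o x = mate x ∧ mate x ≠ o) := by
  have hxo : x ≠ own o := by rintro rfl; exact hx takeMate_own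
  by_cases hxc : x = c
  · subst hxc
    exact Or.inl ⟨rfl, h.takeMate_self hc hm ho⟩
  · rw [takeMate_of_ne hxc hxo] at hx ⊢
    exact Or.inr ⟨hxc, hx, rfl, fun heq => hxo (heq ▸ (h.own_mate x hx).symm)⟩

theorem takeMate_update_own {y : ℕ} (hy : Function.update own o c y ≠ 0) :
    takeMate mate own c o (Function.update own o c y) = y := by
  by_cases hyo : y = o
  · subst hyo
    rw [Function.update_self, h.takeMate_self hc hm ho]
  · rw [Function.update_of_ne hyo] at hy ⊢
    have hmate := h.mate_own y hy
    rw [takeMate_of_ne _ fun heq => hyo (h.eq_of_own_eq hy heq), hmate]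
    rintro heq
    exact hy (by rw [← hmate, heq, hm, h.own_zero])

theorem take (hadj : adj c o) :
    Matched adj (takeMate mate own c o) (Function.update own o c) where
  adj_mate x hx := by
    rcases h.takeMate_ne_zero hc hm ho hx with ⟨rfl, heq⟩ | ⟨-, hmate, heq, -⟩
    · rwa [heq]
    · rw [heq]; exact h.adj_mate x hmate
  own_mate x hx := by
    rcases h.takeMate_ne_zero hc hm ho hx with ⟨rfl, heq⟩ | ⟨-, hmate, heq, hne⟩
    · rw [heq, Function.update_self]
    · rw [heq, Function.update_of_ne hne, h.own_mate x hmate]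
  mate_own y hy := h.takeMate_update_own hc hm ho hy
  mate_zero := by
    by_cases hown : 0 = own o
    · conv_lhs => rw [hown, takeMate_own]
    · rw [takeMate_of_ne hc.symm hown, h.mate_zero]
  own_zero := by rw [Function.update_of_ne ho.symm, h.own_zero]

theorem matchedAgents_take {n : ℕ} (hcn : c ≤ n) :
    matchedAgents n (takeMate mate own c o) = insert c ((matchedAgents n mate).erase (own o)) := by
  ext x
  have hne := h.own_ne hc hm ho
  simp only [mem_matchedAgents, Finset.mem_insert, Finset.mem_erase]
  by_cases hxo : x = own o
  · simp [hxo, takeMate_own, hne]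
  by_cases hxc : x = c
  · simp only [hxc, h.takeMate_self hc hm ho, true_or, iff_true]
    omega
  · rw [takeMate_of_ne hxc hxo]
    tauto

theorem card_matchedAgents_take {n : ℕ} (hcn : c ≤ n) (hn : ∀ c o, adj c o → c ≤ n) :
    (matchedAgents n (takeMate mate own c o)).card =
      (matchedAgents n mate).card + if own o = 0 then 1 else 0 := by
  have hnotMem : c ∉ (matchedAgents n mate).erase (own o) := by simp [mem_matchedAgents, hm]
  rw [h.matchedAgents_take hc hm ho hcn, Finset.card_insert_of_notMem hnotMem]
  split_ifs with hown
  · rw [Finset.erase_eq_of_notMem (by simp [mem_matchedAgents, hown])]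
  · exact Finset.card_erase_add_one (h.own_mem_matchedAgents hn hown)

end Matched

/-- A list of edges between agents and objects, numbered `1, …, m`, some of which are good: in the
application, those to first choices. Agents and objects are numbered from `1`, as `0` stands for
none. -/
structure Net where
  n : ℕ
  m : ℕ
  agt : ℕ → ℕ
  obj : ℕ → ℕ
  good : ℕ → Prop
  agt_mem : ∀ e, 1 ≤ e → e ≤ m → 1 ≤ agt e ∧ agt e ≤ n
  obj_pos : ∀ e, 1 ≤ e → e ≤ m → 1 ≤ obj e
  good_mem : ∀ e, good e → 1 ≤ e ∧ e ≤ m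

namespace Net

variable (G : Net)

/-- Agent `a` and object `b` are joined by a good edge. -/
def Adj (a b : ℕ) : Prop := ∃ e, G.good e ∧ G.agt e = a ∧ G.obj e = b

/-- Agent `a` and object `b` are joined by an edge. -/
def AdjAll (a b : ℕ) : Prop := ∃ e, 1 ≤ e ∧ e ≤ G.m ∧ G.agt e = a ∧ G.obj e = b

open Classical in
/-- The last good edge of the agent `c` among the edges up to `b`, or `0` if there is none. -/
noncomputable def lastGood (c b : ℕ) : ℕ :=
  Nat.findGreatest (fun e => G.good e ∧ G.agt e = c) b

open Classical in
/-- The links of the lists of good edges: each agent has the list of its good edges in decreasing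
order. -/
noncomputable def nxt (p : ℕ) : ℕ := if G.good p then G.lastGood (G.agt p) (p - 1) else 0

/-- The heads of the lists of good edges. -/
noncomputable def hd (c : ℕ) : ℕ := G.lastGood c G.m

/-- Every pointer is `0` or a good edge of its agent. -/
def PtrOk (ptr : ℕ → ℕ) : Prop := ∀ c, ptr c ≠ 0 → G.good (ptr c) ∧ G.agt (ptr c) = c

/-- The good edges that the pointers have passed satisfy `S`. -/
def Scanned (ptr : ℕ → ℕ) (S : ℕ → Prop) : Prop := ∀ e, G.good e → ptr (G.agt e) < e → S e

/-- The agents of `A` can be matched along good edges by `f`. -/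
structure Matchable (A : Finset ℕ) (f : ℕ → ℕ) : Prop where
  adj : ∀ a ∈ A, G.Adj a (f a)
  inj : Set.InjOn f A

variable {G}

theorem Adj.adjAll {a b : ℕ} (h : G.Adj a b) : G.AdjAll a b := by
  obtain ⟨e, he, hagt, hobj⟩ := h
  exact ⟨e, (G.good_mem e he).1, (G.good_mem e he).2, hagt, hobj⟩

theorem AdjAll.bounds {a b : ℕ} (h : G.AdjAll a b) : 1 ≤ a ∧ a ≤ G.n ∧ 1 ≤ b := by
  obtain ⟨e, h1, h2, rfl, rfl⟩ := h
  exact ⟨(G.agt_mem e h1 h2).1, (G.agt_mem e h1 h2).2, G.obj_pos e h1 h2⟩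

theorem Adj.agt_le (a b : ℕ) (h : G.Adj a b) : a ≤ G.n := h.adjAll.bounds.2.1

theorem Adj.obj_ne_zero {a b : ℕ} (h : G.Adj a b) : b ≠ 0 :=
  Nat.one_le_iff_ne_zero.1 h.adjAll.bounds.2.2

theorem matchable_matchedAgents {mate own : ℕ → ℕ} (h : Matched G.Adj mate own) :
    G.Matchable (matchedAgents G.n mate) mate where
  adj a ha := h.adj_mate a (mem_matchedAgents.1 ha).2
  inj := h.injOn_mate fun _ ha => (mem_matchedAgents.1 ha).2

/-! ### Scanning lists of edges -/

theorem lastGood_spec {c b : ℕ} (h : G.lastGood c b ≠ 0) :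
    G.good (G.lastGood c b) ∧ G.agt (G.lastGood c b) = c := by
  classical exact Nat.findGreatest_of_ne_zero rfl h

theorem lastGood_le (c b : ℕ) : G.lastGood c b ≤ b := by
  classical exact Nat.findGreatest_le b

theorem le_lastGood {e b : ℕ} (h : G.good e) (hb : e ≤ b) : e ≤ G.lastGood (G.agt e) b := by
  classical exact Nat.le_findGreatest hb ⟨h, rfl⟩

theorem nxt_of_good {p : ℕ} (h : G.good p) : G.nxt p = G.lastGood (G.agt p) (p - 1) := if_pos h

theorem nxt_lt {p : ℕ} (h : G.good p) : G.nxt p < p := by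
  have hle := G.lastGood_le (G.agt p) (p - 1)
  have hpos := (G.good_mem p h).1
  rw [nxt_of_good h]
  omega

theorem le_nxt {e p : ℕ} (hp : G.good p) (he : G.good e) (hagt : G.agt e = G.agt p) (hlt : e < p) :
    e ≤ G.nxt p := by
  rw [nxt_of_good hp, ← hagt]
  exact le_lastGood he (by omega)

theorem ptrOk_hd : G.PtrOk G.hd := fun _ h => lastGood_spec h

theorem not_hd_lt {e : ℕ} (h : G.good e) : ¬ G.hd (G.agt e) < e :=
  not_lt.2 (le_lastGood h (G.good_mem e h).2)

section Pointers

variable {ptr : ℕ → ℕ} {c : ℕ}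

theorem PtrOk.adj (h : G.PtrOk ptr) (hp : ptr c ≠ 0) : G.Adj c (G.obj (ptr c)) :=
  ⟨ptr c, (h c hp).1, (h c hp).2, rfl⟩

theorem PtrOk.advance (h : G.PtrOk ptr) (hp : ptr c ≠ 0) :
    G.PtrOk (Function.update ptr c (G.nxt (ptr c))) := by
  intro x hx
  by_cases hxc : x = c
  · subst hxc
    obtain ⟨hgood, hagt⟩ := h x hp
    rw [Function.update_self, nxt_of_good hgood, hagt] at hx ⊢
    exact lastGood_spec hx
  · rw [Function.update_of_ne hxc] at hx ⊢
    exact h x hx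

theorem PtrOk.reset (h : G.PtrOk ptr) (c : ℕ) : G.PtrOk (Function.update ptr c (G.hd c)) := by
  intro x hx
  by_cases hxc : x = c
  · subst hxc
    rw [Function.update_self] at hx ⊢
    exact ptrOk_hd x hx
  · rw [Function.update_of_ne hxc] at hx ⊢
    exact h x hx

theorem Scanned.advance {S S' : ℕ → Prop} (h : G.Scanned ptr S) (hptr : G.PtrOk ptr)
    (hp : ptr c ≠ 0) (hS : ∀ e, S e → S' e) (hS' : S' (ptr c)) :
    G.Scanned (Function.update ptr c (G.nxt (ptr c))) S' := by
  intro e he hlt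
  obtain ⟨hgood, hagt⟩ := hptr c hp
  by_cases hec : G.agt e = c
  · rw [hec, Function.update_self] at hlt
    rcases lt_trichotomy e (ptr c) with hep | hep | hep
    · exact absurd (le_nxt hgood he (hec.trans hagt.symm) hep) (by omega)
    · exact hep ▸ hS'
    · exact hS e (h e he (hec ▸ hep))
  · rw [Function.update_of_ne hec] at hlt
    exact hS e (h e he hlt)

theorem Scanned.reset {S S' : ℕ → Prop} (h : G.Scanned ptr S) (c : ℕ)
    (hS : ∀ e, G.agt e ≠ c → S e → S' e) : G.Scanned (Function.update ptr c (G.hd c)) S' := by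
  intro e he hlt
  by_cases hec : G.agt e = c
  · subst hec
    rw [Function.update_self] at hlt
    exact absurd hlt (not_hd_lt he)
  · rw [Function.update_of_ne hec] at hlt
    exact hS e hec (h e he hlt)

end Pointers

/-- The number of edges that the pointers have not passed. -/
def unscanned (G : Net) (ptr : ℕ → ℕ) : ℕ :=
  ((Finset.Icc 1 G.m).filter fun e => e ≤ ptr (G.agt e)).card

/-- A potential that pays for scanning the edges once at each level up to `K`: each level below `K`
that an agent has yet to leave is paid for twice, for the lists are rewound when the level rises. -/
def pot (G : Net) (K : ℕ) (lvl ptr : ℕ → ℕ) : ℕ :=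
  (∑ e ∈ Finset.Icc 1 G.m, 2 * (K - lvl (G.agt e))) + G.unscanned ptr

theorem unscanned_le (ptr : ℕ → ℕ) : G.unscanned ptr ≤ G.m :=
  (Finset.card_filter_le _ _).trans (by simp)

theorem unscanned_advance {ptr : ℕ → ℕ} (hptr : G.PtrOk ptr) {c : ℕ} (hp : ptr c ≠ 0) :
    G.unscanned (Function.update ptr c (G.nxt (ptr c))) < G.unscanned ptr := by
  obtain ⟨hgood, hagt⟩ := hptr c hp
  have hlt := nxt_lt hgood
  refine Finset.card_lt_card (Finset.ssubset_iff_of_subset ?_ |>.2 ⟨ptr c, ?_, ?_⟩)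
  · refine Finset.monotone_filter_right _ fun e _ he => ?_
    by_cases hec : G.agt e = c
    · rw [hec, Function.update_self] at he
      exact hec ▸ he.trans hlt.le
    · rwa [Function.update_of_ne hec] at he
  · exact Finset.mem_filter.2 ⟨Finset.mem_Icc.2 (G.good_mem _ hgood), by rw [hagt]⟩
  · simp [hagt, hlt]

theorem pot_le (K : ℕ) (lvl ptr : ℕ → ℕ) : G.pot K lvl ptr ≤ G.m * (2 * K + 1) := by
  have hsum : ∑ e ∈ Finset.Icc 1 G.m, 2 * (K - lvl (G.agt e)) ≤ G.m * (2 * K) :=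
    (Finset.sum_le_card_nsmul _ _ (2 * K) fun e _ => by omega).trans (by simp)
  have hle := G.unscanned_le ptr
  rw [pot, mul_add]
  omega

theorem pot_advance {ptr : ℕ → ℕ} (hptr : G.PtrOk ptr) {c : ℕ} (hp : ptr c ≠ 0) (K : ℕ)
    (lvl : ℕ → ℕ) : G.pot K lvl (Function.update ptr c (G.nxt (ptr c))) < G.pot K lvl ptr :=
  Nat.add_lt_add_left (unscanned_advance hptr hp) _

theorem pot_raise {ptr lvl : ℕ → ℕ} {e K : ℕ} (he : 1 ≤ e) (he' : e ≤ G.m)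
    (hK : lvl (G.agt e) < K) (p : ℕ) :
    G.pot K (Function.update lvl (G.agt e) (lvl (G.agt e) + 1)) (Function.update ptr (G.agt e) p) <
      G.pot K lvl ptr := by
  simp only [pot, unscanned, Finset.card_filter, ← Finset.sum_add_distrib]
  refine Finset.sum_lt_sum (fun f _ => ?_) ⟨e, Finset.mem_Icc.2 ⟨he, he'⟩, ?_⟩
  · by_cases hx : G.agt f = G.agt e
    · simp only [hx, Function.update_self]
      split_ifs <;> omega
    · simp only [Function.update_of_ne hx, le_refl]
  · simp only [Function.update_self]
    split_ifs <;> omega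

end Net

/-! ### The auction -/

namespace Net

variable {G : Net}

/-- The invariant of the auction. Each object has a price and each agent a level, a lower bound for
the prices of its good objects. The agent `c` is bidding; the unmatched agents of the edges
before `b` have reached the level `K`. -/
structure AuctionInv (G : Net) (K b c : ℕ) (lvl prc mate own ptr : ℕ → ℕ) : Prop where
  matched : Matched G.Adj mate own
  ptr_ok : G.PtrOk ptr
  lvl_le : ∀ a, lvl a ≤ K
  lvl_le_prc : ∀ e, G.good e → lvl (G.agt e) ≤ prc (G.obj e)
  scanned : G.Scanned ptr fun e => lvl (G.agt e) < prc (G.obj e)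
  prc_mate : ∀ a, mate a ≠ 0 → prc (mate a) = lvl a + 1
  own_of_prc : ∀ o, prc o ≠ 0 → own o ≠ 0
  cur : c ≠ 0 → mate c = 0 ∧ lvl c < K ∧ ∃ e, 1 ≤ e ∧ e ≤ G.m ∧ G.agt e = c
  done : ∀ e, 1 ≤ e → e ≤ G.m → e < b → mate (G.agt e) ≠ 0 ∨ lvl (G.agt e) = K ∨ G.agt e = c

namespace AuctionInv

variable {K b c : ℕ} {lvl prc mate own ptr : ℕ → ℕ}

theorem of_eq_zero (hlvl : ∀ a, lvl a = 0) (hprc : ∀ o, prc o = 0) (hmate : ∀ a, mate a = 0)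
    (hown : ∀ o, own o = 0) (hptr : ptr = G.hd) : G.AuctionInv K 1 0 lvl prc mate own ptr where
  matched := .of_eq_zero hmate hown
  ptr_ok := hptr ▸ ptrOk_hd
  lvl_le a := by simp [hlvl]
  lvl_le_prc e _ := by simp [hlvl]
  scanned e he hlt := absurd (hptr ▸ hlt) (not_hd_lt he)
  prc_mate a ha := absurd (hmate a) ha
  own_of_prc o ho := absurd (hprc o) ho
  cur hc := absurd rfl hc
  done e _ _ hlt := by omega

theorem start (h : G.AuctionInv K b 0 lvl prc mate own ptr) (hb : 1 ≤ b) (hb' : b ≤ G.m)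
    (hc : (c = 0 ∧ (mate (G.agt b) ≠ 0 ∨ lvl (G.agt b) = K)) ∨
      (c = G.agt b ∧ mate (G.agt b) = 0 ∧ lvl (G.agt b) < K)) :
    G.AuctionInv K (b + 1) c lvl prc mate own ptr :=
  { h with
    cur := by
      intro hc'
      rcases hc with hc | ⟨rfl, hc⟩
      · exact absurd hc.1 hc'
      · exact ⟨hc.1, hc.2, b, hb, hb', rfl⟩
    done := by
      intro e he he' hlt
      rcases Nat.lt_succ_iff_lt_or_eq.1 hlt with hlt | rfl
      · have hpos := (G.agt_mem e he he').1
        have hdone := h.done e he he' hlt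
        omega
      · omega }

theorem skip (h : G.AuctionInv K b c lvl prc mate own ptr) (hp : ptr c ≠ 0)
    (hlt : lvl c < prc (G.obj (ptr c))) :
    G.AuctionInv K b c lvl prc mate own (Function.update ptr c (G.nxt (ptr c))) :=
  { h with
    ptr_ok := h.ptr_ok.advance hp
    scanned := h.scanned.advance h.ptr_ok hp (fun _ => id) (by rwa [(h.ptr_ok c hp).2]) }

section take

variable {o : ℕ} (h : G.AuctionInv K b c lvl prc mate own ptr) (hc : c ≠ 0) (ho : o ≠ 0)
include h hc ho

theorem prc_takeMate {a : ℕ} (ha : takeMate mate own c o a ≠ 0) :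
    Function.update prc o (lvl c + 1) (takeMate mate own c o a) = lvl a + 1 := by
  rcases h.matched.takeMate_ne_zero hc (h.cur hc).1 ho ha with ⟨rfl, heq⟩ | ⟨-, hmate, heq, hne⟩
  · rw [heq, Function.update_self]
  · rw [heq, Function.update_of_ne hne, h.prc_mate a hmate]

theorem done_takeMate {e : ℕ} (he : 1 ≤ e) (he' : e ≤ G.m) (hlt : e < b) :
    takeMate mate own c o (G.agt e) ≠ 0 ∨ lvl (G.agt e) = K ∨ G.agt e = own o := by
  by_cases hmate : takeMate mate own c o (G.agt e) = 0
  · rcases h.matched.takeMate_eq_zero hc (h.cur hc).1 ho hmate with heq | ⟨hne, hmate⟩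
    · exact Or.inr (Or.inr heq)
    · have hdone := h.done e he he' hlt
      tauto
  · exact Or.inl hmate

omit hc ho in
theorem cur_own (hlt : prc o ≤ K) (hown : own o ≠ 0) :
    lvl (own o) < K ∧ ∃ e, 1 ≤ e ∧ e ≤ G.m ∧ G.agt e = own o := by
  have hadj := h.matched.adj_own hown
  have hmate := h.matched.mate_own o hown
  have hprc := h.prc_mate (own o) (hmate.trans_ne hadj.obj_ne_zero)
  rw [hmate] at hprc
  obtain ⟨e, he, he', hagt, -⟩ := hadj.adjAll
  exact ⟨by omega, e, he, he', hagt⟩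

end take

/-- The next object of the list still has the price that the bidder expects, and the bidder takes
it, which raises the price. -/
theorem take (h : G.AuctionInv K b c lvl prc mate own ptr) (hc : c ≠ 0) (hp : ptr c ≠ 0)
    (hle : prc (G.obj (ptr c)) ≤ lvl c) :
    G.AuctionInv K b (own (G.obj (ptr c))) lvl
      (Function.update prc (G.obj (ptr c)) (lvl c + 1))
      (takeMate mate own c (G.obj (ptr c))) (Function.update own (G.obj (ptr c)) c)
      (Function.update ptr c (G.nxt (ptr c))) := by
  have hadj := h.ptr_ok.adj hp
  have hagt := (h.ptr_ok c hp).2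
  have ho := hadj.obj_ne_zero
  obtain ⟨hm, hlK, -⟩ := h.cur hc
  have hmono : ∀ x, prc x ≤ Function.update prc (G.obj (ptr c)) (lvl c + 1) x := fun x => by
    by_cases hx : x = G.obj (ptr c)
    · rw [hx, Function.update_self]; omega
    · rw [Function.update_of_ne hx]
  exact {
    matched := h.matched.take hc hm ho hadj
    ptr_ok := h.ptr_ok.advance hp
    lvl_le := h.lvl_le
    lvl_le_prc := fun e he => (h.lvl_le_prc e he).trans (hmono _)
    scanned := h.scanned.advance h.ptr_ok hp (fun e he => he.trans_le (hmono _))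
      (by rw [hagt, Function.update_self]; omega)
    prc_mate := fun a ha => h.prc_takeMate hc ho ha
    own_of_prc := fun x hx => by
      by_cases hxo : x = G.obj (ptr c)
      · rwa [hxo, Function.update_self]
      · rw [Function.update_of_ne hxo] at hx ⊢
        exact h.own_of_prc x hx
    cur := fun hown => ⟨takeMate_own, h.cur_own (hle.trans hlK.le) hown⟩
    done := fun e he he' hlt => h.done_takeMate hc ho he he' hlt }

/-- At the end of its list, where all of its objects are too expensive, the bidder raises its level,
and gives up at level `K`. -/
theorem raise (h : G.AuctionInv K b c lvl prc mate own ptr) (hc : c ≠ 0) (hp : ptr c = 0)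
    {c' : ℕ} (hc' : (c' = c ∧ lvl c + 1 < K) ∨ (c' = 0 ∧ K ≤ lvl c + 1)) :
    G.AuctionInv K b c' (Function.update lvl c (lvl c + 1)) prc mate own
      (Function.update ptr c (G.hd c)) := by
  obtain ⟨hm, hlK, hex⟩ := h.cur hc
  exact {
    matched := h.matched
    ptr_ok := h.ptr_ok.reset c
    lvl_le := fun a => by
      by_cases ha : a = c
      · rw [ha, Function.update_self]; omega
      · rw [Function.update_of_ne ha]; exact h.lvl_le a
    lvl_le_prc := fun e he => by
      by_cases ha : G.agt e = c
      · rw [ha, Function.update_self]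
        exact ha ▸ h.scanned e he (by rw [ha, hp]; exact (G.good_mem e he).1)
      · rw [Function.update_of_ne ha]; exact h.lvl_le_prc e he
    scanned := h.scanned.reset c fun e he hS => by rwa [Function.update_of_ne he]
    prc_mate := fun a ha => by
      have hac : a ≠ c := by rintro rfl; exact ha hm
      rw [Function.update_of_ne hac, h.prc_mate a ha]
    own_of_prc := h.own_of_prc
    cur := fun hc0 => by
      obtain ⟨rfl, hlt⟩ | ⟨hzero, -⟩ := hc'
      · exact ⟨hm, by rwa [Function.update_self], hex⟩
      · exact absurd hzero hc0
    done := fun e he he' hlt => by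
      have hdone := h.done e he he' hlt
      by_cases ha : G.agt e = c
      · rw [ha, Function.update_self]; omega
      · rw [Function.update_of_ne ha]; tauto }

section card

variable {A : Finset ℕ} {f : ℕ → ℕ}

theorem own_of_adj (h : G.AuctionInv K b c lvl prc mate own ptr) {a o : ℕ} (hadj : G.Adj a o)
    (hpos : 0 < lvl a) : own o ≠ 0 ∧ lvl a ≤ lvl (own o) + 1 := by
  obtain ⟨e, he, rfl, rfl⟩ := hadj
  have hle := h.lvl_le_prc e he
  have hown := h.own_of_prc (G.obj e) (by omega)
  have hmate := h.matched.mate_own _ hown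
  have hprc := h.prc_mate (own (G.obj e)) (hmate.trans_ne (h.matched.adj_own hown).obj_ne_zero)
  rw [hmate] at hprc
  exact ⟨hown, by omega⟩

theorem card_filter_lt_lvl_le (h : G.AuctionInv K b c lvl prc mate own ptr)
    (hA : G.Matchable A f) (t : ℕ) :
    (A.filter (t < lvl ·)).card ≤ ((matchedAgents G.n mate).filter (t ≤ lvl ·)).card := by
  have hown : ∀ a ∈ A.filter (t < lvl ·), a ∈ A ∧ own (f a) ≠ 0 ∧ t ≤ lvl (own (f a)) := by
    intro a ha
    obtain ⟨ha, hlt⟩ := Finset.mem_filter.1 ha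
    obtain ⟨hown, hle⟩ := h.own_of_adj (hA.adj a ha) (by omega)
    exact ⟨ha, hown, by omega⟩
  refine Finset.card_le_card_of_injOn (fun a => own (f a)) (fun a ha => ?_) fun a ha b hb hab => ?_
  · obtain ⟨-, hne, hle⟩ := hown a ha
    exact Finset.mem_filter.2 ⟨h.matched.own_mem_matchedAgents Adj.agt_le hne, hle⟩
  · obtain ⟨ha, hne, -⟩ := hown a ha
    exact hA.inj ha (hown b hb).1 (h.matched.eq_of_own_eq hne hab)

variable (h : G.AuctionInv K (G.m + 1) 0 lvl prc mate own ptr) (hA : G.Matchable A f)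
include h hA

theorem card_filter_not_lt_lvl_le {t : ℕ} (ht : t < K) :
    (A.filter (¬ t < lvl ·)).card ≤ ((matchedAgents G.n mate).filter (¬ t < lvl ·)).card := by
  refine Finset.card_le_card fun a ha => ?_
  obtain ⟨ha, hle⟩ := Finset.mem_filter.1 ha
  obtain ⟨e, he, he', rfl, -⟩ := (hA.adj a ha).adjAll
  have hpos := (G.agt_mem e he he').1
  have hdone := h.done e he he' (by omega)
  exact Finset.mem_filter.2 ⟨h.matched.mem_matchedAgents_of_ne Adj.agt_le (by omega), hle⟩

/-- Agents of `A` above the level `t` are sent to the owners of their partners, at most one level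
lower; the others are matched themselves. -/
theorem card_le_card_add_card_filter_lvl_eq {t : ℕ} (ht : t < K) :
    A.card ≤ (matchedAgents G.n mate).card +
      ((matchedAgents G.n mate).filter (lvl · = t)).card := by
  set T := matchedAgents G.n mate
  have habove : (A.filter (t < lvl ·)).card ≤ (T.filter (t ≤ lvl ·)).card :=
    h.card_filter_lt_lvl_le hA t
  have hbelow : (A.filter (¬ t < lvl ·)).card ≤ (T.filter (¬ t < lvl ·)).card :=
    h.card_filter_not_lt_lvl_le hA ht
  have hsplit : (T.filter (t ≤ lvl ·)).card ≤
      (T.filter (t < lvl ·)).card + (T.filter (lvl · = t)).card := by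
    refine le_trans (Finset.card_le_card fun a ha => ?_) (Finset.card_union_le _ _)
    simp only [Finset.mem_union, Finset.mem_filter] at ha ⊢
    rcases ha.2.lt_or_eq with hlt | heq
    · exact Or.inl ⟨ha.1, hlt⟩
    · exact Or.inr ⟨ha.1, heq.symm⟩
  have hAcard := Finset.card_filter_add_card_filter_not (s := A) (t < lvl ·)
  have hTcard := Finset.card_filter_add_card_filter_not (s := T) (t < lvl ·)
  omega

theorem mul_card_le :
    K * A.card ≤ K * (matchedAgents G.n mate).card + (matchedAgents G.n mate).card := by
  set T := matchedAgents G.n mate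
  calc K * A.card
      ≤ ∑ t ∈ Finset.range K, (T.card + (T.filter (lvl · = t)).card) := by
        simpa only [Finset.card_range, smul_eq_mul] using
          Finset.card_nsmul_le_sum (Finset.range K) _ A.card fun t ht =>
            h.card_le_card_add_card_filter_lvl_eq hA (Finset.mem_range.1 ht)
    _ = K * T.card + (T.filter (lvl · ∈ Finset.range K)).card := by
        rw [Finset.sum_add_distrib, Finset.sum_card_fiberwise_eq_card_filter]
        simp
    _ ≤ K * T.card + T.card := Nat.add_le_add_left (Finset.card_filter_le _ _) _

theorem card_le (hn : G.n ≤ K * K) (hK : 0 < K) :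
    A.card ≤ (matchedAgents G.n mate).card + K := by
  have hmul := h.mul_card_le hA
  have hle := card_matchedAgents_le G.n mate
  refine Nat.le_of_mul_le_mul_left (c := K) ?_ hK
  rw [mul_add]
  omega

end card

end AuctionInv

end Net

/-! ### The search for an augmenting path -/

/-- The current path of the search ends at the agent `c`, and its objects are `stk 0, …,
stk (top - 1)`: the search has exchanged objects along it, so each object can be given back to the
previous owner, which is the owner of the next object or `c`. -/
structure PathStack (adj : ℕ → ℕ → Prop) (c top : ℕ) (own mrk stk : ℕ → ℕ) : Prop where
  adj_top : 0 < top → adj c (stk (top - 1))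
  adj_own : ∀ x, x + 1 < top → adj (own (stk (x + 1))) (stk x)
  own_ne : ∀ x < top, own (stk x) ≠ 0
  mrk_ne : ∀ x < top, mrk (stk x) ≠ 0
  inj : ∀ x < top, ∀ y < top, stk x = stk y → x = y

namespace PathStack

variable {adj : ℕ → ℕ → Prop} {c top : ℕ} {own mrk stk : ℕ → ℕ}

theorem empty : PathStack adj c 0 own mrk stk where
  adj_top h := absurd h (lt_irrefl 0)
  adj_own _ h := absurd h (Nat.not_lt_zero _)
  own_ne _ h := absurd h (Nat.not_lt_zero _)
  mrk_ne _ h := absurd h (Nat.not_lt_zero _)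
  inj _ h := absurd h (Nat.not_lt_zero _)

theorem push (h : PathStack adj c top own mrk stk) (hc : c ≠ 0) {o : ℕ} (hmrk : mrk o = 0)
    (hadj : adj (own o) o) :
    PathStack adj (own o) (top + 1) (Function.update own o c) (Function.update mrk o 1)
      (Function.update stk top o) := by
  have hne : ∀ x < top, stk x ≠ o := fun x hx hxo => h.mrk_ne x hx (hxo ▸ hmrk)
  have hold : ∀ x < top, Function.update stk top o x = stk x := fun x hx =>
    Function.update_of_ne hx.ne _ _
  have htop : Function.update stk top o top = o := Function.update_self ..
  refine ⟨fun _ => ?_, fun x hx => ?_, fun x hx => ?_, fun x hx => ?_, fun x hx y hy hxy => ?_⟩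
  · rwa [Nat.add_sub_cancel, htop]
  · rw [hold x (by omega)]
    rcases (Nat.lt_succ_iff_lt_or_eq.1 hx) with hx | rfl
    · rw [hold _ hx, Function.update_of_ne (hne _ hx)]
      exact h.adj_own x hx
    · rw [htop, Function.update_self]
      exact h.adj_top (Nat.succ_pos x)
  · rcases (Nat.lt_succ_iff_lt_or_eq.1 hx) with hx | rfl
    · rw [hold x hx, Function.update_of_ne (hne x hx)]
      exact h.own_ne x hx
    · rwa [htop, Function.update_self]
  · rcases (Nat.lt_succ_iff_lt_or_eq.1 hx) with hx | rfl
    · rw [hold x hx, Function.update_of_ne (hne x hx)]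
      exact h.mrk_ne x hx
    · rw [htop, Function.update_self]
      exact one_ne_zero
  · have hinj := h.inj x
    have hnex := hne x
    have hney := hne y
    grind

theorem pop (h : PathStack adj c (top + 1) own mrk stk) :
    PathStack adj (own (stk top)) top (Function.update own (stk top) c) mrk stk := by
  have hne : ∀ x < top, stk x ≠ stk top := fun x hx hxt =>
    hx.ne (h.inj x (by omega) top (by omega) hxt)
  refine ⟨fun htop => ?_, fun x hx => ?_, fun x hx => ?_, fun x hx => h.mrk_ne x (by omega),
    fun x hx y hy => h.inj x (by omega) y (by omega)⟩
  · have hadj := h.adj_own (top - 1) (by omega)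
    rwa [Nat.sub_add_cancel htop] at hadj
  · rw [Function.update_of_ne (hne _ hx)]
    exact h.adj_own x (by omega)
  · rw [Function.update_of_ne (hne x hx)]
    exact h.own_ne x (by omega)

end PathStack

namespace Net

variable {G : Net}

/-- The invariant of the search for an augmenting path, which exchanges objects along the current
path. The agent `c` at the end of the path has no object; the marked objects are on the path or
belong to agents that have been dealt with, like the unmatched agents of the edges before `b`. -/
structure SearchInv (G : Net) (b c top : ℕ) (mate own ptr mrk stk : ℕ → ℕ) : Prop where
  matched : Matched G.Adj mate own
  ptr_ok : G.PtrOk ptr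
  scanned : G.Scanned ptr fun e => mrk (G.obj e) ≠ 0
  cur : c ≠ 0 → mate c = 0 ∧ c ≤ G.n
  done : ∀ e, 1 ≤ e → e ≤ G.m → e < b →
    mate (G.agt e) = 0 → ptr (G.agt e) = 0 ∨ G.agt e = c
  path : PathStack G.Adj c top own mrk stk
  own_of_mrk : ∀ e, 1 ≤ e → e ≤ G.m → mrk (G.obj e) ≠ 0 →
    own (G.obj e) ≠ 0 ∧ (ptr (own (G.obj e)) = 0 ∨ ∃ x < top, stk x = G.obj e)

namespace SearchInv

variable {b c top : ℕ} {mate own ptr mrk stk : ℕ → ℕ}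

theorem of_unmarked (h : Matched G.Adj mate own) (hptr : G.PtrOk ptr)
    (hhd : ∀ e, 1 ≤ e → e ≤ G.m → ptr (G.agt e) = G.hd (G.agt e))
    (hmrk : ∀ e, 1 ≤ e → e ≤ G.m → mrk (G.obj e) = 0) :
    G.SearchInv 1 0 0 mate own ptr mrk stk where
  matched := h
  ptr_ok := hptr
  scanned e he hlt :=
    absurd (hhd e (G.good_mem e he).1 (G.good_mem e he).2 ▸ hlt) (not_hd_lt he)
  cur hc := absurd rfl hc
  done e _ _ hlt := by omega
  path := .empty
  own_of_mrk e he he' hne := absurd (hmrk e he he') hne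

theorem start (h : G.SearchInv b 0 0 mate own ptr mrk stk) (hb : 1 ≤ b) (hb' : b ≤ G.m)
    (hc : (c = 0 ∧ mate (G.agt b) ≠ 0) ∨ (c = G.agt b ∧ mate (G.agt b) = 0)) :
    G.SearchInv (b + 1) c 0 mate own ptr mrk stk :=
  { h with
    cur := by
      intro hc'
      rcases hc with hc | ⟨rfl, hc⟩
      · exact absurd hc.1 hc'
      · exact ⟨hc, (G.agt_mem b hb hb').2⟩
    done := by
      intro e he he' hlt hmate
      rcases Nat.lt_succ_iff_lt_or_eq.1 hlt with hlt | rfl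
      · have hpos := (G.agt_mem e he he').1
        have hdone := h.done e he he' hlt hmate
        omega
      · omega
    path := .empty }

section advance

variable (h : G.SearchInv b c top mate own ptr mrk stk) (p : ℕ)
include h

theorem done_advance {e : ℕ} (he : 1 ≤ e) (he' : e ≤ G.m) (hlt : e < b)
    (hmate : mate (G.agt e) = 0) : Function.update ptr c p (G.agt e) = 0 ∨ G.agt e = c := by
  by_cases ha : G.agt e = c
  · exact Or.inr ha
  · rw [Function.update_of_ne ha]
    exact h.done e he he' hlt hmate

theorem own_of_mrk_advance (hp : ptr c ≠ 0) {e : ℕ} (he : 1 ≤ e) (he' : e ≤ G.m)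
    (hmrk : mrk (G.obj e) ≠ 0) :
    own (G.obj e) ≠ 0 ∧
      (Function.update ptr c p (own (G.obj e)) = 0 ∨ ∃ x < top, stk x = G.obj e) := by
  obtain ⟨hown, hptr⟩ := h.own_of_mrk e he he' hmrk
  refine ⟨hown, hptr.imp_left fun hzero => ?_⟩
  have hne : own (G.obj e) ≠ c := by rintro heq; exact hp (heq ▸ hzero)
  rwa [Function.update_of_ne hne]

end advance

theorem skip (h : G.SearchInv b c top mate own ptr mrk stk) (hp : ptr c ≠ 0)
    (hmrk : mrk (G.obj (ptr c)) ≠ 0) :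
    G.SearchInv b c top mate own (Function.update ptr c (G.nxt (ptr c))) mrk stk :=
  { h with
    ptr_ok := h.ptr_ok.advance hp
    scanned := h.scanned.advance h.ptr_ok hp (fun _ => id) hmrk
    done := fun _ he he' hlt => h.done_advance _ he he' hlt
    own_of_mrk := fun _ he he' hne => h.own_of_mrk_advance _ hp he he' hne }

theorem done_takeMate (h : G.SearchInv b c top mate own ptr mrk stk) (hc : c ≠ 0) {o : ℕ}
    (ho : o ≠ 0) {ptr' : ℕ → ℕ} (hptr : ∀ x, x ≠ c → ptr' x = ptr x) {e : ℕ} (he : 1 ≤ e)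
    (he' : e ≤ G.m) (hlt : e < b) (hmate : takeMate mate own c o (G.agt e) = 0) :
    ptr' (G.agt e) = 0 ∨ G.agt e = own o := by
  rcases h.matched.takeMate_eq_zero hc (h.cur hc).1 ho hmate with heq | ⟨hne, hzero⟩
  · exact Or.inr heq
  · rw [hptr _ hne]
    exact Or.inl ((h.done e he he' hlt hzero).resolve_right hne)

/-- The agent at the end of the path takes an object of its list from its owner. -/
theorem push (h : G.SearchInv b c top mate own ptr mrk stk) (hc : c ≠ 0) (hp : ptr c ≠ 0)
    (hmrk : mrk (G.obj (ptr c)) = 0) (hown : own (G.obj (ptr c)) ≠ 0) :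
    G.SearchInv b (own (G.obj (ptr c))) (top + 1) (takeMate mate own c (G.obj (ptr c)))
      (Function.update own (G.obj (ptr c)) c) (Function.update ptr c (G.nxt (ptr c)))
      (Function.update mrk (G.obj (ptr c)) 1) (Function.update stk top (G.obj (ptr c))) := by
  have hadj := h.ptr_ok.adj hp
  have hadj_own := h.matched.adj_own hown
  exact {
    matched := h.matched.take hc (h.cur hc).1 hadj.obj_ne_zero hadj
    ptr_ok := h.ptr_ok.advance hp
    scanned := h.scanned.advance h.ptr_ok hp
      (fun e hne => by
        by_cases hx : G.obj e = G.obj (ptr c)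
        · simp [hx]
        · rwa [Function.update_of_ne hx])
      (by simp)
    cur := fun _ => ⟨takeMate_own, hadj_own.agt_le⟩
    done := fun e he he' hlt => h.done_takeMate hc hadj.obj_ne_zero
      (fun x hx => Function.update_of_ne hx _ _) he he' hlt
    path := h.path.push hc hmrk hadj_own
    own_of_mrk := fun e he he' hne => by
      by_cases hx : G.obj e = G.obj (ptr c)
      · rw [hx, Function.update_self]
        exact ⟨hc, Or.inr ⟨top, Nat.lt_succ_self top, Function.update_self ..⟩⟩
      · rw [Function.update_of_ne hx] at hne ⊢
        obtain ⟨hown', hpath⟩ := h.own_of_mrk_advance (G.nxt (ptr c)) hp he he' hne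
        refine ⟨hown', hpath.imp_right ?_⟩
        rintro ⟨x, hlt, hstk⟩
        exact ⟨x, by omega, by rw [Function.update_of_ne hlt.ne, hstk]⟩ }

/-- At the end of its list, the agent at the end of the path gets back its object. -/
theorem pop (h : G.SearchInv b c (top + 1) mate own ptr mrk stk) (hc : c ≠ 0) (hp : ptr c = 0) :
    G.SearchInv b (own (stk top)) top (takeMate mate own c (stk top))
      (Function.update own (stk top) c) ptr mrk stk := by
  have hadj := h.path.adj_top (Nat.succ_pos top)
  rw [Nat.add_sub_cancel] at hadj
  have hown := h.path.own_ne top (Nat.lt_succ_self top)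
  exact {
    matched := h.matched.take hc (h.cur hc).1 hadj.obj_ne_zero hadj
    ptr_ok := h.ptr_ok
    scanned := h.scanned
    cur := fun _ => ⟨takeMate_own, (h.matched.adj_own hown).agt_le⟩
    done := fun e he he' hlt =>
      h.done_takeMate hc hadj.obj_ne_zero (fun x _ => rfl) he he' hlt
    path := h.path.pop
    own_of_mrk := fun e he he' hne => by
      by_cases hx : G.obj e = stk top
      · rw [hx, Function.update_self]
        exact ⟨hc, Or.inl hp⟩
      · rw [Function.update_of_ne hx]
        obtain ⟨hown', hpath⟩ := h.own_of_mrk e he he' hne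
        refine ⟨hown', hpath.imp_right ?_⟩
        rintro ⟨x, hlt, hstk⟩
        have hxt : x ≠ top := by rintro rfl; exact hx hstk.symm
        exact ⟨x, by omega, hstk⟩ }

theorem fail (h : G.SearchInv b c 0 mate own ptr mrk stk) (hp : ptr c = 0) :
    G.SearchInv b 0 0 mate own ptr mrk stk :=
  { h with
    cur := fun hc => absurd rfl hc
    done := fun e he he' hlt hmate => by
      rcases h.done e he he' hlt hmate with hzero | heq
      · exact Or.inl hzero
      · exact Or.inl (heq ▸ hp)
    path := .empty }

section card

variable (h : G.SearchInv (G.m + 1) 0 0 mate own ptr mrk stk)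
include h

theorem ptr_eq_zero {e : ℕ} (he : 1 ≤ e) (he' : e ≤ G.m) (hmate : mate (G.agt e) = 0) :
    ptr (G.agt e) = 0 := by
  have hpos := (G.agt_mem e he he').1
  have hdone := h.done e he he' (by omega) hmate
  omega

theorem own_of_adj {a o : ℕ} (hadj : G.Adj a o) (ha : ptr a = 0) : own o ≠ 0 ∧ ptr (own o) = 0 := by
  obtain ⟨e, he, rfl, rfl⟩ := hadj
  obtain ⟨h1, h2⟩ := G.good_mem e he
  obtain ⟨hown, hzero | ⟨x, hx, -⟩⟩ := h.own_of_mrk e h1 h2 (h.scanned e he (by omega))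
  · exact ⟨hown, hzero⟩
  · exact absurd hx (Nat.not_lt_zero x)

/-- Sending the agents of `A` at the end of their lists to the owners of their partners is
injective, and the other agents are matched. -/
theorem card_le {A : Finset ℕ} {f : ℕ → ℕ} (hA : G.Matchable A f) :
    A.card ≤ (matchedAgents G.n mate).card := by
  have hown : ∀ a ∈ A, ptr a = 0 → own (f a) ≠ 0 ∧ ptr (own (f a)) = 0 := fun a ha =>
    h.own_of_adj (hA.adj a ha)
  refine Finset.card_le_card_of_injOn (fun a => if ptr a = 0 then own (f a) else a) ?_ ?_
  · intro a ha
    dsimp only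
    split_ifs with hptr
    · exact h.matched.own_mem_matchedAgents Adj.agt_le (hown a ha hptr).1
    · refine h.matched.mem_matchedAgents_of_ne Adj.agt_le fun hmate => hptr ?_
      obtain ⟨e, he, he', rfl, -⟩ := (hA.adj a ha).adjAll
      exact h.ptr_eq_zero he he' hmate
  · intro a ha b hb hab
    dsimp only at hab
    split_ifs at hab with hpa hpb hpb
    · exact hA.inj ha hb (h.matched.eq_of_own_eq (hown a ha hpa).1 hab)
    · exact absurd (hab ▸ (hown a ha hpa).2) hpb
    · exact absurd (hab ▸ (hown b hb hpb).2) hpa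
    · exact hab

end card

end SearchInv

end Net

/-! ### The program -/

open Cmd Var Arr

def skip : Cmd := const g 0

/-- For each edge, do `a`. The command `a` may increase the number `e` of the edge. -/
def forEdges (a : Cmd) : Cmd := const e 1 ++ loop e lim (a ++ add e e one)

/-- The agent `c` takes the object `o`, and its owner becomes the agent `c`. -/
def takeObj : Cmd :=
  load i own o ++ store own o c ++ store mate c o ++ store mate i zero ++ sub c i zero

/-- Agent `c` considers the edge `p`, the next one of its list. -/
def bid : Cmd :=
  load g nxt p ++ store ptr c g ++ load o obj p ++ load g prc o ++ load l lvl c ++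
    ite l g skip (add l l one ++ store prc o l ++ takeObj)

/-- At the end of its list, agent `c` goes to the next level, and drops out at the level `cap`. -/
def raiseLevel : Cmd :=
  load l lvl c ++ add l l one ++ store lvl c l ++ load g hd c ++ store ptr c g ++
    ite l cap skip (const c 0)

/-- One step of the auction for the agent `c`, which becomes `0` when the displacements end. -/
def auctionStep : Cmd := load p ptr c ++ ite zero p bid raiseLevel

/-- The agent of edge `e` becomes the agent `c` if it takes part in the auction. -/
def auctionPick : Cmd :=
  load c agt e ++ load g mate c ++
    ite zero g (const c 0) (load l lvl c ++ ite l cap skip (const c 0))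

/-- The auction: each agent in turn bids for the objects of its list, and an object goes to a bidder
whose level is not below its price. The displaced owner bids next. -/
def auction : Cmd := forEdges (auctionPick ++ loop zero c auctionStep)

/-- Remove all marks, and go to the start of all lists. -/
def clear : Cmd :=
  forEdges (load o obj e ++ store mrk o zero ++ load l agt e ++ load g hd l ++ store ptr l g)

/-- Agent `c` considers the edge `p`, the next one of its list. -/
def advance : Cmd :=
  load g nxt p ++ store ptr c g ++ load o obj p ++ load g mrk o ++
    ite zero g skip (store mrk o one ++ store stk top o ++ add top top one ++ takeObj)

/-- At the end of its list, agent `c` gets back the last object of the path. -/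
def backtrack : Cmd :=
  ite zero top (sub top top one ++ load o stk top ++ takeObj) (const fnd 0 ++ const c 0)

/-- One step of the depth-first search; `c` becomes `0` when a path is complete or the search
fails. -/
def searchStep : Cmd := load p ptr c ++ ite zero p advance backtrack

/-- The agent of edge `e` becomes the agent `c` if it is unmatched. -/
def searchPick : Cmd :=
  load c agt e ++ load g mate c ++ ite zero g (const c 0) (const fnd 1)

/-- Search for an augmenting path, until one is found. -/
def search : Cmd :=
  const fnd 0 ++ const top 0 ++
    forEdges (searchPick ++ loop zero c searchStep ++ ite zero fnd (sub e lim one) skip)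

/-- Search for augmenting paths as long as there are any. -/
def augment : Cmd := const fnd 1 ++ loop zero fnd (clear ++ search)

/-- Match free agents with free objects, and write the output. -/
def complete : Cmd :=
  forEdges (load c agt e ++ load o obj e ++ load g mate c ++ load i own o ++
    ite zero g skip (ite zero i skip (store mate c o ++ store own o c)) ++
    load g mate c ++ sub c c one ++ out c g)

/-- Read the edges, and make lists of the good ones. -/
def build : Cmd :=
  const one 1 ++ add lim m one ++
    forEdges (sub g e one ++ inp l 0 g ++ add l l one ++ store agt e l ++
      inp o 1 g ++ add o o one ++ store obj e o ++ inp i 2 g ++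
      ite zero i skip (load p hd l ++ store nxt e p ++ store hd l e ++ store ptr l e))

/-- Compute the least number `cap` whose square `sq` is at least `n`. -/
def squareRoot : Cmd := loop sq n (add sq sq cap ++ add cap cap one ++ add sq sq cap)

/-- The whole program; without edges it stops at once, as then it may take only constant time. -/
def main : Cmd := ite zero m (build ++ squareRoot ++ auction ++ augment ++ complete) skip

theorem wp_forEdges {E : Env} {a : Cmd} {Q : St → ℕ → Prop} {s : St} {M : ℕ} (hM : M + 1 ≤ E.B)
    (I : St → Prop) (Φ : St → ℕ) (r : ℕ) (hs : I (s.setV e 1))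
    (hI : ∀ s, I s → s.v one = 1 ∧ s.v lim = M + 1 ∧ 1 ≤ s.v e ∧ s.v e ≤ M + 1)
    (hbody : ∀ s, I s → s.v e ≤ M → wp E a (fun s' t => s.v e ≤ s'.v e ∧ s'.v e ≤ M ∧
      s'.v one = 1 ∧ I (s'.setV e (s'.v e + 1)) ∧
      t + 2 + Φ (s'.setV e (s'.v e + 1)) ≤ Φ s + r) s)
    (hQ : ∀ s' t, I s' → s'.v e = M + 1 → t + Φ s' ≤ Φ (s.setV e 1) + r * M + 2 → Q s' t) :
    wp E (forEdges a) Q s := by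
  simp only [forEdges, wp_seq, wp_const]
  refine ⟨by omega, wp_loop I (fun s => Φ s + r * (M + 1 - s.v e)) hs ?_ ?_⟩
  · intro s₁ h₁ hlt
    have hlim := (hI s₁ h₁).2.1
    rw [wp_seq]
    refine wp_mono (hbody s₁ h₁ (by omega)) fun s₂ t₂ ⟨_, _, hone, h₂, _⟩ => ?_
    simp only [wp_add, hone, St.setV_v, if_true]
    have hrate : r * (M + 1 - (s₂.v e + 1)) + r ≤ r * (M + 1 - s₁.v e) := by
      rw [← Nat.mul_succ]
      exact Nat.mul_le_mul_left r (by omega)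
    exact ⟨by omega, h₂, by omega⟩
  · intro s' t h' hlt ht
    obtain ⟨-, hlim, -, hle⟩ := hI s' h'
    simp only [St.setV_v, if_true, Nat.add_sub_cancel] at ht
    exact hQ s' _ h' (by omega) (by omega)

/-- After the edges have been read, the state contains the lists of good edges and the number `K` of
levels, and there is no output. -/
structure Static (G : Net) (K : ℕ) (s : St) : Prop where
  zero_eq : s.v zero = 0
  one_eq : s.v one = 1
  lim_eq : s.v lim = G.m + 1
  cap_eq : s.v cap = K
  agt_eq : s.a agt = G.agt
  obj_eq : s.a obj = G.obj
  nxt_eq : s.a nxt = G.nxt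
  hd_eq : s.a hd = G.hd
  out_eq : s.out = 0

section Static

variable {G : Net} {K : ℕ} {s s' : St}

theorem static_congr (hv : ∀ r ∈ [zero, one, lim, cap], s'.v r = s.v r)
    (ha : ∀ k ∈ [agt, obj, nxt, hd], s'.a k = s.a k) (hout : s'.out = s.out) :
    Static G K s' ↔ Static G K s := by
  simp only [List.forall_mem_cons, List.not_mem_nil, false_implies, implies_true, and_true] at hv ha
  obtain ⟨hzero, hone, hlim, hcap⟩ := hv
  obtain ⟨hagt, hobj, hnxt, hhd⟩ := ha
  constructor <;> rintro ⟨h1, h2, h3, h4, h5, h6, h7, h8, h9⟩ <;> constructor <;> simp_all only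

theorem static_setV {r : Var} {x : ℕ} (hr : r ∉ [zero, one, lim, cap]) :
    Static G K (s.setV r x) ↔ Static G K s :=
  static_congr (fun r' hr' => by rw [St.setV_v, if_neg (ne_of_mem_of_not_mem hr' hr)])
    (fun _ _ => rfl) rfl

theorem static_setA {k : Arr} {j x : ℕ} (hk : k ∉ [agt, obj, nxt, hd]) :
    Static G K (s.setA k j x) ↔ Static G K s :=
  static_congr (fun _ _ => rfl)
    (fun k' hk' => by rw [St.setA_a, if_neg (ne_of_mem_of_not_mem hk' hk)]) rfl

end Static

/-! ### Correctness of the auction -/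

section auction

variable {E : Env} {G : Net} {K b : ℕ} {s : St}

/-- The state during the auction. -/
def AuctionState (G : Net) (K b : ℕ) (s : St) : Prop :=
  Static G K s ∧ G.AuctionInv K b (s.v c) (s.a lvl) (s.a prc) (s.a mate) (s.a own) (s.a ptr)

/-- The potential of a state of the auction. -/
def St.auctionPot (G : Net) (K : ℕ) (s : St) : ℕ := G.pot K (s.a lvl) (s.a ptr)

theorem bid_spec (hK : K ≤ E.B) (hI : AuctionState G K b s) (hc : s.v c ≠ 0)
    (hp : s.v p = s.a ptr (s.v c)) (hp₀ : s.v p ≠ 0) :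
    wp E bid (fun s' t => AuctionState G K b s' ∧ s'.v e = s.v e ∧
      t + 3 + 30 * s'.auctionPot G K ≤ 30 * s.auctionPot G K) s := by
  obtain ⟨hS, hI⟩ := hI
  rw [hp] at hp₀
  have hpot := Net.pot_advance hI.ptr_ok hp₀ K (s.a lvl)
  have hlvl := (hI.cur hc).2.1
  simp only [bid, takeObj, skip, AuctionState, St.auctionPot, wp_seq, wp_const, wp_add, wp_sub,
    wp_load, wp_store, wp_ite, St.setV_v, St.setV_a, St.setA_v, St.setA_a, static_setV,
    static_setA, List.mem_cons, List.not_mem_nil, or_self, not_false_eq_true, reduceCtorEq, if_true,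
    if_false, hp, hS, hS.zero_eq, hS.one_eq, hS.nxt_eq, hS.obj_eq, Nat.sub_zero, true_and]
  split_ifs with hprc
  · exact ⟨by omega, hI.skip hp₀ hprc, by omega⟩
  · exact ⟨by omega, hI.take hc hp₀ (by omega), by omega⟩

theorem raiseLevel_spec (hK : K ≤ E.B) (hI : AuctionState G K b s) (hc : s.v c ≠ 0)
    (hp : s.a ptr (s.v c) = 0) :
    wp E raiseLevel (fun s' t => AuctionState G K b s' ∧ s'.v e = s.v e ∧
      t + 3 + 30 * s'.auctionPot G K ≤ 30 * s.auctionPot G K) s := by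
  obtain ⟨hS, hI⟩ := hI
  obtain ⟨-, hlvl, e₀, he, he', hagt⟩ := hI.cur hc
  have hpot := Net.pot_raise (ptr := s.a ptr) he he' (hagt ▸ hlvl) (G.hd (s.v c))
  rw [hagt] at hpot
  simp only [raiseLevel, skip, AuctionState, St.auctionPot, wp_seq, wp_const, wp_add, wp_load,
    wp_store, wp_ite, St.setV_v, St.setV_a, St.setA_v, St.setA_a, static_setV,
    static_setA, List.mem_cons, List.not_mem_nil, or_self, not_false_eq_true, reduceCtorEq, if_true,
    if_false, hS, hS.one_eq, hS.cap_eq, hS.hd_eq, true_and]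
  split_ifs with hcap
  · exact ⟨by omega, by omega, hI.raise hc hp (Or.inl ⟨rfl, hcap⟩), by omega⟩
  · exact ⟨by omega, by omega, hI.raise hc hp (Or.inr ⟨rfl, by omega⟩), by omega⟩

theorem auctionStep_spec (hK : K ≤ E.B) (hI : AuctionState G K b s) (hc : s.v c ≠ 0) :
    wp E auctionStep (fun s' t => AuctionState G K b s' ∧ s'.v e = s.v e ∧
      t + 1 + 30 * s'.auctionPot G K ≤ 30 * s.auctionPot G K) s := by
  have hI' : AuctionState G K b (s.setV p (s.a ptr (s.v c))) :=
    ⟨(static_setV (by simp)).2 hI.1, by simpa [St.setV_v, St.setV_a] using hI.2⟩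
  simp only [auctionStep, wp_seq, wp_load, wp_ite, St.setV_v, reduceCtorEq, if_true, if_false,
    hI.1.zero_eq]
  split_ifs with hp
  · refine wp_mono (bid_spec hK hI' (by simpa [St.setV_v]) ?_ ?_) fun s' t ⟨h', he, ht⟩ =>
      ⟨h', he, ?_⟩
    · simp [St.setV_v, St.setV_a]
    · simpa [St.setV_v] using hp.ne'
    · simp only [St.auctionPot, St.setV_a] at ht ⊢
      omega
  · refine wp_mono (raiseLevel_spec hK hI' (by simpa [St.setV_v]) ?_) fun s' t ⟨h', he, ht⟩ =>
      ⟨h', he, ?_⟩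
    · simpa [St.setV_v, St.setV_a] using hp
    · simp only [St.auctionPot, St.setV_a] at ht ⊢
      omega

theorem auctionLoop_spec (hK : K ≤ E.B) (hI : AuctionState G K b s) :
    wp E (loop zero c auctionStep) (fun s' t => AuctionState G K b s' ∧ s'.v e = s.v e ∧
      s'.v c = 0 ∧ t + 30 * s'.auctionPot G K ≤ 30 * s.auctionPot G K + 1) s := by
  refine wp_loop (fun s' => AuctionState G K b s' ∧ s'.v e = s.v e)
    (fun s' => 30 * s'.auctionPot G K) ⟨hI, rfl⟩ (fun s₁ ⟨h₁, he₁⟩ hc => ?_)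
    fun s₁ t ⟨h₁, he₁⟩ hc ht => ⟨h₁, he₁, ?_, ht⟩
  · rw [h₁.1.zero_eq] at hc
    exact wp_mono (auctionStep_spec hK h₁ hc.ne') fun s₂ t ⟨h₂, he₂, ht⟩ =>
      ⟨⟨h₂, he₂.trans he₁⟩, ht⟩
  · rwa [h₁.1.zero_eq, Nat.pos_iff_ne_zero, not_not] at hc

theorem auctionPick_spec (hI : AuctionState G K (s.v e) s) (hc : s.v c = 0) (he : 1 ≤ s.v e)
    (he' : s.v e ≤ G.m) :
    wp E auctionPick (fun s' t => AuctionState G K (s.v e + 1) s' ∧ s'.v e = s.v e ∧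
      s'.auctionPot G K = s.auctionPot G K ∧ t ≤ 10) s := by
  obtain ⟨hS, hI⟩ := hI
  rw [hc] at hI
  have hle := hI.lvl_le (G.agt (s.v e))
  simp only [auctionPick, skip, AuctionState, St.auctionPot, wp_seq, wp_const, wp_load, wp_ite,
    St.setV_v, St.setV_a, static_setV, List.mem_cons, List.not_mem_nil, or_self, not_false_eq_true,
    reduceCtorEq, if_true, if_false, hS, hS.zero_eq, hS.cap_eq, hS.agt_eq, true_and]
  split_ifs with hmate hlvl
  · exact ⟨by omega, hI.start he he' (Or.inl ⟨rfl, Or.inl hmate.ne'⟩), by omega⟩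
  · exact ⟨by omega, hI.start he he' (Or.inr ⟨rfl, by omega, hlvl⟩), by omega⟩
  · exact ⟨by omega, hI.start he he' (Or.inl ⟨rfl, Or.inr (by omega)⟩), by omega⟩

theorem auction_spec (hK : K ≤ E.B) (hB : G.m + 1 ≤ E.B) (hI : AuctionState G K 1 s)
    (hc : s.v c = 0) :
    wp E auction (fun s' t => AuctionState G K (G.m + 1) s' ∧ s'.v c = 0 ∧
      t ≤ G.m * (60 * K + 50) + 2) s := by
  refine wp_forEdges hB (fun s => AuctionState G K (s.v e) s ∧ s.v c = 0 ∧ 1 ≤ s.v e ∧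
    s.v e ≤ G.m + 1) (fun s => 30 * s.auctionPot G K) 20 ?_
    (fun s h => ⟨h.1.1.one_eq, h.1.1.lim_eq, h.2.2⟩) ?_ ?_
  · simp only [AuctionState, static_setV, St.setV_v, St.setV_a, List.mem_cons, List.not_mem_nil,
      or_self, not_false_eq_true, reduceCtorEq, if_true, if_false]
    exact ⟨hI, hc, le_rfl, by omega⟩
  · rintro s₁ ⟨h₁, hc₁, he₁, -⟩ hle
    rw [wp_seq]
    refine wp_mono (auctionPick_spec h₁ hc₁ he₁ hle) fun s₂ t₂ ⟨h₂, he₂, hpot₂, _⟩ => ?_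
    refine wp_mono (auctionLoop_spec hK h₂) fun s₃ t₃ ⟨h₃, he₃, hc₃, ht₃⟩ => ?_
    have hone := h₃.1.one_eq
    simp only [AuctionState, St.auctionPot, static_setV, St.setV_v, St.setV_a, List.mem_cons,
      List.not_mem_nil, or_self, not_false_eq_true, reduceCtorEq, if_true, if_false, he₃, he₂]
      at h₃ hpot₂ ht₃ ⊢
    exact ⟨le_rfl, hle, hone, ⟨h₃, hc₃, by omega, by omega⟩, by omega⟩
  · rintro s' t ⟨h', hc', -⟩ he ht
    rw [he] at h'
    have hpot := G.pot_le K (s.a lvl) (s.a ptr)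
    simp only [St.auctionPot, St.setV_a] at ht
    have harith : G.m * (60 * K + 50) = 30 * (G.m * (2 * K + 1)) + 20 * G.m := by ring
    exact ⟨h', hc', by omega⟩

end auction

/-! ### Correctness of the augmentation -/

section search

variable {E : Env} {G : Net} {K b z : ℕ} {s : St}

/-- The search goes on from a matching with `z` edges; the edges before `b` have been dealt with. -/
def Searching (G : Net) (b z : ℕ) (s : St) : Prop :=
  (s.v c = 0 → s.v fnd = 0 ∧ s.v top = 0) ∧ (s.v c ≠ 0 → s.v fnd = 1) ∧
    G.unscanned (s.a ptr) + s.v top ≤ G.m ∧ (matchedAgents G.n (s.a mate)).card = z ∧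
    G.SearchInv b (s.v c) (s.v top) (s.a mate) (s.a own) (s.a ptr) (s.a mrk) (s.a stk)

/-- An augmenting path has been found, and the matching has `z` edges. -/
def Found (G : Net) (z : ℕ) (s : St) : Prop :=
  s.v fnd = 1 ∧ s.v c = 0 ∧ (matchedAgents G.n (s.a mate)).card = z ∧
    Matched G.Adj (s.a mate) (s.a own) ∧ G.PtrOk (s.a ptr)

/-- The state during the search, which starts from a matching with `z` edges. -/
def SearchState (G : Net) (K b z : ℕ) (s : St) : Prop :=
  Static G K s ∧ (Searching G b z s ∨ Found G (z + 1) s)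

/-- The potential of a state of the search. -/
def St.searchPot (G : Net) (s : St) : ℕ :=
  40 * G.unscanned (s.a ptr) + 20 * s.v top + 20 * s.v fnd

theorem advance_spec (hB : G.m + 1 ≤ E.B) (hS : Static G K s) (hI : Searching G b z s)
    (hc : s.v c ≠ 0) (hp : s.v p = s.a ptr (s.v c)) (hp₀ : s.v p ≠ 0) :
    wp E advance (fun s' t => SearchState G K b z s' ∧ s'.v e = s.v e ∧
      t + 3 + s'.searchPot G ≤ s.searchPot G) s := by
  obtain ⟨-, hfnd, htop, hcard, hI⟩ := hI
  have hfnd := hfnd hc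
  rw [hp] at hp₀
  have hadj := hI.ptr_ok.adj hp₀
  have hpot := Net.unscanned_advance hI.ptr_ok hp₀
  have hM := hI.matched
  obtain ⟨hmate, hcn⟩ := hI.cur hc
  have hcard_take := hM.card_matchedAgents_take hc hmate hadj.obj_ne_zero hcn Net.Adj.agt_le
  rw [hcard] at hcard_take
  simp only [advance, takeObj, skip, SearchState, Searching, Found, St.searchPot, wp_seq, wp_const,
    wp_add, wp_sub, wp_load, wp_store, wp_ite, St.setV_v, St.setV_a, St.setA_v, St.setA_a,
    static_setV, static_setA, List.mem_cons, List.not_mem_nil, or_self, not_false_eq_true,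
    reduceCtorEq, if_true, if_false, hp, hS, hS.zero_eq, hS.one_eq, hS.nxt_eq, hS.obj_eq, hfnd,
    Nat.sub_zero, true_and]
  split_ifs with hmrk
  · exact ⟨by omega, Or.inl ⟨fun h => absurd h hc, fun _ => trivial, by omega, hcard,
      hI.skip hp₀ hmrk.ne'⟩, by omega⟩
  · refine ⟨by omega, ?_, by omega⟩
    by_cases hown : s.a own (G.obj (s.a ptr (s.v c))) = 0
    · exact Or.inr ⟨hown, hcard_take.trans (by rw [if_pos hown]),
        hM.take hc hmate hadj.obj_ne_zero hadj, hI.ptr_ok.advance hp₀⟩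
    · exact Or.inl ⟨fun h => absurd h hown, fun _ => trivial, by omega,
        hcard_take.trans (by rw [if_neg hown, add_zero]), hI.push hc hp₀ (by omega) hown⟩

theorem backtrack_spec (hS : Static G K s) (hI : Searching G b z s) (hc : s.v c ≠ 0)
    (hp : s.a ptr (s.v c) = 0) :
    wp E backtrack (fun s' t => SearchState G K b z s' ∧ s'.v e = s.v e ∧
      t + 3 + s'.searchPot G ≤ s.searchPot G) s := by
  obtain ⟨-, hfnd, htop, hcard, hI⟩ := hI
  have hfnd := hfnd hc
  obtain ⟨hmate, hcn⟩ := hI.cur hc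
  simp only [backtrack, takeObj, SearchState, Searching, Found, St.searchPot, wp_seq, wp_const,
    wp_sub, wp_load, wp_store, wp_ite, St.setV_v, St.setV_a, St.setA_v, St.setA_a,
    static_setV, static_setA, List.mem_cons, List.not_mem_nil, or_self, not_false_eq_true,
    reduceCtorEq, if_true, if_false, hS, hS.zero_eq, hS.one_eq, hfnd, Nat.sub_zero, true_and]
  split_ifs with htop₀
  · obtain ⟨k, hk⟩ := Nat.exists_eq_succ_of_ne_zero htop₀.ne'
    rw [hk] at hI htop ⊢
    have hown := hI.path.own_ne k (Nat.lt_succ_self k)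
    have hadj := hI.path.adj_top (Nat.succ_pos k)
    have hcard_take :=
      hI.matched.card_matchedAgents_take hc hmate hadj.obj_ne_zero hcn Net.Adj.agt_le
    rw [Nat.succ_sub_one, if_neg hown, add_zero, hcard] at hcard_take
    exact ⟨Or.inl ⟨fun h => absurd h hown, fun _ => trivial, by omega, hcard_take, hI.pop hc hp⟩,
      by omega⟩
  · have htop₀ : s.v top = 0 := by omega
    rw [htop₀] at hI ⊢
    exact ⟨by omega, by omega,
      Or.inl ⟨fun _ => rfl, by omega, by omega, hcard, hI.fail hp⟩, by omega⟩

theorem searchStep_spec (hB : G.m + 1 ≤ E.B) (hI : SearchState G K b z s) (hc : s.v c ≠ 0) :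
    wp E searchStep (fun s' t => SearchState G K b z s' ∧ s'.v e = s.v e ∧
      t + 1 + s'.searchPot G ≤ s.searchPot G) s := by
  obtain ⟨hS, hI⟩ := hI
  replace hI : Searching G b z s := hI.resolve_right fun h => hc h.2.1
  have hS' : Static G K (s.setV p (s.a ptr (s.v c))) := (static_setV (by simp)).2 hS
  have hI' : Searching G b z (s.setV p (s.a ptr (s.v c))) := by
    simpa [Searching, St.setV_v, St.setV_a] using hI
  simp only [searchStep, wp_seq, wp_load, wp_ite, St.setV_v, reduceCtorEq, if_true, if_false,
    hS.zero_eq]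
  split_ifs with hp
  · refine wp_mono (advance_spec hB hS' hI' (by simpa [St.setV_v]) ?_ ?_) fun s' t ⟨h', he, ht⟩ =>
      ⟨h', he, ?_⟩
    · simp [St.setV_v, St.setV_a]
    · simpa [St.setV_v] using hp.ne'
    · simp only [St.searchPot, St.setV_a, St.setV_v, reduceCtorEq, if_false] at ht ⊢
      omega
  · refine wp_mono (backtrack_spec hS' hI' (by simpa [St.setV_v]) ?_) fun s' t ⟨h', he, ht⟩ =>
      ⟨h', he, ?_⟩
    · simpa [St.setV_v, St.setV_a] using hp
    · simp only [St.searchPot, St.setV_a, St.setV_v, reduceCtorEq, if_false] at ht ⊢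
      omega

theorem searchLoop_spec (hB : G.m + 1 ≤ E.B) (hI : SearchState G K b z s) :
    wp E (loop zero c searchStep) (fun s' t => SearchState G K b z s' ∧ s'.v e = s.v e ∧
      s'.v c = 0 ∧ t + s'.searchPot G ≤ s.searchPot G + 1) s := by
  refine wp_loop (fun s' => SearchState G K b z s' ∧ s'.v e = s.v e)
    (fun s' => s'.searchPot G) ⟨hI, rfl⟩ (fun s₁ ⟨h₁, he₁⟩ hc => ?_)
    fun s₁ t ⟨h₁, he₁⟩ hc ht => ⟨h₁, he₁, ?_, ht⟩
  · rw [h₁.1.zero_eq] at hc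
    exact wp_mono (searchStep_spec hB h₁ hc.ne') fun s₂ t ⟨h₂, he₂, ht⟩ =>
      ⟨⟨h₂, he₂.trans he₁⟩, ht⟩
  · rwa [h₁.1.zero_eq, Nat.pos_iff_ne_zero, not_not] at hc

theorem searchPick_spec (hB : 1 ≤ E.B) (hS : Static G K s) (hI : Searching G (s.v e) z s)
    (hc : s.v c = 0) (he : 1 ≤ s.v e) (he' : s.v e ≤ G.m) :
    wp E searchPick (fun s' t => SearchState G K (s.v e + 1) z s' ∧ s'.v e = s.v e ∧
      s'.searchPot G ≤ s.searchPot G + 20 ∧ t ≤ 5) s := by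
  obtain ⟨hidle, -, htop, hcard, hI⟩ := hI
  obtain ⟨hfnd, htop₀⟩ := hidle hc
  rw [hc, htop₀] at hI
  have hagt := (G.agt_mem _ he he').1
  simp only [searchPick, SearchState, Searching, St.searchPot, wp_seq, wp_const, wp_load, wp_ite,
    St.setV_v, St.setV_a, static_setV, List.mem_cons, List.not_mem_nil, or_self, not_false_eq_true,
    reduceCtorEq, if_true, if_false, hS, hS.zero_eq, hS.agt_eq, hfnd, htop₀, hcard, true_and]
  split_ifs with hmate
  · exact ⟨by omega, Or.inl ⟨fun _ => trivial, by omega, by omega,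
      hI.start he he' (Or.inl ⟨rfl, hmate.ne'⟩)⟩, by omega, by omega⟩
  · exact ⟨by omega, Or.inl ⟨by omega, fun _ => trivial, by omega,
      hI.start he he' (Or.inr ⟨rfl, by omega⟩)⟩, by omega, by omega⟩

/-- Between two edges of the search, either no augmenting path has been found or all further edges
are skipped. -/
def SearchEdgeState (G : Net) (K z : ℕ) (s : St) : Prop :=
  Static G K s ∧ s.v c = 0 ∧ 1 ≤ s.v e ∧ s.v e ≤ G.m + 1 ∧
    (Searching G (s.v e) z s ∨ s.v e = G.m + 1 ∧ Found G (z + 1) s)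

theorem searchEdge_spec (hB : G.m + 1 ≤ E.B) (hI : SearchEdgeState G K z s) (he : s.v e ≤ G.m) :
    wp E (searchPick ++ loop zero c searchStep ++ ite zero fnd (sub e lim one) skip)
      (fun s' t => s.v e ≤ s'.v e ∧ s'.v e ≤ G.m ∧ s'.v one = 1 ∧
        SearchEdgeState G K z (s'.setV e (s'.v e + 1)) ∧
        t + 2 + 40 * G.unscanned (s'.a ptr) ≤ 40 * G.unscanned (s.a ptr) + 50) s := by
  obtain ⟨hS, hc, he', -, hI | hI⟩ := hI
  swap
  · omega
  obtain ⟨hfnd, htop⟩ := hI.1 hc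
  rw [wp_seq, wp_seq]
  refine wp_mono (searchPick_spec (by omega) hS hI hc he' he) fun s₁ t₁ ⟨h₁, he₁, hpot₁, _⟩ => ?_
  refine wp_mono (searchLoop_spec hB h₁) fun s₂ t₂ ⟨⟨hS₂, h₂⟩, he₂, hc₂, ht₂⟩ => ?_
  simp only [St.searchPot, hfnd, htop] at hpot₁ ht₂
  rw [wp_ite, hS₂.zero_eq]
  obtain h₂ | h₂ := h₂
  · obtain ⟨hfnd₂, htop₂⟩ := h₂.1 hc₂
    rw [if_neg (by omega)]
    simp only [skip, SearchEdgeState, Searching, wp_const, St.setV_v, St.setV_a, static_setV,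
      List.mem_cons, List.not_mem_nil, or_self, not_false_eq_true, reduceCtorEq, if_true, if_false,
      he₂, he₁, hS₂.one_eq, true_and]
    exact ⟨by omega, le_rfl, he, ⟨hS₂, hc₂, by omega, by omega, Or.inl h₂⟩, by omega⟩
  · rw [h₂.1, if_pos one_pos]
    simp only [SearchEdgeState, Found, wp_sub, St.setV_v, St.setV_a, static_setV, List.mem_cons,
      List.not_mem_nil, or_self, not_false_eq_true, reduceCtorEq, if_true, if_false, hS₂.lim_eq,
      hS₂.one_eq, Nat.add_sub_cancel, true_and]
    exact ⟨he, le_rfl, ⟨hS₂, hc₂, by omega, le_rfl, Or.inr h₂⟩, by omega⟩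

theorem search_spec (hB : G.m + 1 ≤ E.B) (hS : Static G K s) (hc : s.v c = 0)
    (hI : G.SearchInv 1 0 0 (s.a mate) (s.a own) (s.a ptr) (s.a mrk) (s.a stk)) :
    wp E search (fun s' t => Static G K s' ∧ s'.v c = 0 ∧ Matched G.Adj (s'.a mate) (s'.a own) ∧
      G.PtrOk (s'.a ptr) ∧ t ≤ 90 * G.m + 4 ∧
      (s'.v fnd = 0 ∧ (∀ A f, G.Matchable A f → A.card ≤ (matchedAgents G.n (s'.a mate)).card) ∨
        s'.v fnd = 1 ∧ (matchedAgents G.n (s'.a mate)).card =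
          (matchedAgents G.n (s.a mate)).card + 1)) s := by
  simp only [search, wp_seq, wp_const]
  refine ⟨by omega, by omega, wp_forEdges hB
    (SearchEdgeState G K (matchedAgents G.n (s.a mate)).card)
    (fun s => 40 * G.unscanned (s.a ptr)) 50 ?_
    (fun s h => ⟨h.1.one_eq, h.1.lim_eq, h.2.2.1, h.2.2.2.1⟩)
    (fun s₁ h₁ he => searchEdge_spec hB h₁ he) fun s' t h' he ht => ?_⟩
  · simp only [SearchEdgeState, Searching, static_setV, St.setV_v, St.setV_a, List.mem_cons,
      List.not_mem_nil, or_self, not_false_eq_true, reduceCtorEq, if_true, if_false, hc, add_zero,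
      true_and]
    exact ⟨hS, le_rfl, by omega, Or.inl ⟨fun _ => trivial, absurd rfl, G.unscanned_le _, hI⟩⟩
  · obtain ⟨hS', hc', -, -, h' | ⟨-, hfnd, -, hcard, hM, hptr⟩⟩ := h'
    · have hle := G.unscanned_le (s.a ptr)
      obtain ⟨hidle, -, -, -, hI'⟩ := h'
      obtain ⟨hfnd, htop⟩ := hidle hc'
      rw [hc', htop, he] at hI'
      simp only [St.setV_a] at ht
      exact ⟨hS', hc', hI'.matched, hI'.ptr_ok, by omega, Or.inl ⟨hfnd, fun A f => hI'.card_le⟩⟩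
    · have hle := G.unscanned_le (s.a ptr)
      simp only [St.setV_a] at ht
      exact ⟨hS', hc', hM, hptr, by omega, Or.inr ⟨hfnd, hcard⟩⟩

theorem clear_spec (hB : G.m + 1 ≤ E.B) (hS : Static G K s) (hptr : G.PtrOk (s.a ptr)) :
    wp E clear (fun s' t => Static G K s' ∧ s'.v c = s.v c ∧ s'.a mate = s.a mate ∧
      s'.a own = s.a own ∧ G.PtrOk (s'.a ptr) ∧
      (∀ f, 1 ≤ f → f ≤ G.m → s'.a ptr (G.agt f) = G.hd (G.agt f)) ∧
      (∀ f, 1 ≤ f → f ≤ G.m → s'.a mrk (G.obj f) = 0) ∧ t ≤ 10 * G.m + 2) s := by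
  refine wp_forEdges hB (fun s' => Static G K s' ∧ s'.v c = s.v c ∧ s'.a mate = s.a mate ∧
      s'.a own = s.a own ∧ G.PtrOk (s'.a ptr) ∧ (1 ≤ s'.v e ∧ s'.v e ≤ G.m + 1) ∧
      (∀ f, 1 ≤ f → f < s'.v e → s'.a ptr (G.agt f) = G.hd (G.agt f)) ∧
      (∀ f, 1 ≤ f → f < s'.v e → s'.a mrk (G.obj f) = 0))
    (fun _ => 0) 10 ?_ (fun s h => ⟨h.1.one_eq, h.1.lim_eq, h.2.2.2.2.2.1⟩) ?_ ?_
  · simp only [static_setV, St.setV_v, St.setV_a, List.mem_cons, List.not_mem_nil, or_self,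
      not_false_eq_true, reduceCtorEq, if_true, if_false, true_and]
    exact ⟨hS, hptr, ⟨le_rfl, by omega⟩, fun f _ _ => by omega, fun f _ _ => by omega⟩
  · rintro s₁ ⟨hS₁, hc, hmate, hown, hptr, ⟨he, -⟩, hhd, hmrk⟩ hle
    simp only [wp_seq, wp_load, wp_store, St.setV_v, St.setV_a, St.setA_v, St.setA_a, static_setV,
      static_setA, List.mem_cons, List.not_mem_nil, or_self, not_false_eq_true, reduceCtorEq,
      if_true, if_false, hS₁, hS₁.zero_eq, hS₁.one_eq, hS₁.agt_eq, hS₁.obj_eq, hS₁.hd_eq, true_and]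
    refine ⟨le_rfl, hle, ⟨hc, hmate, hown, hptr.reset _, by omega, fun f hf hlt => ?_,
      fun f hf hlt => ?_⟩, by omega⟩
    · rw [Function.update_apply]
      split_ifs with hagt
      · rw [hagt]
      · exact hhd f hf (by grind)
    · rw [Function.update_apply]
      split_ifs with hobj
      · rfl
      · exact hmrk f hf (by grind)
  · rintro s' t ⟨hS', hc, hmate, hown, hptr, -, hhd, hmrk⟩ he ht
    rw [he] at hhd hmrk
    exact ⟨hS', hc, hmate, hown, hptr, fun f hf hle => hhd f hf (by omega),
      fun f hf hle => hmrk f hf (by omega), by omega⟩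

/-- The state between two searches. -/
def AugmentState (G : Net) (K : ℕ) (s : St) : Prop :=
  Static G K s ∧ s.v c = 0 ∧ Matched G.Adj (s.a mate) (s.a own) ∧ G.PtrOk (s.a ptr) ∧
    (s.v fnd = 0 ∧ (∀ A f, G.Matchable A f → A.card ≤ (matchedAgents G.n (s.a mate)).card) ∨
      s.v fnd = 1)

theorem clear_search_spec (hB : G.m + 1 ≤ E.B) (hI : AugmentState G K s) :
    wp E (clear ++ search) (fun s' t => AugmentState G K s' ∧
      (matchedAgents G.n (s.a mate)).card + s'.v fnd ≤ (matchedAgents G.n (s'.a mate)).card ∧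
      t ≤ 100 * G.m + 6) s := by
  obtain ⟨hS, hc, hM, hptr, -⟩ := hI
  rw [wp_seq]
  refine wp_mono (clear_spec hB hS hptr) ?_
  rintro s₁ t₁ ⟨hS₁, hc₁, hmate, hown, hptr₁, hhd, hmrk, ht₁⟩
  refine wp_mono (search_spec hB hS₁ (hc₁.trans hc)
    (.of_unmarked (by rwa [hmate, hown]) hptr₁ hhd hmrk)) ?_
  rintro s₂ t₂ ⟨hS₂, hc₂, hM₂, hptr₂, ht₂, hfnd⟩
  rw [hmate] at hfnd
  refine ⟨⟨hS₂, hc₂, hM₂, hptr₂, hfnd.imp_right And.left⟩, ?_, by omega⟩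
  rcases hfnd with ⟨hfnd, hmax⟩ | ⟨hfnd, hcard⟩
  · simpa [hfnd] using hmax _ _ (Net.matchable_matchedAgents hM)
  · rw [hfnd, hcard]

theorem augment_spec (hB : G.m + 1 ≤ E.B) (hS : Static G K s) (hc : s.v c = 0)
    (hM : Matched G.Adj (s.a mate) (s.a own)) (hptr : G.PtrOk (s.a ptr)) {d : ℕ}
    (hd : ∀ A f, G.Matchable A f → A.card ≤ (matchedAgents G.n (s.a mate)).card + d) :
    wp E augment (fun s' t => Static G K s' ∧ Matched G.Adj (s'.a mate) (s'.a own) ∧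
      (∀ A f, G.Matchable A f → A.card ≤ (matchedAgents G.n (s'.a mate)).card) ∧
      t ≤ (d + 1) * (100 * G.m + 7) + 2) s := by
  simp only [augment, wp_seq, wp_const]
  refine ⟨by omega, wp_loop (AugmentState G K)
    (fun s' => ((matchedAgents G.n (s.a mate)).card + d - (matchedAgents G.n (s'.a mate)).card +
      s'.v fnd) * (100 * G.m + 7)) ?_ (fun s₁ h₁ _ => ?_) fun s' t h' hlt ht => ?_⟩
  · simp only [AugmentState, static_setV, St.setV_v, St.setV_a, List.mem_cons, List.not_mem_nil,
      or_self, not_false_eq_true, reduceCtorEq, if_true, if_false]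
    exact ⟨hS, hc, hM, hptr, Or.inr trivial⟩
  · have hfnd : s₁.v fnd = 1 := by
      have hzero := h₁.1.zero_eq
      obtain ⟨-, -, -, -, ⟨hfnd, -⟩ | hfnd⟩ := h₁ <;> omega
    refine wp_mono (clear_search_spec hB h₁) fun s₂ t₂ ⟨h₂, _, _⟩ => ⟨h₂, ?_⟩
    have hle := hd _ _ (Net.matchable_matchedAgents h₂.2.2.1)
    have hdrop : ((matchedAgents G.n (s.a mate)).card + d - (matchedAgents G.n (s₂.a mate)).card +
        s₂.v fnd + 1) * (100 * G.m + 7) ≤ ((matchedAgents G.n (s.a mate)).card + d -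
        (matchedAgents G.n (s₁.a mate)).card + s₁.v fnd) * (100 * G.m + 7) :=
      Nat.mul_le_mul_right _ (by omega)
    rw [add_mul _ 1] at hdrop
    omega
  · obtain ⟨hS', -, hM', -, ⟨-, hmax⟩ | hfnd⟩ := h'
    · simp only [St.setV_v, St.setV_a, if_true, Nat.add_sub_cancel_left] at ht
      exact ⟨hS', hM', hmax, by omega⟩
    · rw [hS'.zero_eq] at hlt
      omega

end search

/-! ### Correctness of the completion and of the program -/

variable {E : Env} {G : Net} {K : ℕ} {s : St}

/-- The arrays `F`, `F'` hold a maximum matching of good edges, and `mate`, `own` hold a matching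
that extends it and cannot be extended further. -/
structure Net.IsGreedyMatching (G : Net) (F F' mate own : ℕ → ℕ) : Prop where
  matched_good : Matched G.Adj F F'
  card_le : ∀ A f, G.Matchable A f → A.card ≤ (matchedAgents G.n F).card
  matched : Matched G.AdjAll mate own
  extends_ : ∀ c, F c ≠ 0 → mate c = F c
  maximal : ∀ a b, G.AdjAll a b → mate a ≠ 0 ∨ own b ≠ 0

/-- The invariant of the completion of `F` before edge `b` is considered. Every output cell is up to
date, or empty with no edge of its agent considered yet. -/
structure CompleteInv (G : Net) (F : ℕ → ℕ) (b : ℕ) (mate own out : ℕ → ℕ) : Prop where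
  matched : Matched G.AdjAll mate own
  extends_ : ∀ c, F c ≠ 0 → mate c = F c
  maximal : ∀ f, 1 ≤ f → f < b → mate (G.agt f) ≠ 0 ∨ own (G.obj f) ≠ 0
  out_eq : ∀ x, out x = mate (x + 1) ∨ out x = 0 ∧ ∀ f, 1 ≤ f → f < b → G.agt f ≠ x + 1

namespace CompleteInv

variable {F mate own out : ℕ → ℕ} {b : ℕ}

theorem skip (h : CompleteInv G F b mate own out) (hb : 1 ≤ b) (hb' : b ≤ G.m)
    (hmax : mate (G.agt b) ≠ 0 ∨ own (G.obj b) ≠ 0) :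
    CompleteInv G F (b + 1) mate own (Function.update out (G.agt b - 1) (mate (G.agt b))) := by
  have hagt := (G.agt_mem b hb hb').1
  refine ⟨h.matched, h.extends_, fun f hf hf' => ?_, fun x => ?_⟩
  · rcases Nat.lt_succ_iff_lt_or_eq.1 hf' with hf' | rfl
    · exact h.maximal f hf hf'
    · exact hmax
  · have hout := h.out_eq x
    grind

theorem add (h : CompleteInv G F b mate own out) (hb : 1 ≤ b) (hb' : b ≤ G.m)
    (hmate : mate (G.agt b) = 0) (hown : own (G.obj b) = 0) :
    CompleteInv G F (b + 1) (Function.update mate (G.agt b) (G.obj b))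
      (Function.update own (G.obj b) (G.agt b)) (Function.update out (G.agt b - 1) (G.obj b)) := by
  have hagt := (G.agt_mem b hb hb').1
  have hobj := G.obj_pos b hb hb'
  refine ⟨h.matched.add (by omega) (by omega) hmate hown ⟨b, hb, hb', rfl, rfl⟩, fun c hc => ?_,
    fun f hf hf' => ?_, fun x => ?_⟩
  · have hext := h.extends_ c hc
    grind
  · have hmax := h.maximal f hf
    grind
  · have hout := h.out_eq x
    grind

theorem out_eq_mate (h : CompleteInv G F (G.m + 1) mate own out) (x : ℕ) :
    out x = mate (x + 1) := by
  obtain hout | ⟨hout, hagt⟩ := h.out_eq x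
  · exact hout
  by_contra hne
  obtain ⟨f, hf, hf', hfx, -⟩ := h.matched.adj_mate (x + 1) fun hzero => hne (hout.trans hzero.symm)
  exact hagt f hf (Nat.lt_succ_of_le hf') hfx

end CompleteInv

theorem complete_spec (hB : G.m + 1 ≤ E.B) (hn : G.n ≤ E.n) (hS : Static G K s)
    (hM : Matched G.Adj (s.a mate) (s.a own)) :
    wp E complete (fun s' t =>
      CompleteInv G (s.a mate) (G.m + 1) (s'.a mate) (s'.a own) s'.out ∧ t ≤ 20 * G.m + 2) s := by
  refine wp_forEdges hB (fun s' => (s'.v zero = 0 ∧ s'.v one = 1 ∧ s'.v lim = G.m + 1 ∧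
      s'.a agt = G.agt ∧ s'.a obj = G.obj) ∧ 1 ≤ s'.v e ∧ s'.v e ≤ G.m + 1 ∧
      CompleteInv G (s.a mate) (s'.v e) (s'.a mate) (s'.a own) s'.out)
    (fun _ => 0) 20 ?_ (fun s' h => ⟨h.1.2.1, h.1.2.2.1, h.2.1, h.2.2.1⟩) ?_ ?_
  · simp only [St.setV_v, St.setV_a, St.setV_out, reduceCtorEq, if_true, if_false, hS.zero_eq,
      hS.one_eq, hS.lim_eq, hS.agt_eq, hS.obj_eq, hS.out_eq, true_and]
    exact ⟨le_rfl, by omega, hM.mono fun _ _ => Net.Adj.adjAll, fun _ _ => rfl,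
      fun f _ _ => by omega, fun x => Or.inr ⟨rfl, fun f _ _ => by omega⟩⟩
  · rintro s₁ ⟨⟨hzero, hone, hlim, hagt, hobj⟩, he, -, hI⟩ he'
    obtain ⟨hpos, hle⟩ := G.agt_mem (s₁.v e) he he'
    simp only [RAMCode.skip, wp_seq, wp_load, wp_store, wp_sub, wp_out, wp_ite, wp_const,
      St.setV_v, St.setV_a, St.setV_out, St.setA_v, St.setA_a, St.setA_out, St.setOut_v,
      St.setOut_a, St.setOut_out, reduceCtorEq, if_true, if_false, hzero, hone, hlim, hagt, hobj,
      true_and, and_true, Function.update_self]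
    split_ifs with hmate hown
    · exact ⟨by omega, by omega, le_rfl, he',
        ⟨by omega, by omega, hI.skip he he' (Or.inl hmate.ne')⟩, by omega⟩
    · exact ⟨by omega, by omega, le_rfl, he',
        ⟨by omega, by omega, hI.skip he he' (Or.inr hown.ne')⟩, by omega⟩
    · exact ⟨by omega, le_rfl, he',
        ⟨by omega, by omega, hI.add he he' (by omega) (by omega)⟩, by omega⟩
  · rintro s' t ⟨-, -, -, hI⟩ he ht
    exact ⟨he ▸ hI, by omega⟩

/-- The edges that the input lists. The good ones are those of rank `0`. -/
def Env.net (E : Env) : Net where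
  n := E.n
  m := E.m
  agt e := if 1 ≤ e ∧ e ≤ E.m then E.inp 0 (e - 1) + 1 else 0
  obj e := if 1 ≤ e ∧ e ≤ E.m then E.inp 1 (e - 1) + 1 else 0
  good e := (1 ≤ e ∧ e ≤ E.m) ∧ E.inp 2 (e - 1) = 0
  agt_mem e h1 h2 := by
    have hlt := E.agt_lt (e - 1) (by omega)
    rw [if_pos ⟨h1, h2⟩]
    omega
  obj_pos e h1 h2 := by
    rw [if_pos ⟨h1, h2⟩]
    omega
  good_mem e h := h.1

section net

variable {f : ℕ}

theorem Env.net_agt (h : 1 ≤ f) (h' : f ≤ E.m) : E.net.agt f = E.inp 0 (f - 1) + 1 :=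
  if_pos ⟨h, h'⟩

theorem Env.net_obj (h : 1 ≤ f) (h' : f ≤ E.m) : E.net.obj f = E.inp 1 (f - 1) + 1 :=
  if_pos ⟨h, h'⟩

theorem Env.net_good (h : 1 ≤ f) (h' : f ≤ E.m) : E.net.good f ↔ E.inp 2 (f - 1) = 0 :=
  and_iff_right ⟨h, h'⟩

end net

theorem Net.lastGood_succ_of_good {b : ℕ} (h : G.good (b + 1)) (x : ℕ) :
    G.lastGood x (b + 1) = Function.update (G.lastGood · b) (G.agt (b + 1)) (b + 1) x := by
  classical
  unfold Net.lastGood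
  rw [Nat.findGreatest_succ, Function.update_apply]
  simp only [h, true_and, eq_comm]

theorem Net.lastGood_succ_of_not_good {b : ℕ} (h : ¬ G.good (b + 1)) (x : ℕ) :
    G.lastGood x (b + 1) = G.lastGood x b := by
  classical
  unfold Net.lastGood
  rw [Nat.findGreatest_succ, if_neg fun h' => h h'.1]

/-- The arrays hold the lists of the edges before `b`. -/
structure BuildInv (E : Env) (b : ℕ) (agt obj nxt hd : ℕ → ℕ) : Prop where
  agt_eq : ∀ f, agt f = if f < b then E.net.agt f else 0
  obj_eq : ∀ f, obj f = if f < b then E.net.obj f else 0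
  nxt_eq : ∀ f, nxt f = if f < b then E.net.nxt f else 0
  hd_eq : ∀ x, hd x = E.net.lastGood x (b - 1)

namespace BuildInv

variable {b : ℕ} {agt obj nxt hd : ℕ → ℕ}

theorem one (E : Env) : BuildInv E 1 0 0 0 0 := by
  constructor <;> intro f
  · simp +contextual [Env.net]
  · simp +contextual [Env.net]
  · simp +contextual [Env.net, Net.nxt]
  · simp [Net.lastGood]

theorem skip (h : BuildInv E b agt obj nxt hd) (hb : 1 ≤ b) (hgood : ¬ E.net.good b) :
    BuildInv E (b + 1) (Function.update agt b (E.net.agt b)) (Function.update obj b (E.net.obj b))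
      nxt hd := by
  obtain ⟨b, rfl⟩ := Nat.exists_eq_add_of_le' hb
  obtain ⟨hagt, hobj, hnxt, hhd⟩ := h
  refine ⟨by grind, by grind, fun f => ?_, fun x => ?_⟩
  · have hzero : E.net.nxt (b + 1) = 0 := if_neg hgood
    grind
  · rw [hhd, Nat.add_sub_cancel, Nat.add_sub_cancel, Net.lastGood_succ_of_not_good hgood]

theorem push (h : BuildInv E b agt obj nxt hd) (hb : 1 ≤ b) (hgood : E.net.good b) :
    BuildInv E (b + 1) (Function.update agt b (E.net.agt b)) (Function.update obj b (E.net.obj b))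
      (Function.update nxt b (hd (E.net.agt b))) (Function.update hd (E.net.agt b) b) := by
  obtain ⟨b, rfl⟩ := Nat.exists_eq_add_of_le' hb
  obtain ⟨hagt, hobj, hnxt, hhd⟩ := h
  refine ⟨by grind, by grind, fun f => ?_, fun x => ?_⟩
  · have hlast : E.net.nxt (b + 1) = E.net.lastGood (E.net.agt (b + 1)) (b + 1 - 1) := if_pos hgood
    grind
  · rw [funext hhd, Nat.add_sub_cancel, Nat.add_sub_cancel, Net.lastGood_succ_of_good hgood]

theorem eq_net (h : BuildInv E (E.m + 1) agt obj nxt hd) :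
    agt = E.net.agt ∧ obj = E.net.obj ∧ nxt = E.net.nxt ∧ hd = E.net.hd := by
  refine ⟨funext fun f => ?_, funext fun f => ?_, funext fun f => ?_, funext h.hd_eq⟩
  · rw [h.agt_eq, ite_eq_left_iff]
    exact fun hf => (if_neg (by omega)).symm
  · rw [h.obj_eq, ite_eq_left_iff]
    exact fun hf => (if_neg (by omega)).symm
  · rw [h.nxt_eq, ite_eq_left_iff]
    exact fun hf => (if_neg fun hgood => hf (by have := hgood.1.2; omega)).symm

end BuildInv

/-- The initial state. -/
def initState (E : Env) : St where
  v x := match x with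
    | .n => E.n
    | .q => E.q
    | .m => E.m
    | _ => 0
  a _ := 0
  out := 0

/-- The state while the edges are read. -/
def BuildState (E : Env) (s : St) : Prop :=
  (s.v zero = 0 ∧ s.v one = 1 ∧ s.v lim = E.m + 1 ∧ s.v cap = 0 ∧ s.v sq = 0 ∧ s.v c = 0 ∧
    s.v .n = E.n ∧ s.out = 0) ∧
  (s.a lvl = 0 ∧ s.a prc = 0 ∧ s.a mate = 0 ∧ s.a own = 0 ∧ s.a ptr = s.a hd) ∧
  1 ≤ s.v e ∧ s.v e ≤ E.m + 1 ∧ BuildInv E (s.v e) (s.a agt) (s.a obj) (s.a nxt) (s.a hd)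

theorem BuildState.static (h : BuildState E s) (he : s.v e = E.m + 1) : Static E.net 0 s := by
  obtain ⟨⟨hzero, hone, hlim, hcap, -, -, -, hout⟩, -, -, -, hI⟩ := h
  obtain ⟨hagt, hobj, hnxt, hhd⟩ := (he ▸ hI).eq_net
  exact ⟨hzero, hone, hlim, hcap, hagt, hobj, hnxt, hhd, hout⟩

theorem BuildState.auctionInv (h : BuildState E s) (he : s.v e = E.m + 1) (K : ℕ) :
    E.net.AuctionInv K 1 0 (s.a lvl) (s.a prc) (s.a mate) (s.a own) (s.a ptr) := by
  have hhd := (h.static he).hd_eq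
  obtain ⟨-, ⟨hlvl, hprc, hmate, hown, hptr⟩, -⟩ := h
  exact .of_eq_zero (congrFun hlvl) (congrFun hprc) (congrFun hmate) (congrFun hown)
    (hptr.trans hhd)

theorem build_spec (E : Env) :
    wp E build (fun s' t => BuildState E s' ∧ s'.v e = E.m + 1 ∧ t ≤ 20 * E.m + 4)
      (initState E) := by
  have hB := E.size_le
  simp only [build, initState, wp_seq, wp_const, wp_add, St.setV_v, reduceCtorEq, if_true, if_false]
  refine ⟨by omega, by omega, wp_forEdges (M := E.m) (by omega) (BuildState E) (fun _ => 0) 20 ?_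
    (fun s h => ⟨h.1.2.1, h.1.2.2.1, h.2.2.1, h.2.2.2.1⟩) (fun s hI he => ?_)
    fun s' t h he ht => ⟨h, he, by omega⟩⟩
  · simp only [BuildState, St.setV_v, St.setV_a, St.setV_out, reduceCtorEq, if_true, if_false,
      true_and]
    exact ⟨le_rfl, by omega, BuildInv.one E⟩
  · obtain ⟨⟨hzero, hone, hlim, hcap, hsq, hc, hn, hout⟩, ⟨hlvl, hprc, hmate, hown, hptr⟩, he', -,
      hI⟩ := hI
    have hlt : s.v e - 1 < E.m := by omega
    have hagt : E.net.agt (s.v e) ≤ E.n := (E.net.agt_mem _ he' he).2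
    have hobj : E.net.obj (s.v e) ≤ E.q := (E.net_obj he' he).trans_le (E.obj_lt _ hlt)
    simp only [RAMCode.skip, BuildState, wp_seq, wp_load, wp_store, wp_add, wp_sub, wp_inp, wp_ite,
      wp_const, St.setV_v, St.setV_a, St.setV_out, St.setA_v, St.setA_a, St.setA_out,
      reduceCtorEq, if_true, if_false, hzero, hone, hlim, hcap, hsq, hc, hn, hout, hlvl, hprc,
      hmate, hown, hptr, ← Env.net_agt he' he, ← Env.net_obj he' he, true_and, and_true]
    split_ifs with hrank
    · exact ⟨hlt, by omega, hlt, by omega, hlt, by omega, le_rfl, he, ⟨by omega, by omega,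
        hI.skip he' (by rw [Env.net_good he' he]; omega)⟩, by omega⟩
    · exact ⟨hlt, by omega, hlt, by omega, hlt, le_rfl, he, ⟨by omega, by omega,
        hI.push he' (by rw [Env.net_good he' he]; omega)⟩, by omega⟩

theorem Static.setV_cap {K' : ℕ} (h : Static G K s) : Static G K' (s.setV cap K') := by
  obtain ⟨hzero, hone, hlim, -, hagt, hobj, hnxt, hhd, hout⟩ := h
  constructor <;>
    simp only [St.setV_v, St.setV_a, St.setV_out, reduceCtorEq, if_true, if_false, *]

theorem squareRoot_spec (hB : 4 * s.v .n + 4 ≤ E.B) (hS : Static G 0 s) (hsq : s.v sq = 0) :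
    wp E squareRoot (fun s' t => Static G (s'.v cap) s' ∧ s'.v c = s.v c ∧ s'.a = s.a ∧
      s.v .n ≤ s'.v cap * s'.v cap ∧ s'.v cap ≤ Nat.sqrt (s.v .n) + 1 ∧
      t ≤ 5 * Nat.sqrt (s.v .n) + 6) s := by
  refine wp_loop (fun s' => Static G (s'.v cap) s' ∧ s'.v c = s.v c ∧ s'.a = s.a ∧
      s'.v .n = s.v .n ∧ s'.v sq = s'.v cap * s'.v cap ∧ s'.v cap ≤ Nat.sqrt (s.v .n) + 1)
    (fun s' => 5 * (Nat.sqrt (s.v .n) + 1 - s'.v cap)) ?_ ?_ ?_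
  · exact ⟨hS.cap_eq ▸ hS, rfl, rfl, rfl, by rw [hsq, hS.cap_eq], by rw [hS.cap_eq]; omega⟩
  · rintro s₁ ⟨hS₁, hc, ha, hn, hsq₁, -⟩ hlt
    rw [hn, hsq₁] at hlt
    have hcap : s₁.v cap ≤ Nat.sqrt (s.v .n) := Nat.le_sqrt.2 hlt.le
    have hself : s₁.v cap ≤ s₁.v cap * s₁.v cap := Nat.le_mul_self _
    simp only [wp_seq, wp_add, St.setV_v, reduceCtorEq, if_true, if_false, hS₁.one_eq, hsq₁]
    exact ⟨by omega, by omega, by omega, ⟨(static_setV (by simp)).2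
      ((static_setV (by simp)).2 hS₁).setV_cap, hc, ha, hn, by ring, by omega⟩, by omega⟩
  · rintro s₁ t ⟨hS₁, hc, ha, hn, hsq₁, hcap⟩ hlt ht
    rw [hn, hsq₁] at hlt
    exact ⟨hS₁, hc, ha, by omega, hcap, by omega⟩

/-- The output is the array of mates of a greedy matching. -/
def Solved (E : Env) (out : ℕ → ℕ) : Prop :=
  ∃ F F' mate own, E.net.IsGreedyMatching F F' mate own ∧ ∀ x, out x = mate (x + 1)

theorem CompleteInv.solved {F F' mate own out : ℕ → ℕ}
    (h : CompleteInv E.net F (E.m + 1) mate own out) (hF : Matched E.net.Adj F F')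
    (hmax : ∀ A f, E.net.Matchable A f → A.card ≤ (matchedAgents E.n F).card) : Solved E out :=
  ⟨F, F', mate, own, ⟨hF, hmax, h.matched, h.extends_, fun _ _ ⟨f, hf, hf', hagt, hobj⟩ =>
    hagt ▸ hobj ▸ h.maximal f hf (Nat.lt_succ_of_le hf')⟩, h.out_eq_mate⟩

theorem Solved.of_m_eq_zero (hm : E.m = 0) : Solved E 0 := by
  have hadj : ∀ a b, ¬ E.net.AdjAll a b := fun a b ⟨f, hf, hf', _⟩ => by
    have : f ≤ E.m := hf'
    omega
  refine ⟨0, 0, 0, 0, ⟨.of_eq_zero (fun _ => rfl) fun _ => rfl, fun A f hA => ?_,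
    .of_eq_zero (fun _ => rfl) fun _ => rfl, fun _ _ => rfl, fun a b h => absurd h (hadj a b)⟩,
    fun _ => rfl⟩
  rw [Finset.eq_empty_of_forall_notMem fun a ha => hadj _ _ (hA.adj a ha).adjAll]
  exact Nat.zero_le _

theorem steps_le {S m K : ℕ} (hS : 1 ≤ S) (hm : 1 ≤ m) (hK : K ≤ S + 1) :
    5 * S + m * (60 * K + 50) + (K + 1) * (100 * m + 7) + 40 * m + 17 ≤ 1000 * (S * m + 1) := by
  have hSm : S ≤ S * m := Nat.le_mul_of_pos_right _ hm
  have hmS : m ≤ S * m := Nat.le_mul_of_pos_left _ hS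
  calc _ ≤ 5 * S + m * (60 * (S + 1) + 50) + (S + 1 + 1) * (100 * m + 7) + 40 * m + 17 := by gcongr
    _ = 160 * (S * m) + 350 * m + 12 * S + 31 := by ring
    _ ≤ _ := by omega

theorem main_spec (E : Env) :
    wp E main (fun s' t => t ≤ 1000 * (Nat.sqrt E.n * E.m + 1) ∧ Solved E s'.out)
      (initState E) := by
  have hB := E.size_le
  have hzero : (initState E).v zero = 0 := rfl
  have hm : (initState E).v .m = E.m := rfl
  simp only [main, RAMCode.skip, wp_ite, wp_const, wp_seq, hzero, hm]
  split_ifs with hpos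
  swap
  · exact ⟨by omega, by omega, .of_m_eq_zero (by omega)⟩
  have hn : 0 < E.n := Nat.zero_lt_of_lt (E.agt_lt 0 hpos)
  refine wp_mono (build_spec E) fun s₁ t₁ ⟨h₁, he₁, _⟩ => ?_
  obtain ⟨-, -, -, -, hsq₁, hc₁, hn₁, -⟩ := h₁.1
  refine wp_mono (squareRoot_spec (by omega) (h₁.static he₁) hsq₁)
    fun s₂ t₂ ⟨hS₂, hc₂, ha₂, hle, hcap, ht₂⟩ => ?_
  rw [hn₁] at hle hcap ht₂
  have hsqrt := Nat.sqrt_le_self E.n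
  have hK : 0 < s₂.v cap := Nat.pos_of_mul_pos_left (hn.trans_le hle)
  have hI₂ : AuctionState E.net (s₂.v cap) 1 s₂ :=
    ⟨hS₂, by rw [hc₂, hc₁, ha₂]; exact h₁.auctionInv he₁ _⟩
  refine wp_mono (auction_spec (by omega) (show E.m + 1 ≤ E.B by omega) hI₂ (hc₂.trans hc₁))
    fun s₃ t₃ ⟨⟨hS₃, hI₃⟩, hc₃, ht₃⟩ => ?_
  rw [hc₃] at hI₃
  refine wp_mono (augment_spec (show E.m + 1 ≤ E.B by omega) hS₃ hc₃ hI₃.matched hI₃.ptr_ok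
    fun A f hA => hI₃.card_le hA hle hK) fun s₄ t₄ ⟨hS₄, hM₄, hmax, ht₄⟩ => ?_
  refine wp_mono (complete_spec (show E.m + 1 ≤ E.B by omega) le_rfl hS₄ hM₄)
    fun s₅ t₅ ⟨hI₅, ht₅⟩ => ⟨?_, hI₅.solved hM₄ hmax⟩
  have htime := steps_le (Nat.le_sqrt.2 hn) hpos hcap
  change t₃ ≤ E.m * _ + 2 at ht₃
  change t₄ ≤ _ * (100 * E.m + 7) + 2 at ht₄
  change t₅ ≤ 20 * E.m + 2 at ht₅
  omega

end RAMCode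

/-! ### From the output back to the instance -/

namespace HAInstance

open RAMCode

section Listing

variable {n q : ℕ} {I : HAInstance (Fin n) (Fin q)} {e : List (Fin n × Fin q)}

theorem IsListing.length_eq (he : I.IsListing e) : e.length = I.numPairs := by
  classical
  have hset : e.toFinset = (Finset.univ.sigma I.acc).map
      (Equiv.sigmaEquivProd (Fin n) (Fin q)).toEmbedding := by
    ext ⟨i, o⟩
    simp [he.2, Equiv.sigmaEquivProd]
  rw [← List.toFinset_card_of_nodup he.1, hset, Finset.card_map, Finset.card_sigma, numPairs]

theorem rank_le_numPairs {i : Fin n} {o : Fin q} (ho : o ∈ I.acc i) :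
    I.rank i o ≤ I.numPairs := by
  classical
  have hsub : Finset.range (I.rank i o) ⊆ (I.acc i).image (I.rank i) := fun r hr =>
    Finset.mem_image.2 (I.rank_dense i o ho r (Finset.mem_range.1 hr))
  calc I.rank i o = (Finset.range (I.rank i o)).card := (Finset.card_range _).symm
    _ ≤ (I.acc i).card := (Finset.card_le_card hsub).trans Finset.card_image_le
    _ ≤ I.numPairs := Finset.single_le_sum (f := fun i => (I.acc i).card)
      (fun _ _ => Nat.zero_le _) (Finset.mem_univ i)

theorem IsListing.mem_acc (he : I.IsListing e) {j : ℕ} (hj : j < e.length) :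
    e[j].2 ∈ I.acc e[j].1 :=
  (he.2 _).1 (List.getElem_mem hj)

theorem initialConfig_mem {j : ℕ} (hj : j < e.length) :
    (I.initialConfig e).mem (3 * j) = e[j].1 ∧ (I.initialConfig e).mem (3 * j + 1) = e[j].2 ∧
      (I.initialConfig e).mem (3 * j + 2) = I.rank e[j].1 e[j].2 := by
  have hget : e[j]? = some e[j] := List.getElem?_eq_getElem hj
  have hone : (3 * j + 1) / 3 = j := by omega
  have htwo : (3 * j + 2) / 3 = j := by omega
  simp [initialConfig, hget, hone, htwo, Nat.add_mod]

theorem initialConfig_mem_eq_zero {a : ℕ} (ha : 3 * e.length ≤ a) :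
    (I.initialConfig e).mem a = 0 := by
  have hget : e[a / 3]? = none := List.getElem?_eq_none (by omega)
  simp [initialConfig, hget]

/-- The data of the run on a listing of an instance. -/
def IsListing.env (he : I.IsListing e) : Env where
  n := n
  q := q
  m := I.numPairs
  B := 16 * (n + q + I.numPairs + 1)
  inp col j := (I.initialConfig e).mem (3 * j + col)
  size_le := by omega
  agt_lt j hj := (initialConfig_mem (he.length_eq ▸ hj)).1.trans_lt (Fin.isLt _)
  obj_lt j hj := (initialConfig_mem (he.length_eq ▸ hj)).2.1.trans_lt (Fin.isLt _)
  rank_le j hj := by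
    have hrank := rank_le_numPairs (he.mem_acc (he.length_eq ▸ hj))
    exact (initialConfig_mem (he.length_eq ▸ hj)).2.2.trans_le (by omega)

theorem IsListing.env_net_apply (he : I.IsListing e) {j : ℕ} (hj : j < e.length) :
    he.env.net.agt (j + 1) = e[j].1 + 1 ∧ he.env.net.obj (j + 1) = e[j].2 + 1 ∧
      (he.env.net.good (j + 1) ↔ I.IsFirstChoice e[j].1 e[j].2) := by
  have hle : j + 1 ≤ he.env.m := hj.trans_eq he.length_eq
  obtain ⟨hagt, hobj, hrank⟩ := initialConfig_mem (I := I) hj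
  refine ⟨(Env.net_agt (by omega) hle).trans (congrArg (· + 1) hagt),
    (Env.net_obj (by omega) hle).trans (congrArg (· + 1) hobj), ?_⟩
  rw [Env.net_good (by omega) hle, isFirstChoice_iff, and_iff_right (he.mem_acc hj), ← hrank]
  rfl

theorem IsListing.adjAll_iff (he : I.IsListing e) {a b : ℕ} :
    he.env.net.AdjAll a b ↔
      ∃ (i : Fin n) (o : Fin q), o ∈ I.acc i ∧ a = i + 1 ∧ b = o + 1 := by
  constructor
  · rintro ⟨f, hf, hf', rfl, rfl⟩
    obtain ⟨j, rfl⟩ := Nat.exists_eq_add_of_le' hf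
    have hj : j < e.length := Nat.lt_of_succ_le (hf'.trans_eq he.length_eq.symm)
    obtain ⟨hagt, hobj, -⟩ := he.env_net_apply hj
    exact ⟨_, _, he.mem_acc hj, hagt, hobj⟩
  · rintro ⟨i, o, ho, rfl, rfl⟩
    obtain ⟨j, hj, hget⟩ := List.getElem_of_mem ((he.2 (i, o)).2 ho)
    obtain ⟨hagt, hobj, -⟩ := he.env_net_apply hj
    rw [hget] at hagt hobj
    exact ⟨j + 1, by omega, hj.trans_eq he.length_eq, hagt, hobj⟩

theorem IsListing.adj_iff (he : I.IsListing e) {a b : ℕ} :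
    he.env.net.Adj a b ↔
      ∃ (i : Fin n) (o : Fin q), I.IsFirstChoice i o ∧ a = i + 1 ∧ b = o + 1 := by
  constructor
  · rintro ⟨f, hgood, rfl, rfl⟩
    obtain ⟨hf, hf'⟩ := he.env.net.good_mem f hgood
    obtain ⟨j, rfl⟩ := Nat.exists_eq_add_of_le' hf
    obtain ⟨hagt, hobj, hfirst⟩ := he.env_net_apply (hf'.trans_eq he.length_eq.symm)
    exact ⟨_, _, hfirst.1 hgood, hagt, hobj⟩
  · rintro ⟨i, o, ho, rfl, rfl⟩
    obtain ⟨j, hj, hget⟩ := List.getElem_of_mem ((he.2 (i, o)).2 ho.1)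
    obtain ⟨hagt, hobj, hfirst⟩ := he.env_net_apply hj
    rw [hget] at hagt hobj hfirst
    exact ⟨j + 1, hfirst.2 ho, hagt, hobj⟩

theorem IsListing.adjAll_succ_iff (he : I.IsListing e) {i : Fin n} {o : Fin q} :
    he.env.net.AdjAll (i + 1) (o + 1) ↔ o ∈ I.acc i := by
  simp [he.adjAll_iff, ← Fin.ext_iff]

theorem IsListing.adj_succ_iff (he : I.IsListing e) {i : Fin n} {o : Fin q} :
    he.env.net.Adj (i + 1) (o + 1) ↔ I.IsFirstChoice i o := by
  simp [he.adj_iff, ← Fin.ext_iff]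

theorem IsListing.mate_le (he : I.IsListing e) {mate own : ℕ → ℕ}
    (h : Matched he.env.net.AdjAll mate own) (c : ℕ) : mate c ≤ q := by
  by_contra! hlt
  obtain ⟨_, o, -, -, ho⟩ := he.adjAll_iff.1 (h.adj_mate c (by omega))
  omega

end Listing

section toMatching

variable {n q : ℕ} {mate : ℕ → ℕ}

/-- The matching that an array of mates holds, where `mate (i + 1) = o + 1` says that agent `i` gets
object `o`. -/
def toMatching (n q : ℕ) (mate : ℕ → ℕ) (i : Fin n) : Option (Fin q) :=
  if h : 0 < mate (i + 1) ∧ mate (i + 1) ≤ q then some ⟨mate (i + 1) - 1, by omega⟩ else none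

/-- The array of mates that holds a matching. -/
def toArray (M : Fin n → Option (Fin q)) (c : ℕ) : ℕ :=
  if h : 0 < c ∧ c ≤ n then (M ⟨c - 1, by omega⟩).elim 0 fun o => o + 1 else 0

theorem toMatching_eq_some {i : Fin n} {o : Fin q} :
    toMatching n q mate i = some o ↔ mate (i + 1) = o + 1 := by
  have ho := o.isLt
  unfold toMatching
  split_ifs with h
  · simp only [Option.some_inj, Fin.ext_iff]
    omega
  · simp only [false_iff]
    omega

theorem toMatching_ne_none {i : Fin n} (hle : mate (i + 1) ≤ q) :
    toMatching n q mate i ≠ none ↔ mate (i + 1) ≠ 0 := by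
  simp [toMatching, hle, Nat.pos_iff_ne_zero]

theorem outputs_toMatching {c : RAMConfig} {m : ℕ} (hle : ∀ a, mate a ≤ q)
    (hc : ∀ i : Fin n, c.mem (3 * m + i) = mate (i + 1)) : Outputs c m (toMatching n q mate) := by
  intro i
  rw [hc]
  cases hM : toMatching n q mate i with
  | some o => exact toMatching_eq_some.1 hM
  | none => exact not_not.1 fun hne => (toMatching_ne_none (hle _)).2 hne hM

theorem matchingSize_toMatching (hle : ∀ c, mate c ≤ q) :
    matchingSize (toMatching n q mate) = (matchedAgents n mate).card := by
  refine Finset.card_bij (fun i _ => (i : ℕ) + 1) (fun i hi => ?_)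
    (fun i _ j _ hij => Fin.ext (Nat.succ_injective hij)) fun c hc => ?_
  · rw [Finset.mem_filter, ← Option.ne_none_iff_isSome, toMatching_ne_none (hle _)] at hi
    exact mem_matchedAgents.2 ⟨by omega, hi.2⟩
  · obtain ⟨⟨hpos, hcn⟩, hmate⟩ := mem_matchedAgents.1 hc
    obtain ⟨c, rfl⟩ := Nat.exists_eq_add_of_le' hpos
    refine ⟨⟨c, hcn⟩, ?_, rfl⟩
    rw [Finset.mem_filter, ← Option.ne_none_iff_isSome, toMatching_ne_none (hle _)]
    exact ⟨Finset.mem_univ _, hmate⟩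

theorem toMatching_toArray (M : Fin n → Option (Fin q)) : toMatching n q (toArray M) = M := by
  ext i o
  rw [toMatching_eq_some, toArray, dif_pos ⟨Nat.succ_pos _, i.isLt⟩]
  change (M i).elim 0 (fun o => (o : ℕ) + 1) = o + 1 ↔ _
  cases M i <;> simp [Fin.ext_iff]

theorem toArray_le (M : Fin n → Option (Fin q)) (c : ℕ) : toArray M c ≤ q := by
  unfold toArray
  split_ifs with h
  · cases M ⟨c - 1, by omega⟩ with
    | none => exact Nat.zero_le _
    | some o => exact o.isLt
  · exact Nat.zero_le _

theorem exists_eq_some_of_mem_matchedAgents {M : Fin n → Option (Fin q)} {c : ℕ}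
    (hc : c ∈ matchedAgents n (toArray M)) :
    ∃ i o, M i = some o ∧ c = i + 1 ∧ toArray M c = o + 1 := by
  obtain ⟨⟨hpos, hcn⟩, hne⟩ := mem_matchedAgents.1 hc
  obtain ⟨c, rfl⟩ := Nat.exists_eq_add_of_le' hpos
  obtain ⟨o, ho⟩ := Option.ne_none_iff_exists'.1
    ((toMatching_ne_none (i := ⟨c, hcn⟩) (toArray_le M _)).2 hne)
  exact ⟨⟨c, hcn⟩, o, by rwa [← toMatching_toArray M], rfl, toMatching_eq_some.1 ho⟩

variable {I : HAInstance (Fin n) (Fin q)} {e : List (Fin n × Fin q)} {F F' own : ℕ → ℕ}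

theorem isMatching_toMatching {adj : ℕ → ℕ → Prop} (h : Matched adj mate own)
    (hadj : ∀ (i : Fin n) (o : Fin q), adj (i + 1) (o + 1) → o ∈ I.acc i) :
    I.IsMatching (toMatching n q mate) := by
  refine ⟨fun i o ho => ?_, fun i j o hi hj => ?_⟩
  · rw [toMatching_eq_some] at ho
    exact hadj i o (ho ▸ h.adj_mate _ (by omega))
  · rw [toMatching_eq_some] at hi hj
    have hown := h.own_mate (i + 1) (by omega)
    rw [hi, ← hj, h.own_mate (j + 1) (by omega)] at hown
    exact Fin.ext (by omega)

theorem IsListing.matchable_toArray (he : I.IsListing e) {M : Fin n → Option (Fin q)}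
    (hM : I.IsFirstChoiceMatching M) :
    he.env.net.Matchable (matchedAgents n (toArray M)) (toArray M) where
  adj a ha := by
    obtain ⟨i, o, ho, rfl, harr⟩ := exists_eq_some_of_mem_matchedAgents ha
    exact harr ▸ he.adj_succ_iff.2 (hM.2 i o ho)
  inj a ha b hb hab := by
    obtain ⟨i, o, ho, rfl, harr⟩ := exists_eq_some_of_mem_matchedAgents ha
    obtain ⟨j, o', ho', rfl, harr'⟩ := exists_eq_some_of_mem_matchedAgents hb
    obtain rfl : o = o' := Fin.ext (by omega)
    rw [hM.1.2 i j o ho ho']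

theorem IsListing.isMaximumFirstChoiceMatching_toMatching (he : I.IsListing e)
    (hF : Matched he.env.net.Adj F F')
    (hmax : ∀ A f, he.env.net.Matchable A f → A.card ≤ (matchedAgents n F).card) :
    I.IsMaximumFirstChoiceMatching (toMatching n q F) := by
  have hle := he.mate_le (hF.mono fun _ _ => Net.Adj.adjAll)
  refine ⟨⟨isMatching_toMatching hF fun i o h => he.adjAll_succ_iff.1 h.adjAll,
    fun i o ho => ?_⟩, fun M hM => ?_⟩
  · rw [toMatching_eq_some] at ho
    exact he.adj_succ_iff.1 (ho ▸ hF.adj_mate _ (by omega))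
  · rw [matchingSize_toMatching hle, ← toMatching_toArray M,
      matchingSize_toMatching (toArray_le M)]
    exact hmax _ _ (he.matchable_toArray hM)

theorem IsListing.isMaximalMatching_toMatching (he : I.IsListing e)
    (h : Matched he.env.net.AdjAll mate own)
    (hmax : ∀ a b, he.env.net.AdjAll a b → mate a ≠ 0 ∨ own b ≠ 0) :
    I.IsMaximalMatching (toMatching n q mate) := by
  refine ⟨isMatching_toMatching h fun i o => he.adjAll_succ_iff.1, fun i o ho => ?_⟩
  refine (hmax _ _ (he.adjAll_succ_iff.2 ho)).imp (toMatching_ne_none (he.mate_le h _)).2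
    fun hne => ?_
  obtain ⟨j, o', -, hj, -⟩ := he.adjAll_iff.1 (h.adj_own hne)
  exact ⟨j, toMatching_eq_some.2 (hj ▸ h.mate_own _ hne)⟩

theorem IsListing.isGreedyMatching_toMatching (he : I.IsListing e)
    (h : he.env.net.IsGreedyMatching F F' mate own) :
    I.IsGreedyMatching (toMatching n q mate) := by
  refine ⟨toMatching n q F, he.isMaximumFirstChoiceMatching_toMatching h.matched_good h.card_le,
    fun i o ho => ?_, he.isMaximalMatching_toMatching h.matched h.maximal⟩
  rw [toMatching_eq_some] at ho ⊢
  rw [h.extends_ _ (by omega), ho]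

end toMatching

/-! ### The running time on the random access machine -/

open RAMInstr RAMConfig

/-- Code that computes the base addresses of the output and the arrays. -/
def setup : RAMProgram := [add 6 2 2, add 6 6 2, add 5 6 0]

/-- The machine program that finds a greedy matching. -/
def program : RAMProgram := setup ++ compile setup.length main

section program

variable {n q : ℕ} {I : HAInstance (Fin n) (Fin q)} {e : List (Fin n × Fin q)}

theorem IsListing.initialConfig_boundedBy (he : I.IsListing e) :
    (I.initialConfig e).BoundedBy (32 * he.env.B) := by
  have hB := he.env.size_le
  have hn : he.env.n = n := rfl
  have hq : he.env.q = q := rfl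
  have hm : he.env.m = e.length := he.length_eq.symm
  refine ⟨fun r => ?_, fun a => ?_⟩
  · simp only [initialConfig]
    split_ifs <;> omega
  · by_cases ha : a / 3 < he.env.m
    · have hinp : (I.initialConfig e).mem (3 * (a / 3) + a % 3) ≤ he.env.B :=
        he.env.inp_le ⟨a % 3, Nat.mod_lt _ three_pos⟩ (a / 3) ha
      rw [Nat.div_add_mod] at hinp
      omega
    · rw [initialConfig_mem_eq_zero (by omega)]
      exact Nat.zero_le _

theorem IsListing.sim_setup (he : I.IsListing e) :
    Sim he.env (initState he.env) (setup.foldl exec (I.initialConfig e)) := by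
  have hB := he.env.size_le
  have hlen := he.length_eq
  have hn : he.env.n = n := rfl
  have hq : he.env.q = q := rfl
  have hm : he.env.m = I.numPairs := rfl
  have hzero : ∀ a, 3 * I.numPairs ≤ a → (I.initialConfig e).mem a = 0 := fun a ha =>
    initialConfig_mem_eq_zero (hlen ▸ ha)
  constructor
  · intro x
    cases x <;> simp [setup, RAMConfig.exec, initialConfig, initState, Var.reg, hlen, hn, hq, hm]
  · simp [setup, RAMConfig.exec, initialConfig, hlen, hn, hm]
    omega
  · simp [setup, RAMConfig.exec, initialConfig, hlen, hm]
    omega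
  · exact fun _ _ _ => rfl
  · exact fun i _ => hzero _ (by omega)
  · exact fun k i => hzero _ (by omega)
  · intro x
    cases x <;> simp only [initState] <;> omega
  · exact fun _ _ => Nat.zero_le _

theorem IsListing.reach_setup (he : I.IsListing e) :
    Reach program (32 * he.env.B) (I.initialConfig e) setup.length
      (setup.foldl exec (I.initialConfig e)) := by
  have hB := he.env.size_le
  have hn : he.env.n = n := rfl
  have hm : he.env.m = e.length := he.length_eq.symm
  have hcode : CodeAt program 0 program := fun j ins h => by rwa [Nat.zero_add]
  refine Reach.of_safe setup _ he.initialConfig_boundedBy ?_ hcode.append.1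
  simp [setup, Safe, RAMConfig.exec, initialConfig]
  omega

theorem IsListing.exists_reach_halted (he : I.IsListing e) :
    ∃ t c', t ≤ 10 * (1000 * (Nat.sqrt n * I.numPairs + 1)) + 3 ∧
      Reach program (32 * he.env.B) (I.initialConfig e) t c' ∧ program.length ≤ c'.pc ∧
      ∃ M, Outputs c' I.numPairs M ∧ I.IsGreedyMatching M := by
  obtain ⟨s, t, hruns, ht, F, F', mate, own, hM, hout⟩ := main_spec he.env
  have hcode : CodeAt program 0 program := fun j ins h => by rwa [Nat.zero_add]
  have hsetup := he.reach_setup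
  have hpc : (setup.foldl exec (I.initialConfig e)).pc = setup.length := rfl
  obtain ⟨t', c', ht', hmain, hS, hpc'⟩ := hruns.simulates program _ he.sim_setup hsetup.bounded
    (by rw [hpc, ← Nat.zero_add setup.length]; exact hcode.append.2)
  refine ⟨_, c', ?_, hsetup.trans hmain, ?_, toMatching n q mate,
    outputs_toMatching (he.mate_le hM.matched) fun i => (hS.out i i.isLt).trans (hout i),
    he.isGreedyMatching_toMatching hM⟩
  · change t ≤ 1000 * (Nat.sqrt n * I.numPairs + 1) at ht
    change 3 + t' ≤ _
    omega
  · rw [hpc', hpc, program, List.length_append]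

end program

theorem foundInSqrtTime_of_isGreedyMatching
    {Restriction : ∀ {n q : ℕ}, HAInstance (Fin n) (Fin q) → Prop}
    {Goal : ∀ {n q : ℕ}, HAInstance (Fin n) (Fin q) → (Fin n → Option (Fin q)) → Prop}
    (h : ∀ {n q : ℕ} (I : HAInstance (Fin n) (Fin q)) (M), Restriction I → I.IsGreedyMatching M →
      Goal I M) : FoundInSqrtTime Restriction Goal := by
  refine ⟨program, 20000, fun n q I e he hI => ?_⟩
  obtain ⟨t, c', ht, ⟨rfl, hbounded⟩, hpc, M, hout, hM⟩ := he.exists_reach_halted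
  have hB : 32 * he.env.B ≤ 20000 * (n + q + I.numPairs + 1) := by
    change 32 * (16 * (n + q + I.numPairs + 1)) ≤ _
    omega
  refine ⟨t, M, ?_, hpc, fun s hs => ⟨fun r => ((hbounded s hs).1 r).trans hB,
    fun a => ((hbounded s hs).2 a).trans hB⟩, hout, h I M hI hM⟩
  calc (t : ℝ) ≤ 10 * (1000 * (Nat.sqrt n * I.numPairs + 1)) + 3 := by exact_mod_cast ht
    _ ≤ 10 * (1000 * (Real.sqrt n * I.numPairs + 1)) + 3 := by
      gcongr
      exact Real.nat_sqrt_le_real_sqrt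
    _ ≤ (20000 : ℕ) * (Real.sqrt n * I.numPairs + 1) := by
      have hpos : 0 ≤ Real.sqrt n * I.numPairs := by positivity
      push_cast
      linarith

end HAInstance

open HAInstance

theorem mainTheorem7 :
    -- every list is a single tie
    ((∀ (N : Type u) (O : Type v) [Fintype N] [Fintype O] (I : HAInstance N O), I.SingleTie →
        (∃ M, I.MajorityStable M) ∧
        ∀ M, I.IsMaximumMatching M → I.MajorityStable M) ∧
      HAInstance.FoundInSqrtTime
        (fun I => I.SingleTie)
        (fun I M => I.MajorityStable M)) ∧
    -- dichotomous and complete lists, `|O| ≥ |N|`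
    ((∀ (N : Type u) (O : Type v) [Fintype N] [Fintype O] (I : HAInstance N O),
        I.Dichotomous → I.CompleteLists → Fintype.card N ≤ Fintype.card O →
        (∃ M, I.MajorityStable M) ∧
        ∀ F, I.IsMaximumFirstChoiceMatching F →
          (∃ M, I.IsCompletionOf M F) ∧
          ∀ M, I.IsCompletionOf M F → I.MajorityStable M) ∧
      HAInstance.FoundInSqrtTime
        (fun {n q} I => I.Dichotomous ∧ I.CompleteLists ∧ n ≤ q)
        (fun I M => I.MajorityStable M)) ∧
    -- dichotomous and complete lists, `|O| < |N|`
    ((∀ (N : Type u) (O : Type v) [Fintype N] [Fintype O] (I : HAInstance N O),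
        I.Dichotomous → I.CompleteLists → Fintype.card O < Fintype.card N →
        ∃ M, I.KStable (2 * (Fintype.card N : ℝ) / 3 + 1) M) ∧
      HAInstance.FoundInSqrtTime
        (fun {n q} I => I.Dichotomous ∧ I.CompleteLists ∧ q < n)
        (fun {n _} I M => I.KStable (2 * (n : ℝ) / 3 + 1) M)) := by
  refine ⟨⟨fun N O _ _ I h => ?_, foundInSqrtTime_of_isGreedyMatching fun I M h hM => ?_⟩,
    ⟨fun N O _ _ I hd hc hcard => ?_, foundInSqrtTime_of_isGreedyMatching fun I M h hM => ?_⟩,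
    ⟨fun N O _ _ I hd hc _ => ?_, foundInSqrtTime_of_isGreedyMatching fun I M h hM => ?_⟩⟩
  · obtain ⟨M, hM⟩ := I.exists_isGreedyMatching
    exact ⟨⟨M, h.majorityStable (h.isMaximumMatching hM)⟩, fun M hM => h.majorityStable hM⟩
  · exact h.majorityStable (h.isMaximumMatching hM)
  · obtain ⟨M, hM⟩ := I.exists_isGreedyMatching
    refine ⟨⟨M, hM.majorityStable hd hc hcard⟩, fun F hF => ⟨?_, fun M hM =>
      hM.majorityStable hd hF⟩⟩
    obtain ⟨M, hM, hext⟩ := hF.1.1.exists_isMaximalMatching_extends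
    exact ⟨M, isCompletionOf_of_isMaximalMatching hc hcard hM hext⟩
  · obtain ⟨hd, hc, hcard⟩ := h
    exact hM.majorityStable hd hc (by simpa using hcard)
  · obtain ⟨M, hM⟩ := I.exists_isGreedyMatching
    exact ⟨M, hM.kStable hd hc⟩
  · obtain ⟨hd, hc, -⟩ := h
    simpa using hM.kStable hd hc
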